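/- Let $d\ge 3$ be an integer, $0<s<1$ and $1<p<d$. Let $g\colon\mathbb{R}^d\setminus\{0\}\to\mathbb{R}$ be of one of the following two types, for some $0<r<R$: (i) (localized kernel) $g(x)=|x|^{-(d-1+s)}$ if $0<|x|\le r$, and $g(x)=0$ if $|x|\ge R$; (ii) (kernel with integrable tail) $g(x)=a\,|x|^{-(d-1+s)}$ if $0<|x|\le r$, and $g(x)=b\,|x|^{-\alpha}$ if $|x|\ge R$, for some $\alpha>d$ and $a,b>0$. Assume moreover that $g\in C^\infty(\mathbb{R}^d\setminus\{0\})$ is radial and that, for every $x\ne 0$, the function $\rho\in(0,\infty)\mapsto \rho^{d-1}g(\rho x)$ is non-increasing and convex. For $u\in C_c^\infty(\mathbb{R}^d)$ (real-valued) set $$\mathcal{G}u(x)=-\int_{\mathbb{R}^d}(u(x)-u(y))\,\nabla g(x-y)\,\mathrm{d}y ,$$ and for $k\ge 0$, $\tau\in\mathbb{R}$ set $T_k(\tau)=\max\{-k,\min\{\tau,k\}\}$ and $G_k(\tau)=\tau-T_k(\tau)$. For a measurable $v\colon\mathbb{R}^d\to\mathbb{R}$ and $y>0$ let $$v^*(y)=\inf\{\tau\ge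 0: |\{|v|>\tau\}|<y\},\qquad v^{**}(y)=\frac1y\int_0^y v^*(\tau)\,\mathrm{d}\tau,$$ and for $1<m<\infty$, $1\le q<\infty$ let $\|v\|_{L^{m,q}(\mathbb{R}^d)}=\Bigl(\int_0^\infty\bigl(\tau^{1/m}v^{**}(\tau)\bigr)^q\,\frac{\mathrm{d}\tau}{\tau}\Bigr)^{1/q}$. Then there exists a constant $C>0$, depending only on $d$, $s$, $p$ and $g$, such that for every $u\in C_c^\infty(\mathbb{R}^d)$ the integral defining $\mathcal{G}u(x)$ converges absolutely for every $x\in\mathbb{R}^d$, $\mathcal{G}u\in L^p(\mathbb{R}^d;\mathbb{R}^d)$, and there exists $k\ge 0$, namely $k=\|\mathcal{G}u\|_{L^p(\mathbb{R}^d)}$, such that $$\|G_k(u)\|_{L^{\frac{pd}{d-sp},\,p}(\mathbb{R}^d)}+\|T_k(u)\|_{L^{\frac{pd}{d-p},\,p}(\mathbb{R}^d)}\le C\,\|\mathcal{G}u\|_{L^p(\mathbb{R}^d)} .$$ -/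

import Mathlib

open MeasureTheory Set
open scoped ContDiff

noncomputable section

/-- The kernel of the localized fractional gradient: for some `0 < r < R`,
`g x = 1 / |x| ^ (d - 1 + s)` for `0 < |x| ≤ r`, and `g x = 0` for `|x| ≥ R`. -/
def IsLocalizedKernel (d : ℕ) (s : ℝ) (g : EuclideanSpace ℝ (Fin d) → ℝ) : Prop :=
  ∃ r R : ℝ, 0 < r ∧ r < R ∧
    (∀ x, x ≠ 0 → ‖x‖ ≤ r → g x = 1 / ‖x‖ ^ ((d : ℝ) - 1 + s)) ∧
    (∀ x, R ≤ ‖x‖ → g x = 0)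

/-- The kernel with integrable tail: for some `α > d`, `a, b > 0` and `0 < r < R`,
`g x = a / |x| ^ (d - 1 + s)` for `0 < |x| ≤ r`, and `g x = b / |x| ^ α` for `|x| ≥ R`. -/
def IsIntegrableTailKernel (d : ℕ) (s : ℝ) (g : EuclideanSpace ℝ (Fin d) → ℝ) : Prop :=
  ∃ α a b r R : ℝ, (d : ℝ) < α ∧ 0 < a ∧ 0 < b ∧ 0 < r ∧ r < R ∧
    (∀ x, x ≠ 0 → ‖x‖ ≤ r → g x = a / ‖x‖ ^ ((d : ℝ) - 1 + s)) ∧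
    (∀ x, R ≤ ‖x‖ → g x = b / ‖x‖ ^ α)

/-- `g` is smooth away from the origin and radial, and `ρ ↦ ρ ^ (d - 1) * g (ρ x)` is
non-increasing and convex on `(0, ∞)` for every `x ≠ 0`. -/
structure PositivityAssumption (d : ℕ) (g : EuclideanSpace ℝ (Fin d) → ℝ) : Prop where
  smooth : ContDiffOn ℝ ∞ g {0}ᶜ
  radial : ∀ x y, ‖x‖ = ‖y‖ → g x = g y
  antitone : ∀ x, x ≠ 0 → AntitoneOn (fun ρ : ℝ => ρ ^ (d - 1) * g (ρ • x)) (Ioi 0)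
  convex : ∀ x, x ≠ 0 → ConvexOn ℝ (Ioi 0) (fun ρ : ℝ => ρ ^ (d - 1) * g (ρ • x))

/-- The integrand `y ↦ (u x - u y) ∇g (x - y)` of the `𝒢`-fractional gradient at `x`. -/
def fracGradientIntegrand {d : ℕ} (g u : EuclideanSpace ℝ (Fin d) → ℝ)
    (x y : EuclideanSpace ℝ (Fin d)) : EuclideanSpace ℝ (Fin d) :=
  (u x - u y) • gradient g (x - y)

/-- The `𝒢`-fractional gradient `𝒢u (x) = - ∫ (u x - u y) ∇g (x - y) dy`. -/
def fracGradient {d : ℕ} (g u : EuclideanSpace ℝ (Fin d) → ℝ)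
    (x : EuclideanSpace ℝ (Fin d)) : EuclideanSpace ℝ (Fin d) :=
  -∫ y, fracGradientIntegrand g u x y

/-- The truncation `T_k (τ) = max {-k, min {τ, k}}`. -/
def truncT (k τ : ℝ) : ℝ := max (-k) (min τ k)

/-- The truncation `G_k (τ) = τ - T_k (τ)`. -/
def truncG (k τ : ℝ) : ℝ := τ - truncT k τ

/-- The decreasing rearrangement `v^* (y) = inf {τ ≥ 0 : |{|v| > τ}| < y}`, for `y > 0`.
The infimum is taken in `[0, ∞]`; the level `τ = ∞` always belongs to the set, so that the value
is `∞` precisely when no finite level is admissible. -/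
def decreasingRearrangement {d : ℕ} (v : EuclideanSpace ℝ (Fin d) → ℝ) (y : ℝ) : ENNReal :=
  sInf {τ : ENNReal | volume {x | τ < ‖v x‖ₑ} < ENNReal.ofReal y}

/-- The average `v^** (y) = (1 / y) ∫_0^y v^* (τ) dτ`, for `y > 0`. -/
def maximalRearrangement {d : ℕ} (v : EuclideanSpace ℝ (Fin d) → ℝ) (y : ℝ) : ENNReal :=
  (∫⁻ τ in Ioo 0 y, decreasingRearrangement v τ) / ENNReal.ofReal y

/-- The norm of the Lorentz space `L^{p,q}(ℝ^d)`, for `1 < p < ∞` and `1 ≤ q < ∞`: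
`(∫_0^∞ (τ ^ (1 / p) v^** (τ)) ^ q dτ / τ) ^ (1 / q)`, with values in `[0, ∞]`. -/
def lorentzNorm {d : ℕ} (p q : ℝ) (v : EuclideanSpace ℝ (Fin d) → ℝ) : ENNReal :=
  (∫⁻ τ in Ioi (0 : ℝ),
    (ENNReal.ofReal τ ^ (1 / p) * maximalRearrangement v τ) ^ q / ENNReal.ofReal τ) ^ (1 / q)

end

/-! Integration by parts turns the nonlocal gradient into a convolution, `𝒢u = g * ∇u`
(`inner_neg_integral_gradient`). Near the origin `g` is a multiple of the Riesz kernel of order `1 -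
s`, so with `β = (1 - s) / 2` its Fourier transform is `(1 + |ξ|²)^(-β) (c + 𝓕 σ)` with `c ≠ 0` and
`σ` integrable (`exists_symbol`). This symbol has no zeros: in polar coordinates the real part of `𝓕
g` is an integral over directions `w` of cosine transforms of `ρ^(d-1) g(ρ w)`. These are positive
by Pólya's criterion for convex functions, or by monotonicity when `w` is orthogonal to `ξ`
(`fourier_ne_zero`).

A Wiener lemma on `L^p` (`exists_eLpNorm_fourierInv_le_of_ne_zero`) then divides out `c + 𝓕 σ`.
Hence the smoothed derivatives `ψ_i`, with transforms `(1 + |ξ|²)^(-β) 𝓕(∂_i u)`, satisfy `‖ψ_i‖_p ≤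
C ‖𝒢u‖_p`. All multiplier bounds come from Young's inequality with an `L¹` kernel.

Next `u` is recovered from the `ψ_i` by splitting `𝓕 u` into `(1 + |ξ|²)⁻¹ 𝓕 u` and `|ξ|² (1 +
|ξ|²)⁻¹ 𝓕 u`. The first piece has its gradient in `L^p`, being a Bessel potential of the `ψ_i`, so
it is dominated by a Riesz potential of order one. The second is a sum of convolutions of the `ψ_i`
with derivatives of the Bessel kernel of order `1 + s`, which are bounded by a multiple of
`|x|^(s-d)`, so it is dominated by a Riesz potential of order `s`. Thus `|u| ≤ C I_1 f₁ + C I_s f₂`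
with `‖f_j‖_p ≤ C ‖𝒢u‖_p`.

Rearrangement turns this into `u* ≤ Ψ₁ + Ψ₂` with decreasing `Ψ_j`, where Hardy's inequalities bound
`t^(a_j) Ψ_j` in `L^p(dt/t)` by `C ‖𝒢u‖_p`, for `a₁ = 1/p - s/d` and `a₂ = 1/p - 1/d`
(`exists_lintegral_rieszBound_le`). With `k = ‖𝒢u‖_p` the bounds are homogeneous in `k`, so `u* < k`
beyond some `t₀ ≥ 1` independent of `u`. On `(0, t₀]`, where the rearrangement of `G_k(u)` lives,
`t^(a₁) ≤ C t^(a₂)`. For `T_k(u)`, the level `k` is a bound below `t₀`, and `t^(a₂) ≤ t^(a₁)` beyond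
it. Each truncation therefore tolerates the `Ψ_j` with the wrong exponent
(`exists_lorentzNorm_trunc_le`). -/

/-! ### Schur's test -/

section Schur

open ENNReal

/-- Schur's test for an integral operator with nonnegative kernel. -/
theorem lintegral_rpow_lintegral_mul_le {α β : Type*} [MeasurableSpace α] [MeasurableSpace β]
    {μ : Measure α} {ν : Measure β} [SFinite μ] [SFinite ν] {p : ℝ} (hp : 1 < p)
    {K : α → β → ℝ≥0∞} (hK : Measurable (Function.uncurry K))
    {A B : ℝ≥0∞} (hA : ∀ x, ∫⁻ y, K x y ∂ν ≤ A) (hB : ∀ y, ∫⁻ x, K x y ∂μ ≤ B)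
    {φ : β → ℝ≥0∞} (hφ : AEMeasurable φ ν) :
    ∫⁻ x, (∫⁻ y, K x y * φ y ∂ν) ^ p ∂μ ≤ A ^ (p - 1) * B * ∫⁻ y, φ y ^ p ∂ν := by
  have hp0 : 0 < p := zero_lt_one.trans hp
  have hK' : ∀ x, AEMeasurable (K x) ν := fun x => (hK.of_uncurry_left).aemeasurable
  set q := p / (p - 1) with hq
  have hpq : q.HolderConjugate p := (Real.HolderConjugate.conjExponent hp).symm
  -- Hölder after splitting `K = K^(1/q) K^(1/p)`, with `φ` attached to the second factor; the
  -- remaining integral in `x` is Tonelli.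
  have key : ∀ x, (∫⁻ y, K x y * φ y ∂ν) ^ p ≤ A ^ (p - 1) * ∫⁻ y, K x y * φ y ^ p ∂ν := by
    intro x
    have h1 : ∫⁻ y, K x y * φ y ∂ν = ∫⁻ y, ((fun y => K x y ^ (1 / q)) *
        fun y => K x y ^ (1 / p) * φ y) y ∂ν := by
      refine lintegral_congr fun y => ?_
      simp only [Pi.mul_apply]
      rw [← mul_assoc, ← ENNReal.rpow_add_of_nonneg _ _ (by have := hpq.pos; positivity)
        (by positivity)]
      have : 1 / q + 1 / p = 1 := by simpa using hpq.inv_add_inv_eq_one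
      rw [this, ENNReal.rpow_one]
    have h2 := ENNReal.lintegral_mul_le_Lp_mul_Lq ν hpq
      (f := fun y => K x y ^ (1 / q)) (g := fun y => K x y ^ (1 / p) * φ y)
      ((hK' x).pow_const _) (((hK' x).pow_const _).mul hφ)
    rw [← h1] at h2
    have e1 : ∀ y, (K x y ^ (1 / q)) ^ q = K x y := fun y => by
      rw [← ENNReal.rpow_mul, one_div_mul_cancel hpq.ne_zero, ENNReal.rpow_one]
    have e2 : ∀ y, (K x y ^ (1 / p) * φ y) ^ p = K x y * φ y ^ p := fun y => by
      rw [ENNReal.mul_rpow_of_nonneg _ _ hp0.le, ← ENNReal.rpow_mul,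
        one_div_mul_cancel hp0.ne', ENNReal.rpow_one]
    simp only [e1, e2] at h2
    calc (∫⁻ y, K x y * φ y ∂ν) ^ p
        ≤ ((∫⁻ y, K x y ∂ν) ^ (1 / q) * (∫⁻ y, K x y * φ y ^ p ∂ν) ^ (1 / p)) ^ p := by
          gcongr
      _ = (∫⁻ y, K x y ∂ν) ^ (p - 1) * ∫⁻ y, K x y * φ y ^ p ∂ν := by
          rw [ENNReal.mul_rpow_of_nonneg _ _ hp0.le, ← ENNReal.rpow_mul, ← ENNReal.rpow_mul,
            one_div_mul_cancel hp0.ne', ENNReal.rpow_one]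
          congr 2
          rw [hq]; field_simp
      _ ≤ _ := by
          gcongr
          exact hA x
  calc ∫⁻ x, (∫⁻ y, K x y * φ y ∂ν) ^ p ∂μ
      ≤ ∫⁻ x, A ^ (p - 1) * ∫⁻ y, K x y * φ y ^ p ∂ν ∂μ := lintegral_mono key
    _ ≤ A ^ (p - 1) * ∫⁻ y, ∫⁻ x, K x y * φ y ^ p ∂μ ∂ν := by
        have hm : AEMeasurable (Function.uncurry fun x y => K x y * φ y ^ p) (μ.prod ν) :=
          hK.aemeasurable.mul (hφ.pow_const p).comp_snd
        rw [← lintegral_lintegral_swap hm, lintegral_const_mul'' (A ^ (p - 1))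
          (f := fun x => ∫⁻ y, K x y * φ y ^ p ∂ν) hm.lintegral_prod_right']
    _ ≤ A ^ (p - 1) * ∫⁻ y, B * φ y ^ p ∂ν := by
        gcongr with y
        rw [lintegral_mul_const _ hK.of_uncurry_right]
        gcongr
        exact hB y
    _ = _ := by
        rw [lintegral_const_mul'' _ (hφ.pow_const p), mul_assoc]

end Schur

/-! ### Fourier transforms of integrable functions as `L^p` multipliers -/

section FourierMultiplier

open FourierTransform ENNReal Real

variable {E : Type*} [NormedAddCommGroup E] [InnerProductSpace ℝ E] [FiniteDimensional ℝ E]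
  [MeasurableSpace E] [BorelSpace E]

/-- Young's inequality `‖k ⋆ f‖_p ≤ ‖k‖_1 ‖f‖_p` for nonnegative functions. -/
theorem lintegral_rpow_conv_le {p : ℝ} (hp : 1 < p) {k f : E → ℝ≥0∞} (hk : Measurable k)
    (hf : AEMeasurable f) :
    ∫⁻ x, (∫⁻ y, k (x - y) * f y) ^ p ≤ (∫⁻ x, k x) ^ p * ∫⁻ y, f y ^ p := by
  have h := lintegral_rpow_lintegral_mul_le (μ := (volume : Measure E)) (ν := (volume : Measure E))
    hp (K := fun x y => k (x - y)) (hk.comp (measurable_fst.sub measurable_snd))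
    (A := ∫⁻ x, k x) (B := ∫⁻ x, k x) (fun x => (lintegral_sub_left_eq_self k x).le)
    (fun y => (lintegral_sub_right_eq_self k y).le) hf
  refine h.trans_eq ?_
  congr 1
  -- Schur gives `A^(p-1) * A`; merging the powers needs `A` neither `0` nor `∞`, so these two
  -- values are treated apart.
  rcases eq_or_ne (∫⁻ x, k x) 0 with h0 | h0
  · simp [h0, (zero_lt_one.trans hp)]
  rcases eq_or_ne (∫⁻ x, k x) ∞ with h1 | h1
  · simp [h1, hp, (zero_lt_one.trans hp)]
  · conv_lhs => rw [← ENNReal.rpow_one (∫⁻ x, k x)]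
    rw [← ENNReal.rpow_mul, ← ENNReal.rpow_add _ _ h0 h1]
    congr 1; ring

/-- The inverse Fourier transform of `𝓕 k * φ` is the convolution of `k` and `𝓕⁻ φ`. -/
theorem fourierInv_fourier_mul {k φ : E → ℂ} (hk : Integrable k) (hφ : Integrable φ) (x : E) :
    𝓕⁻ (fun ξ => 𝓕 k ξ * φ ξ) x = ∫ y, k (x - y) * 𝓕⁻ φ y := by
  have h1 : ∫ y, k (x - y) * 𝓕⁻ φ y = ∫ y, k y * 𝓕⁻ φ (x - y) := by
    rw [← integral_sub_left_eq_self _ _ x]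
    simp
  rw [h1, fourierInv_eq]
  have e : ∀ ξ y : E, 𝐞 (inner ℝ ξ x) • (𝐞 (-inner ℝ y ξ) • k y * φ ξ)
      = k y * 𝐞 (inner ℝ ξ (x - y)) • φ ξ := by
    intro ξ y
    rw [inner_sub_right, sub_eq_add_neg, AddChar.map_add_eq_mul, real_inner_comm ξ y]
    simp only [Circle.smul_def, smul_eq_mul, Circle.coe_mul]
    ring
  calc ∫ ξ, 𝐞 (inner ℝ ξ x) • (𝓕 k ξ * φ ξ)
      = ∫ ξ, ∫ y, k y * 𝐞 (inner ℝ ξ (x - y)) • φ ξ := by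
        refine integral_congr_ae (Filter.Eventually.of_forall fun ξ => ?_)
        simp only [← e, fourier_eq, ← integral_mul_const]
        simp_rw [Circle.smul_def]
        rw [integral_smul]
    _ = ∫ y, ∫ ξ, k y * 𝐞 (inner ℝ ξ (x - y)) • φ ξ := by
        refine integral_integral_swap ?_
        have : Integrable (fun z : E × E => φ z.1 * k z.2) (volume.prod volume) := hφ.mul_prod hk
        refine this.norm.mono' ?_ (Filter.Eventually.of_forall fun z => ?_)
        · refine hk.1.comp_snd.mul (AEStronglyMeasurable.smul ?_ hφ.1.comp_fst)
          exact (continuous_subtype_val.comp <| continuous_fourierChar.comp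
            (f := fun z : E × E => inner ℝ z.1 (x - z.2)) (by fun_prop)).aestronglyMeasurable
        · simp [Function.uncurry, Circle.norm_smul, mul_comm]
    _ = _ := by
        refine integral_congr_ae (Filter.Eventually.of_forall fun y => ?_)
        simp only
        rw [integral_const_mul, fourierInv_eq]

/-- Multiplication by `𝓕 k` is convolution with `k`, so Young's inequality bounds this multiplier on
`L^p` by `‖k‖_1`. It is the only source of multiplier bounds in the proof. -/
theorem eLpNorm_fourierInv_fourier_mul_le {p : ℝ} (hp : 1 < p) {k φ : E → ℂ} (hk : Integrable k)
    (hφ : Integrable φ) :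
    eLpNorm (𝓕⁻ fun ξ => 𝓕 k ξ * φ ξ) (ENNReal.ofReal p) ≤
      (∫⁻ x, ‖k x‖ₑ) * eLpNorm (𝓕⁻ φ) (ENNReal.ofReal p) := by
  have hp0 : 0 < p := zero_lt_one.trans hp
  have hpne : ENNReal.ofReal p ≠ 0 := by simpa using hp0
  set k' := hk.1.mk k with hk'
  have hkk : k =ᵐ[volume] k' := hk.1.ae_eq_mk
  have hk'm : StronglyMeasurable k' := hk.1.stronglyMeasurable_mk
  have hk'i : Integrable k' := hk.congr hkk
  have hF : (fun ξ => 𝓕 k ξ * φ ξ) = fun ξ => 𝓕 k' ξ * φ ξ := by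
    ext ξ; rw [fourier_congr_ae hkk]
  have hcont : AEMeasurable (fun y => ‖𝓕⁻ φ y‖ₑ) := by
    have : Continuous (𝓕⁻ φ) := by
      have h := VectorFourier.fourierIntegral_continuous (μ := (volume : Measure E))
        (L := -innerₗ E) Real.continuous_fourierChar (by simpa using by fun_prop) hφ
      exact h
    exact this.enorm.measurable.aemeasurable
  have hL : ∫⁻ x, ‖k x‖ₑ = ∫⁻ x, ‖k' x‖ₑ := lintegral_congr_ae (hkk.fun_comp _)
  rw [hF, hL, eLpNorm_eq_lintegral_rpow_enorm_toReal hpne ofReal_ne_top,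
    eLpNorm_eq_lintegral_rpow_enorm_toReal hpne ofReal_ne_top, ENNReal.toReal_ofReal hp0.le]
  have h := lintegral_rpow_conv_le hp (k := fun x => ‖k' x‖ₑ) hk'm.measurable.enorm hcont
  calc (∫⁻ x, ‖𝓕⁻ (fun ξ => 𝓕 k' ξ * φ ξ) x‖ₑ ^ p) ^ (1 / p)
      ≤ (∫⁻ x, (∫⁻ y, ‖k' (x - y)‖ₑ * ‖𝓕⁻ φ y‖ₑ) ^ p) ^ (1 / p) := by
        gcongr with x
        rw [fourierInv_fourier_mul hk'i hφ]
        refine (enorm_integral_le_lintegral_enorm _).trans_eq ?_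
        simp
    _ ≤ ((∫⁻ x, ‖k' x‖ₑ) ^ p * ∫⁻ y, ‖𝓕⁻ φ y‖ₑ ^ p) ^ (1 / p) := by gcongr
    _ = _ := by
        rw [ENNReal.mul_rpow_of_nonneg _ _ (by positivity), ← ENNReal.rpow_mul,
          mul_one_div_cancel hp0.ne', ENNReal.rpow_one]

end FourierMultiplier

/-! ### Continuity of translations in `L¹` and small multipliers -/

section Translation

open FourierTransform ENNReal Real Filter Topology Convolution

variable {E : Type*} [NormedAddCommGroup E] [InnerProductSpace ℝ E] [FiniteDimensional ℝ E]
  [MeasurableSpace E] [BorelSpace E]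

/-- The translation group acts continuously on `L¹`; the integral is the distance from the class of
`f` to its translate. -/
theorem continuous_lintegral_enorm_translate_sub {f : E → ℂ} (hf : Integrable f) :
    Continuous fun z : E => ∫⁻ x, ‖f (x - z) - f x‖ₑ := by
  have : Fact ((1 : ℝ≥0∞) ≠ ⊤) := ⟨one_ne_top⟩
  have hm : MemLp f 1 := memLp_one_iff_integrable.2 hf
  let F : Lp ℂ 1 (volume : Measure E) := hm.toLp f
  have hc : Continuous fun z : E => edist (DomAddAct.mk (-z) +ᵥ F) F := by
    refine Continuous.edist ?_ continuous_const
    exact (DomAddAct.mkHomeomorph.continuous.comp continuous_neg).vadd continuous_const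
  refine hc.congr fun z => ?_
  rw [Lp.edist_def, eLpNorm_one_eq_lintegral_enorm]
  refine lintegral_congr_ae ?_
  have h1 := DomAddAct.vadd_Lp_ae_eq (DomAddAct.mk (-z)) F
  have h2 : (F : E → ℂ) =ᵐ[volume] f := hm.coeFn_toLp
  have h3 : (fun x => F (-z +ᵥ x)) =ᵐ[volume] fun x => f (-z +ᵥ x) :=
    (measurePreserving_vadd (-z) (volume : Measure E)).quasiMeasurePreserving.ae_eq_comp h2
  filter_upwards [h1, h2, h3] with x a b c
  simp only [Pi.sub_apply, b]
  rw [a, Equiv.symm_apply_apply, c, vadd_eq_add, neg_add_eq_sub]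

theorem fourier_comp_inv_smul {f : E → ℂ} {t : ℝ} (ht : 0 < t) (ξ : E) :
    𝓕 (fun x => ((t ^ Module.finrank ℝ E)⁻¹ : ℝ) • f (t⁻¹ • x)) ξ = 𝓕 f (t • ξ) := by
  rw [fourier_eq, fourier_eq]
  have := Measure.integral_comp_smul (volume : Measure E)
    (fun y => 𝐞 (-inner ℝ y (t • ξ)) • f y) t⁻¹
  rw [abs_of_pos (by positivity), inv_pow, inv_inv] at this
  rw [(eq_inv_smul_iff₀ (by positivity)).2 this.symm, ← integral_smul]
  refine integral_congr_ae (Eventually.of_forall fun x => ?_)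
  simp only [inner_smul_left, inner_smul_right, Circle.smul_def]
  rw [smul_comm]
  congr 5
  simp; field_simp

/-- For integrable `μ`, `f` the function with Fourier transform `(𝓕 μ (t • ξ) - 𝓕 μ 0) * 𝓕 f ξ`
is small in `L¹` for small `t`. -/
theorem exists_fourier_eq_dilate_sub_mul {μ f : E → ℂ} (hμ : Integrable μ) (hf : Integrable f)
    {ε : ℝ≥0∞} (hε : 0 < ε) :
    ∃ t : ℝ, 0 < t ∧ ∃ k : E → ℂ, Integrable k ∧ ∫⁻ x, ‖k x‖ₑ ≤ ε ∧
      ∀ ξ, 𝓕 k ξ = (𝓕 μ (t • ξ) - 𝓕 μ 0) * 𝓕 f ξ := by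
  wlog hmeas : StronglyMeasurable μ ∧ StronglyMeasurable f generalizing μ f
  · obtain ⟨t, ht, k, h1, h2, h3⟩ := this (hμ.congr hμ.1.ae_eq_mk) (hf.congr hf.1.ae_eq_mk)
      ⟨hμ.1.stronglyMeasurable_mk, hf.1.stronglyMeasurable_mk⟩
    refine ⟨t, ht, k, h1, h2, fun ξ => ?_⟩
    rw [h3, fourier_congr_ae hμ.1.ae_eq_mk.symm, fourier_congr_ae hμ.1.ae_eq_mk.symm,
      fourier_congr_ae hf.1.ae_eq_mk.symm]
  obtain ⟨hμm, hfm⟩ := hmeas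
  -- The kernel will be `∫ μ(y) (f(x - t y) - f(x)) dy`, whose `L¹` norm is at most `∫ |μ(y)| w(t y)
  -- dy`. This tends to `w(0) ‖μ‖_1 = 0` as `t → 0`, by dominated convergence.
  set w : E → ℝ≥0∞ := fun z => ∫⁻ x, ‖f (x - z) - f x‖ₑ with hw
  have hwc : Continuous w := continuous_lintegral_enorm_translate_sub hf
  have hw2 : ∀ z, w z ≤ 2 * ∫⁻ x, ‖f x‖ₑ := fun z => by
    calc w z ≤ ∫⁻ x, (‖f (x - z)‖ₑ + ‖f x‖ₑ) := lintegral_mono fun x => enorm_sub_le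
      _ = (∫⁻ x, ‖f (x - z)‖ₑ) + ∫⁻ x, ‖f x‖ₑ :=
        lintegral_add_right _ hfm.enorm
      _ = _ := by rw [lintegral_sub_right_eq_self (fun x => ‖f x‖ₑ) z, two_mul]
  have hlim : Tendsto (fun t : ℝ => ∫⁻ y, ‖μ y‖ₑ * w (t • y)) (𝓝 0) (𝓝 0) := by
    have h0 : ∫⁻ y, ‖μ y‖ₑ * w ((0 : ℝ) • y) = 0 := by simp [hw]
    have := tendsto_lintegral_filter_of_dominated_convergence (μ := (volume : Measure E))
      (F := fun (t : ℝ) y => ‖μ y‖ₑ * w (t • y)) (f := fun y => ‖μ y‖ₑ * w ((0 : ℝ) • y))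
      (l := 𝓝 0) (fun y => ‖μ y‖ₑ * (2 * ∫⁻ x, ‖f x‖ₑ)) ?_ ?_ ?_ ?_
    · rwa [h0] at this
    · refine Eventually.of_forall fun t => ?_
      exact hμm.enorm.mul (hwc.comp (continuous_const_smul t)).measurable
    · refine Eventually.of_forall fun t => Eventually.of_forall fun y => ?_
      gcongr
      exact hw2 _
    · rw [lintegral_mul_const _ hμm.enorm]
      exact mul_ne_top hμ.2.ne (mul_ne_top (by simp) hf.2.ne)
    · refine Eventually.of_forall fun y => ?_
      refine ENNReal.Tendsto.const_mul ?_ (Or.inr enorm_ne_top)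
      exact (hwc.comp (continuous_id.smul continuous_const)).tendsto 0
  have hev : ∀ᶠ t : ℝ in 𝓝[>] 0, ∫⁻ y, ‖μ y‖ₑ * w (t • y) < ε :=
    (hlim.mono_left nhdsWithin_le_nhds).eventually_lt_const hε
  obtain ⟨t, htε, ht⟩ := (hev.and self_mem_nhdsWithin).exists
  have ht : 0 < t := ht
  set μt : E → ℂ := fun x => ((t ^ Module.finrank ℝ E)⁻¹ : ℝ) • μ (t⁻¹ • x) with hμt
  have hμti : Integrable μt :=
    (hμ.comp_smul (inv_ne_zero ht.ne')).smul ((t ^ Module.finrank ℝ E)⁻¹ : ℝ)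
  have hconv : Integrable (μt ⋆[ContinuousLinearMap.mul ℂ ℂ] f) :=
    hμti.integrable_convolution _ hf
  refine ⟨t, ht, fun x => (μt ⋆[ContinuousLinearMap.mul ℂ ℂ] f) x - 𝓕 μ 0 * f x,
    hconv.sub (hf.const_mul _), ?_, fun ξ => ?_⟩
  · refine le_trans ?_ htε.le
    have hae : ∀ᵐ x, Integrable fun y => μt y * f (x - y) :=
      hμti.ae_convolution_exists (ContinuousLinearMap.mul ℂ ℂ) hf
    have hpt : ∀ᵐ x, ‖(μt ⋆[ContinuousLinearMap.mul ℂ ℂ] f) x - 𝓕 μ 0 * f x‖ₑ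
        ≤ ∫⁻ y, ‖μ y‖ₑ * ‖f (x - t • y) - f x‖ₑ := by
      filter_upwards [hae] with x hx
      have hx' : Integrable fun y => μ y * f (x - t • y) := by
        have := (hx.comp_smul ht.ne').smul (t ^ Module.finrank ℝ E)
        refine this.congr (Eventually.of_forall fun y => ?_)
        simp only [hμt, Pi.smul_apply]
        rw [smul_mul_assoc, smul_smul, mul_inv_cancel₀ (by positivity), one_smul,
          inv_smul_smul₀ ht.ne']
      have h1 : (μt ⋆[ContinuousLinearMap.mul ℂ ℂ] f) x = ∫ y, μ y * f (x - t • y) := by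
        have := Measure.integral_comp_smul (volume : Measure E)
          (fun y => μ y * f (x - t • y)) t⁻¹
        rw [abs_of_pos (by positivity), inv_pow, inv_inv] at this
        rw [convolution_def, (eq_inv_smul_iff₀ (by positivity)).2 this.symm, ← integral_smul]
        refine integral_congr_ae (Eventually.of_forall fun y => ?_)
        simp [hμt, smul_smul, ht.ne', mul_assoc]
      have h2 : 𝓕 μ 0 * f x = ∫ y, μ y * f x := by
        rw [integral_mul_const, fourier_eq]; simp
      rw [h1, h2, ← integral_sub hx' (hμ.mul_const _)]
      refine (enorm_integral_le_lintegral_enorm _).trans_eq (lintegral_congr fun y => ?_)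
      rw [← mul_sub, enorm_mul]
    calc _ ≤ ∫⁻ x, ∫⁻ y, ‖μ y‖ₑ * ‖f (x - t • y) - f x‖ₑ := lintegral_mono_ae hpt
      _ = ∫⁻ y, ∫⁻ x, ‖μ y‖ₑ * ‖f (x - t • y) - f x‖ₑ := by
        refine lintegral_lintegral_swap (Measurable.aemeasurable ?_)
        refine (hμm.measurable.comp measurable_snd).enorm.mul (Measurable.enorm ?_)
        exact (hfm.measurable.comp (measurable_fst.sub (measurable_snd.const_smul t))).sub
          (hfm.measurable.comp measurable_fst)
      _ = _ := by
        refine lintegral_congr fun y => ?_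
        rw [lintegral_const_mul' _ _ enorm_ne_top]
  · have h1 : 𝓕 (fun x => (μt ⋆[ContinuousLinearMap.mul ℂ ℂ] f) x - 𝓕 μ 0 * f x) ξ
        = 𝓕 (μt ⋆[ContinuousLinearMap.mul ℂ ℂ] f) ξ - 𝓕 μ 0 * 𝓕 f ξ := by
      simp only [fourier_eq, smul_sub]
      rw [integral_sub ((Real.fourierIntegral_convergent_iff ξ).2 hconv)
        ((Real.fourierIntegral_convergent_iff ξ).2 (hf.const_mul _)), ← integral_const_mul]
      congr 1
      refine integral_congr_ae (Eventually.of_forall fun y => ?_)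
      simp only [Circle.smul_def, smul_eq_mul]; ring
    rw [h1, Real.fourier_mul_convolution_eq hμti hf, fourier_comp_inv_smul ht, sub_mul]

end Translation

/-! ### A Wiener lemma for `L^p` multipliers -/

section Wiener

open FourierTransform ENNReal Real Filter Topology

variable {E : Type*} [NormedAddCommGroup E] [InnerProductSpace ℝ E] [FiniteDimensional ℝ E]
  [MeasurableSpace E] [BorelSpace E]

theorem continuous_fourier_of_integrable {f : E → ℂ} (hf : Integrable f) : Continuous (𝓕 f) :=
  VectorFourier.fourierIntegral_continuous (μ := (volume : Measure E))
    (L := innerₗ E) Real.continuous_fourierChar (by simpa using by fun_prop) hf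

theorem continuous_fourierInv_of_integrable {f : E → ℂ} (hf : Integrable f) :
    Continuous (𝓕⁻ f) :=
  VectorFourier.fourierIntegral_continuous (μ := (volume : Measure E))
    (L := -innerₗ E) Real.continuous_fourierChar (by simpa using by fun_prop) hf

theorem norm_fourier_le {f : E → ℂ} (ξ : E) : ‖𝓕 f ξ‖ ≤ ∫ x, ‖f x‖ :=
  VectorFourier.norm_fourierIntegral_le_integral_norm _ _ _ _ _

theorem Integrable.fourier_mul {k φ : E → ℂ} (hk : Integrable k) (hφ : Integrable φ) :
    Integrable fun ξ => 𝓕 k ξ * φ ξ :=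
  hφ.bdd_mul (continuous_fourier_of_integrable hk).aestronglyMeasurable
    (Eventually.of_forall norm_fourier_le)

theorem fourierInv_add' {φ ψ : E → ℂ} (hφ : Integrable φ) (hψ : Integrable ψ) :
    𝓕⁻ (fun ξ => φ ξ + ψ ξ) = 𝓕⁻ φ + 𝓕⁻ ψ := by
  ext x
  have h1 : Integrable fun v => 𝐞 (inner ℝ v x) • φ v := by
    simpa using (Real.fourierIntegral_convergent_iff (-x)).2 hφ
  have h2 : Integrable fun v => 𝐞 (inner ℝ v x) • ψ v := by
    simpa using (Real.fourierIntegral_convergent_iff (-x)).2 hψ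
  simp only [Pi.add_apply, fourierInv_eq, smul_add]
  exact integral_add h1 h2

theorem fourierInv_const_mul (c : ℂ) (φ : E → ℂ) :
    𝓕⁻ (fun ξ => c * φ ξ) = c • 𝓕⁻ φ := by
  ext x
  simp only [Pi.smul_apply, fourierInv_eq, smul_eq_mul, ← integral_const_mul]
  refine integral_congr_ae (Eventually.of_forall fun y => ?_)
  simp only [Circle.smul_def, smul_eq_mul]; ring

theorem eLpNorm_fourierInv_add_le {p : ℝ≥0∞} (hp : 1 ≤ p) {φ ψ : E → ℂ} (hφ : Integrable φ)
    (hψ : Integrable ψ) :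
    eLpNorm (𝓕⁻ fun ξ => φ ξ + ψ ξ) p ≤ eLpNorm (𝓕⁻ φ) p + eLpNorm (𝓕⁻ ψ) p := by
  rw [fourierInv_add' hφ hψ]
  exact eLpNorm_add_le (continuous_fourierInv_of_integrable hφ).aestronglyMeasurable
    (continuous_fourierInv_of_integrable hψ).aestronglyMeasurable hp

theorem eLpNorm_fourierInv_const_mul (p : ℝ≥0∞) (c : ℂ) (φ : E → ℂ) :
    eLpNorm (𝓕⁻ fun ξ => c * φ ξ) p = ‖c‖ₑ * eLpNorm (𝓕⁻ φ) p := by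
  rw [fourierInv_const_mul, eLpNorm_const_smul]

theorem eLpNorm_fourierInv_sum_le {p : ℝ≥0∞} (hp : 1 ≤ p) {ι : Type*} (s : Finset ι)
    {φ : ι → E → ℂ} (hφ : ∀ i ∈ s, Integrable (φ i)) :
    eLpNorm (𝓕⁻ fun ξ => ∑ i ∈ s, φ i ξ) p ≤ ∑ i ∈ s, eLpNorm (𝓕⁻ (φ i)) p := by
  classical
  induction s using Finset.induction_on with
  | empty =>
    have : (𝓕⁻ fun _ : E => (0 : ℂ)) = 0 := by ext x; simp [fourierInv_eq]
    simp [this]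
  | insert a s ha ih =>
    simp only [Finset.sum_insert ha]
    refine (eLpNorm_fourierInv_add_le hp (hφ a (by simp))
      (integrable_finsetSum s fun i hi => hφ i (by simp [hi]))).trans ?_
    gcongr
    exact ih fun i hi => hφ i (by simp [hi])

/-- A smooth compactly supported function is the Fourier transform of an integrable function. -/
theorem exists_integrable_fourier_eq {χ : E → ℂ} (hχ : ContDiff ℝ ∞ χ)
    (hc : HasCompactSupport χ) : ∃ k : E → ℂ, Integrable k ∧ 𝓕 k = χ := by
  let X : SchwartzMap E ℂ := hc.toSchwartzMap hχ
  refine ⟨(𝓕⁻ X : SchwartzMap E ℂ), (𝓕⁻ X : SchwartzMap E ℂ).integrable, ?_⟩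
  rw [← SchwartzMap.fourier_coe, FourierTransform.fourier_fourierInv_eq]
  rfl

/-- Fourier transform of a modulation. -/
theorem fourier_modulate {f : E → ℂ} (η ξ : E) :
    𝓕 (fun x => 𝐞 (inner ℝ x η) • f x) ξ = 𝓕 f (ξ - η) := by
  rw [fourier_eq, fourier_eq]
  refine integral_congr_ae (Eventually.of_forall fun x => ?_)
  have : -inner ℝ x (ξ - η) = inner ℝ x η + -inner ℝ x ξ := by rw [inner_sub_right]; ring
  simp only [smul_smul]
  rw [this, AddChar.map_add_eq_mul, mul_comm]

/-- This cutoff serves two purposes: localizing near one frequency and, after dilation, isolating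
low frequencies. Being the transform of an `L¹` function, it is itself an admissible multiplier. -/
theorem exists_contDiffBump_fourier :
    ∃ m : E → ℂ, Integrable m ∧ ContDiff ℝ ∞ (𝓕 m) ∧ HasCompactSupport (𝓕 m) ∧
      ∀ ξ ∈ Metric.closedBall (0 : E) 1, 𝓕 m ξ = 1 := by
  let χ : ContDiffBump (0 : E) := ⟨1, 2, one_pos, one_lt_two⟩
  have h1 : ContDiff ℝ ∞ fun x : E => (χ x : ℂ) := Complex.ofRealCLM.contDiff.comp χ.contDiff
  have h2 : HasCompactSupport fun x : E => (χ x : ℂ) :=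
    χ.hasCompactSupport.comp_left (g := fun r : ℝ => (r : ℂ)) Complex.ofReal_zero
  obtain ⟨m, hm, hmχ⟩ := exists_integrable_fourier_eq h1 h2
  exact ⟨m, hm, hmχ ▸ h1, hmχ ▸ h2, fun ξ hξ => by
    rw [hmχ]; simp [χ.one_of_mem_closedBall hξ]⟩

/-- Near a frequency the Fourier transform of an integrable function is, up to a constant, the
Fourier transform of a function of small `L¹` norm. -/
theorem exists_fourier_eq_sub_const_near {σ : E → ℂ} (hσ : Integrable σ) (ξ₀ : E) {ε : ℝ≥0∞}
    (hε : 0 < ε) :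
    ∃ δ : ℝ, 0 < δ ∧ ∃ k : E → ℂ, Integrable k ∧ ∫⁻ x, ‖k x‖ₑ ≤ ε ∧
      ∀ ξ ∈ Metric.ball ξ₀ δ, 𝓕 k ξ = 𝓕 σ ξ - 𝓕 σ ξ₀ := by
  obtain ⟨m, hm, -, -, hm1⟩ := exists_contDiffBump_fourier (E := E)
  have hmod : ∀ (η : E) {f : E → ℂ}, Integrable f →
      Integrable fun x => 𝐞 (inner ℝ x η) • f x := fun η f hf => by
    simpa using (Real.fourierIntegral_convergent_iff (-η)).2 hf
  -- Modulating by `-ξ₀` moves the frequency to the origin, giving `(𝓕 σ (t ξ + ξ₀) - 𝓕 σ ξ₀) 𝓕 m ξ`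
  -- with small `L¹` kernel. Undoing the dilation and the modulation preserves the `L¹` norm, and
  -- the cutoff becomes `𝓕 m ((ξ - ξ₀)/t)`, which is one on the ball of radius `t`; hence `δ = t`.
  obtain ⟨t, ht, k, hk, hkε, hkF⟩ := exists_fourier_eq_dilate_sub_mul (hmod (-ξ₀) hσ) hm hε
  set k' : E → ℂ := fun x => ((t⁻¹ ^ Module.finrank ℝ E)⁻¹ : ℝ) • k (t⁻¹⁻¹ • x) with hk'
  have hk'i : Integrable k' := (hk.comp_smul (inv_ne_zero (inv_ne_zero ht.ne'))).smul
    ((t⁻¹ ^ Module.finrank ℝ E)⁻¹ : ℝ)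
  have hk'F : ∀ ξ, 𝓕 k' ξ = 𝓕 k (t⁻¹ • ξ) := fourier_comp_inv_smul (inv_pos.2 ht)
  refine ⟨t, ht, fun x => 𝐞 (inner ℝ x ξ₀) • k' x, hmod _ hk'i, ?_, fun ξ hξ => ?_⟩
  · simp only [Circle.smul_def, enorm_smul, hk']
    have : ∀ z : Circle, ‖(z : ℂ)‖ₑ = 1 := fun z => by simp [← ofReal_norm, Circle.norm_coe]
    simp only [this, one_mul, inv_inv]
    have h3 : Integrable fun x => k (t • x) := hk.comp_smul ht.ne'
    rw [lintegral_const_mul' _ _ enorm_ne_top, ← ofReal_integral_norm_eq_lintegral_enorm h3,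
      Measure.integral_comp_smul volume (fun x => ‖k x‖) t, smul_eq_mul,
      ENNReal.ofReal_mul (by positivity), ofReal_integral_norm_eq_lintegral_enorm hk,
      ← mul_assoc]
    refine le_trans (le_of_eq ?_) hkε
    convert one_mul _
    rw [← ofReal_norm, ← ENNReal.ofReal_mul (by positivity), ENNReal.ofReal_eq_one]
    simp [abs_of_pos ht, ht.ne']
  · rw [fourier_modulate, hk'F, hkF, smul_smul, mul_inv_cancel₀ ht.ne', one_smul,
      fourier_modulate, fourier_modulate, hm1]
    · simp
    · rw [mem_closedBall_zero_iff, norm_smul, norm_inv, Real.norm_of_nonneg ht.le,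
        inv_mul_le_iff₀ ht, mul_one]
      rw [Metric.mem_ball, dist_eq_norm] at hξ
      exact hξ.le

/-- The Fourier transform of an integrable function is small at infinity, in the algebra of
Fourier transforms of integrable functions. -/
theorem exists_fourier_eq_sub_mul_far {σ : E → ℂ} (hσ : Integrable σ) {ε : ℝ≥0∞} (hε : 0 < ε) :
    ∃ m : E → ℂ, Integrable m ∧ ContDiff ℝ ∞ (𝓕 m) ∧ HasCompactSupport (𝓕 m) ∧
      ∃ k : E → ℂ, Integrable k ∧ ∫⁻ x, ‖k x‖ₑ ≤ ε ∧ ∀ ξ, 𝓕 k ξ = (𝓕 m ξ - 1) * 𝓕 σ ξ := by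
  obtain ⟨m, hm, hm2, hm3, hm1⟩ := exists_contDiffBump_fourier (E := E)
  -- Now the roles are exchanged: the cutoff is dilated and `σ` stays fixed, with `𝓕 m 0 = 1`.
  obtain ⟨t, ht, k, hk, hkε, hkF⟩ := exists_fourier_eq_dilate_sub_mul hm hσ hε
  have e : (𝓕 fun x => ((t ^ Module.finrank ℝ E)⁻¹ : ℝ) • m (t⁻¹ • x)) = fun ξ => 𝓕 m (t • ξ) :=
    funext fun ξ => fourier_comp_inv_smul ht ξ
  refine ⟨fun x => ((t ^ Module.finrank ℝ E)⁻¹ : ℝ) • m (t⁻¹ • x),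
    (hm.comp_smul (inv_ne_zero ht.ne')).smul ((t ^ Module.finrank ℝ E)⁻¹ : ℝ), ?_, ?_,
    k, hk, hkε, fun ξ => ?_⟩
  · rw [e]; exact hm2.comp (contDiff_const_smul t)
  · rw [e]; exact hm3.comp_smul ht.ne'
  · rw [hkF, e, hm1 0 (by simp)]

/-- Near a frequency where the symbol `c + 𝓕 σ` does not vanish, it may be divided out. -/
theorem exists_eLpNorm_fourierInv_mul_le_near {p : ℝ} (hp : 1 < p) {σ : E → ℂ}
    (hσ : Integrable σ) {c : ℂ} {ξ₀ : E} (h0 : c + 𝓕 σ ξ₀ ≠ 0) :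
    ∃ δ : ℝ, 0 < δ ∧ ∀ m : E → ℂ, Integrable m → Function.support (𝓕 m) ⊆ Metric.ball ξ₀ δ →
      ∃ C : ℝ≥0∞, C ≠ ⊤ ∧ ∀ φ : E → ℂ, Integrable φ →
        eLpNorm (𝓕⁻ φ) (ENNReal.ofReal p) ≠ ⊤ →
        eLpNorm (𝓕⁻ fun ξ => 𝓕 m ξ * φ ξ) (ENNReal.ofReal p) ≤
          C * eLpNorm (𝓕⁻ fun ξ => (c + 𝓕 σ ξ) * φ ξ) (ENNReal.ofReal p) := by
  set a := c + 𝓕 σ ξ₀ with ha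
  have hp1 : 1 ≤ ENNReal.ofReal p := by simpa using hp.le
  have hapos : 0 < ‖a‖ₑ := by simpa using h0
  obtain ⟨δ, hδ, k, hk, hkε, hkF⟩ := exists_fourier_eq_sub_const_near hσ ξ₀
    (ENNReal.half_pos hapos.ne')
  refine ⟨δ, hδ, fun m hm hsupp => ⟨2 / ‖a‖ₑ * ∫⁻ x, ‖m x‖ₑ,
    mul_ne_top (ENNReal.div_ne_top (by simp) hapos.ne') hm.2.ne, fun φ hφ hfin => ?_⟩⟩
  set N : (E → ℂ) → ℝ≥0∞ := fun φ => eLpNorm (𝓕⁻ φ) (ENNReal.ofReal p) with hN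
  set φ' : E → ℂ := fun ξ => 𝓕 m ξ * φ ξ with hφ'
  have hφ'i : Integrable φ' := Integrable.fourier_mul hm hφ
  have hψφ : Integrable fun ξ => (c + 𝓕 σ ξ) * φ ξ := by
    simp only [add_mul]
    exact (hφ.const_mul c).add (Integrable.fourier_mul hσ hφ)
  have hfin' : N φ' ≠ ⊤ := ne_top_of_le_ne_top (mul_ne_top hm.2.ne hfin)
    (eLpNorm_fourierInv_fourier_mul_le hp hm hφ)
  -- On the support of `𝓕 m` the symbol is `a + 𝓕 k` with `‖k‖_1 ≤ |a| / 2`, so the error `𝓕 k * φ'`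
  -- costs at most half of the left side. Absorbing it requires the norm of `φ'` to be finite, which
  -- is why the statement assumes a finite norm for `φ`.
  have e : (fun ξ => a * φ' ξ) =
      fun ξ => 𝓕 m ξ * ((c + 𝓕 σ ξ) * φ ξ) + (-1) * (𝓕 k ξ * φ' ξ) := by
    ext ξ
    by_cases hξ : 𝓕 m ξ = 0
    · simp [hφ', hξ]
    · rw [hkF ξ (hsupp hξ), ha]; simp only [hφ']; ring
  have key : ‖a‖ₑ * N φ' ≤
      (∫⁻ x, ‖m x‖ₑ) * N (fun ξ => (c + 𝓕 σ ξ) * φ ξ) + ‖a‖ₑ / 2 * N φ' := by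
    calc ‖a‖ₑ * N φ' = N (fun ξ => a * φ' ξ) := (eLpNorm_fourierInv_const_mul _ _ _).symm
      _ ≤ N (fun ξ => 𝓕 m ξ * ((c + 𝓕 σ ξ) * φ ξ)) + N (fun ξ => (-1) * (𝓕 k ξ * φ' ξ)) := by
        rw [e]
        exact eLpNorm_fourierInv_add_le hp1 (Integrable.fourier_mul hm hψφ)
          ((Integrable.fourier_mul hk hφ'i).const_mul _)
      _ ≤ _ := by
        gcongr
        · exact eLpNorm_fourierInv_fourier_mul_le hp hm hψφ
        · simp only [hN, eLpNorm_fourierInv_const_mul]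
          rw [enorm_neg, enorm_one, one_mul]
          refine (eLpNorm_fourierInv_fourier_mul_le hp hk hφ'i).trans ?_
          gcongr
  have hX : ‖a‖ₑ / 2 * N φ' ≤ (∫⁻ x, ‖m x‖ₑ) * N (fun ξ => (c + 𝓕 σ ξ) * φ ξ) := by
    have h2 : ‖a‖ₑ * N φ' = ‖a‖ₑ / 2 * N φ' + ‖a‖ₑ / 2 * N φ' := by
      rw [← add_mul, ENNReal.add_halves]
    rw [h2] at key
    exact (ENNReal.add_le_add_iff_right
      (mul_ne_top (ENNReal.div_ne_top enorm_ne_top (by simp)) hfin')).1 key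
  calc N φ' = 2 / ‖a‖ₑ * (‖a‖ₑ / 2 * N φ') := by
        have h1 : 2 / ‖a‖ₑ * (‖a‖ₑ / 2) = (‖a‖ₑ⁻¹ * ‖a‖ₑ) * (2 * 2⁻¹) := by
          simp only [div_eq_mul_inv]; ring
        rw [← mul_assoc, h1, ENNReal.inv_mul_cancel hapos.ne' enorm_ne_top,
          ENNReal.mul_inv_cancel (by simp) (by simp), one_mul, one_mul]
    _ ≤ 2 / ‖a‖ₑ * ((∫⁻ x, ‖m x‖ₑ) * N (fun ξ => (c + 𝓕 σ ξ) * φ ξ)) := by gcongr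
    _ = _ := by rw [mul_assoc]

open scoped Manifold in
/-- A symbol `c + 𝓕 σ` with `c ≠ 0` and `σ` integrable which vanishes nowhere may be divided out,
on `L^p`. -/
theorem exists_eLpNorm_fourierInv_le_of_ne_zero {p : ℝ} (hp : 1 < p) {σ : E → ℂ}
    (hσ : Integrable σ) {c : ℂ} (hc : c ≠ 0) (h0 : ∀ ξ, c + 𝓕 σ ξ ≠ 0) :
    ∃ C : ℝ≥0∞, C ≠ ⊤ ∧ ∀ φ : E → ℂ, Integrable φ → eLpNorm (𝓕⁻ φ) (ENNReal.ofReal p) ≠ ⊤ →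
      eLpNorm (𝓕⁻ φ) (ENNReal.ofReal p) ≤
        C * eLpNorm (𝓕⁻ fun ξ => (c + 𝓕 σ ξ) * φ ξ) (ENNReal.ofReal p) := by
  have hp1 : 1 ≤ ENNReal.ofReal p := by simpa using hp.le
  have hcpos : 0 < ‖c‖ₑ := by simpa using hc
  -- Away from the low frequencies selected by `m`, `𝓕 σ` is a perturbation of the constant `c` of
  -- size at most `|c| / 2`. The compact support of `𝓕 m` is covered by finitely many balls of the
  -- local lemma.
  obtain ⟨m, hm, hm2, hm3, k, hk, hkε, hkF⟩ := exists_fourier_eq_sub_mul_far hσ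
    (ENNReal.half_pos hcpos.ne')
  choose δ hδ hloc using fun ξ => exists_eLpNorm_fourierInv_mul_le_near hp hσ (h0 ξ)
  obtain ⟨t, ht⟩ := hm3.isCompact.elim_finite_subcover (fun ξ => Metric.ball ξ (δ ξ))
    (fun _ => Metric.isOpen_ball) fun ξ _ => mem_iUnion.2 ⟨ξ, Metric.mem_ball_self (hδ ξ)⟩
  obtain ⟨ρ, hρ⟩ := SmoothPartitionOfUnity.exists_isSubordinate 𝓘(ℝ, E)
    (isClosed_tsupport (𝓕 m)) (fun i : t => Metric.ball i.1 (δ i.1))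
    (fun _ => Metric.isOpen_ball) (by simpa [iUnion_subtype] using ht)
  have hpiece : ∀ i : t, ∃ n : E → ℂ, Integrable n ∧ 𝓕 n = fun ξ => (ρ i ξ : ℂ) * 𝓕 m ξ := by
    intro i
    refine exists_integrable_fourier_eq ?_ hm3.mul_left
    exact (Complex.ofRealCLM.contDiff.comp (ρ i).contMDiff.contDiff).mul hm2
  choose n hn hnF using hpiece
  have hn2 : ∀ i : t, ∃ C : ℝ≥0∞, C ≠ ⊤ ∧ ∀ φ : E → ℂ, Integrable φ →
        eLpNorm (𝓕⁻ φ) (ENNReal.ofReal p) ≠ ⊤ →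
        eLpNorm (𝓕⁻ fun ξ => 𝓕 (n i) ξ * φ ξ) (ENNReal.ofReal p) ≤
          C * eLpNorm (𝓕⁻ fun ξ => (c + 𝓕 σ ξ) * φ ξ) (ENNReal.ofReal p) := by
    refine fun i => hloc i.1 (n i) (hn i) fun ξ hξ => hρ i (subset_tsupport _ ?_)
    rw [Function.mem_support, hnF] at hξ
    intro h
    simp [h] at hξ
  choose D hD hDn using hn2
  set M := ∫⁻ x, ‖m x‖ₑ with hM
  have hMt : M ≠ ⊤ := hm.2.ne
  set C₁ := ∑ i, D i with hC₁
  have hC₁t : C₁ ≠ ⊤ := ENNReal.sum_ne_top.2 fun i _ => hD i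
  refine ⟨2 * (C₁ + (1 + M) / ‖c‖ₑ), by finiteness [hcpos.ne'], fun φ hφ hfin => ?_⟩
  set N : (E → ℂ) → ℝ≥0∞ := fun φ => eLpNorm (𝓕⁻ φ) (ENNReal.ofReal p) with hN
  have hψφ : Integrable fun ξ => (c + 𝓕 σ ξ) * φ ξ := by
    simp only [add_mul]
    exact (hφ.const_mul c).add (Integrable.fourier_mul hσ hφ)
  have hmφ := Integrable.fourier_mul hm hφ
  set Ψ := N (fun ξ => (c + 𝓕 σ ξ) * φ ξ) with hΨ
  have hlow : N (fun ξ => 𝓕 m ξ * φ ξ) ≤ C₁ * Ψ := by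
    have e : (fun ξ => 𝓕 m ξ * φ ξ) = fun ξ => ∑ i, 𝓕 (n i) ξ * φ ξ := by
      ext ξ
      by_cases hξ : 𝓕 m ξ = 0
      · simp [hnF, hξ]
      · have h1 := ρ.sum_eq_one (subset_tsupport _ hξ)
        rw [finsum_eq_sum_of_fintype] at h1
        simp only [hnF]
        rw [← Finset.sum_mul, ← Finset.sum_mul, ← Complex.ofReal_sum, h1]
        simp
    rw [e, hC₁, Finset.sum_mul]
    refine (eLpNorm_fourierInv_sum_le hp1 _ fun i _ => Integrable.fourier_mul (hn i) hφ).trans ?_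
    exact Finset.sum_le_sum fun i _ => hDn i φ hφ hfin
  -- The high-frequency part `(1 - 𝓕 m) φ`. Here `c φ'' = (1 - 𝓕 m)(c + 𝓕 σ) φ + 𝓕 k φ`; the last
  -- term contributes half of the norm of the whole `φ`, absorbed only after the low-frequency bound
  -- is added.
  set φ'' : E → ℂ := fun ξ => φ ξ + (-1) * (𝓕 m ξ * φ ξ) with hφ''
  have hhigh : ‖c‖ₑ * N φ'' ≤ (1 + M) * Ψ + ‖c‖ₑ / 2 * N φ := by
    have e : (fun ξ => c * φ'' ξ) = fun ξ => ((c + 𝓕 σ ξ) * φ ξ +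
        (-1) * (𝓕 m ξ * ((c + 𝓕 σ ξ) * φ ξ))) + 𝓕 k ξ * φ ξ := by
      ext ξ
      rw [hkF]; simp only [hφ'']; ring
    have hmψφ := (Integrable.fourier_mul hm hψφ).const_mul (-1)
    calc ‖c‖ₑ * N φ'' = N (fun ξ => c * φ'' ξ) := (eLpNorm_fourierInv_const_mul _ _ _).symm
      _ ≤ N (fun ξ => (c + 𝓕 σ ξ) * φ ξ + (-1) * (𝓕 m ξ * ((c + 𝓕 σ ξ) * φ ξ))) +
          N (fun ξ => 𝓕 k ξ * φ ξ) := by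
        rw [e]
        exact eLpNorm_fourierInv_add_le hp1 (hψφ.add hmψφ) (Integrable.fourier_mul hk hφ)
      _ ≤ (Ψ + M * Ψ) + ‖c‖ₑ / 2 * N φ := by
        gcongr
        · refine (eLpNorm_fourierInv_add_le hp1 hψφ hmψφ).trans ?_
          gcongr
          rw [eLpNorm_fourierInv_const_mul, enorm_neg, enorm_one, one_mul]
          exact eLpNorm_fourierInv_fourier_mul_le hp hm hψφ
        · refine (eLpNorm_fourierInv_fourier_mul_le hp hk hφ).trans ?_
          gcongr
      _ = _ := by ring
  have hhigh' : N φ'' ≤ (1 + M) / ‖c‖ₑ * Ψ + N φ / 2 := by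
    have h1 : N φ'' = ‖c‖ₑ⁻¹ * (‖c‖ₑ * N φ'') := by
      rw [← mul_assoc, ENNReal.inv_mul_cancel hcpos.ne' enorm_ne_top, one_mul]
    rw [h1]
    calc ‖c‖ₑ⁻¹ * (‖c‖ₑ * N φ'') ≤ ‖c‖ₑ⁻¹ * ((1 + M) * Ψ + ‖c‖ₑ / 2 * N φ) := by gcongr
      _ = (1 + M) / ‖c‖ₑ * Ψ + (‖c‖ₑ⁻¹ * ‖c‖ₑ) * (N φ / 2) := by
        simp only [div_eq_mul_inv]; ring
      _ = _ := by rw [ENNReal.inv_mul_cancel hcpos.ne' enorm_ne_top, one_mul]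
  have htot : N φ ≤ (C₁ + (1 + M) / ‖c‖ₑ) * Ψ + N φ / 2 := by
    have e : φ = fun ξ => 𝓕 m ξ * φ ξ + φ'' ξ := by ext ξ; simp only [hφ'']; ring
    calc N φ = N (fun ξ => 𝓕 m ξ * φ ξ + φ'' ξ) := by rw [← e]
      _ ≤ N (fun ξ => 𝓕 m ξ * φ ξ) + N φ'' :=
        eLpNorm_fourierInv_add_le hp1 hmφ (hφ.add (hmφ.const_mul _))
      _ ≤ C₁ * Ψ + ((1 + M) / ‖c‖ₑ * Ψ + N φ / 2) := by gcongr
      _ = _ := by ring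
  have hhalf : N φ / 2 ≤ (C₁ + (1 + M) / ‖c‖ₑ) * Ψ := by
    have h2 : N φ = N φ / 2 + N φ / 2 := (ENNReal.add_halves _).symm
    have h3 : N φ / 2 + N φ / 2 ≤ (C₁ + (1 + M) / ‖c‖ₑ) * Ψ + N φ / 2 := h2 ▸ htot
    exact (ENNReal.add_le_add_iff_right (ENNReal.div_ne_top hfin (by simp))).1 h3
  calc N φ = 2 * (N φ / 2) := by rw [ENNReal.mul_div_cancel (by simp) (by simp)]
    _ ≤ 2 * ((C₁ + (1 + M) / ‖c‖ₑ) * Ψ) := by gcongr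
    _ = _ := by rw [mul_assoc]

end Wiener

/-! ### Hardy's inequalities on the half line with measure `dt / t` -/

section Hardy

open ENNReal

/-- The measure `dt / t` on `(0, ∞)`. -/
noncomputable def haarPos : Measure ℝ :=
  (volume.restrict (Ioi (0 : ℝ))).withDensity fun t => (ENNReal.ofReal t)⁻¹

instance : SFinite haarPos := by unfold haarPos; infer_instance

theorem lintegral_haarPos (f : ℝ → ℝ≥0∞) :
    ∫⁻ t, f t ∂haarPos = ∫⁻ t in Ioi (0 : ℝ), f t / ENNReal.ofReal t := by
  rw [haarPos, lintegral_withDensity_eq_lintegral_mul_non_measurable₀ _ (by fun_prop)]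
  · simp only [Pi.mul_apply, div_eq_mul_inv, mul_comm]
  · filter_upwards [ae_restrict_mem measurableSet_Ioi] with t ht
    simpa using ht

theorem lintegral_haarPos_congr {f g : ℝ → ℝ≥0∞} (h : ∀ t, 0 < t → f t = g t) :
    ∫⁻ t, f t ∂haarPos = ∫⁻ t, g t ∂haarPos := by
  rw [lintegral_haarPos, lintegral_haarPos]
  exact setLIntegral_congr_fun measurableSet_Ioi fun t ht => by simp only [h t ht]

theorem lintegral_haarPos_mono {f g : ℝ → ℝ≥0∞} (h : ∀ t, 0 < t → f t ≤ g t) :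
    ∫⁻ t, f t ∂haarPos ≤ ∫⁻ t, g t ∂haarPos := by
  rw [lintegral_haarPos, lintegral_haarPos]
  exact setLIntegral_mono' measurableSet_Ioi fun t ht => by gcongr; exact h t ht

theorem lintegral_Ioo_rpow_sub_one {a t : ℝ} (ha : 0 < a) (ht : 0 < t) :
    ∫⁻ τ in Ioo 0 t, ENNReal.ofReal (τ ^ (a - 1)) = ENNReal.ofReal (t ^ a / a) := by
  have hi : IntegrableOn (fun τ : ℝ => τ ^ (a - 1)) (Ioc 0 t) := by
    have := intervalIntegral.intervalIntegrable_rpow' (a := 0) (b := t) (r := a - 1) (by linarith)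
    rwa [intervalIntegrable_iff_integrableOn_Ioc_of_le ht.le] at this
  rw [setLIntegral_congr Ioo_ae_eq_Ioc, ← ofReal_integral_eq_lintegral_ofReal hi]
  · rw [← intervalIntegral.integral_of_le ht.le, integral_rpow (Or.inl (by linarith))]
    simp [ha.ne']
  · filter_upwards [ae_restrict_mem measurableSet_Ioc] with τ hτ
    exact Real.rpow_nonneg hτ.1.le _

theorem lintegral_Ioi_rpow_neg_sub_one {a t : ℝ} (ha : 0 < a) (ht : 0 < t) :
    ∫⁻ τ in Ioi t, ENNReal.ofReal (τ ^ (-a - 1)) = ENNReal.ofReal (t ^ (-a) / a) := by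
  have hi : IntegrableOn (fun τ : ℝ => τ ^ (-a - 1)) (Ioi t) :=
    integrableOn_Ioi_rpow_of_lt (by linarith) ht
  rw [← ofReal_integral_eq_lintegral_ofReal hi]
  · rw [integral_Ioi_rpow_of_lt (by linarith) ht]
    congr 1; simp
  · filter_upwards [ae_restrict_mem measurableSet_Ioi] with τ hτ
    exact Real.rpow_nonneg (ht.trans hτ).le _

theorem ofReal_rpow_div_ofReal {t : ℝ} (ht : 0 < t) (a : ℝ) :
    ENNReal.ofReal t ^ a / ENNReal.ofReal t = ENNReal.ofReal (t ^ (a - 1)) := by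
  rw [ENNReal.ofReal_rpow_of_pos ht, ← ENNReal.ofReal_div_of_pos ht, Real.rpow_sub_one ht.ne']

/-- Hardy's inequality for averages over `(0, t)`. -/
theorem lintegral_hardy_Ioo {p a : ℝ} (hp : 1 < p) (ha : 0 < a) {φ : ℝ → ℝ≥0∞}
    (hφ : Measurable φ) :
    ∫⁻ t, (ENNReal.ofReal t ^ (-a) *
        ∫⁻ τ in Ioo 0 t, ENNReal.ofReal τ ^ a * φ τ / ENNReal.ofReal τ) ^ p ∂haarPos ≤
      ENNReal.ofReal (1 / a) ^ p * ∫⁻ t, φ t ^ p ∂haarPos := by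
  set S : Set (ℝ × ℝ) := {z | z.2 < z.1 ∧ 0 < z.1} with hS
  have hSm : MeasurableSet S := (measurableSet_lt measurable_snd measurable_fst).inter
    (measurableSet_lt measurable_const measurable_fst)
  -- The kernel `(τ/t)^a` on `τ < t` is homogeneous of degree zero, so for `dt / t` both marginals
  -- are at most `1/a` and Schur's test applies. The condition `0 < t` in `S` makes the marginal
  -- bounds hold at all real arguments.
  set K : ℝ → ℝ → ℝ≥0∞ := fun t τ =>
    S.indicator (fun z => ENNReal.ofReal z.1 ^ (-a) * ENNReal.ofReal z.2 ^ a) (t, τ) with hK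
  have hKm : Measurable (Function.uncurry K) := by
    have : Measurable fun z : ℝ × ℝ => ENNReal.ofReal z.1 ^ (-a) * ENNReal.ofReal z.2 ^ a := by
      fun_prop
    exact this.indicator hSm
  have hrow : ∀ (ψ : ℝ → ℝ≥0∞) (t : ℝ), 0 < t → ∫⁻ τ, K t τ * ψ τ ∂haarPos =
      ENNReal.ofReal t ^ (-a) * ∫⁻ τ in Ioo 0 t, ENNReal.ofReal τ ^ a * ψ τ / ENNReal.ofReal τ := by
    intro ψ t ht
    rw [lintegral_haarPos, ← lintegral_const_mul' _ _ (by
      rw [ENNReal.ofReal_rpow_of_pos ht]; exact ofReal_ne_top),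
      ← lintegral_indicator measurableSet_Ioi, ← lintegral_indicator measurableSet_Ioo]
    refine lintegral_congr fun τ => ?_
    by_cases h0 : 0 < τ
    · by_cases h1 : τ < t
      · simp only [hK, hS, indicator, mem_Ioi, mem_ofPred_eq, mem_Ioo, h0, h1, ht, and_self,
          if_true, div_eq_mul_inv, mul_assoc]
      · simp [hK, hS, indicator, h0, h1]
    · simp [h0]
  have hA : ∀ t, ∫⁻ τ, K t τ ∂haarPos ≤ ENNReal.ofReal (1 / a) := by
    intro t
    rcases le_or_gt t 0 with ht | ht
    · have : ∀ τ, K t τ = 0 := fun τ => by simp [hK, hS, indicator, not_lt.2 ht]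
      simp [this]
    · have h := hrow (fun _ => 1) t ht
      simp only [mul_one] at h
      rw [h, setLIntegral_congr_fun measurableSet_Ioo fun τ hτ => ofReal_rpow_div_ofReal hτ.1 a,
        lintegral_Ioo_rpow_sub_one ha ht, ENNReal.ofReal_rpow_of_pos ht,
        ← ENNReal.ofReal_mul (by positivity), Real.rpow_neg ht.le]
      refine le_of_eq (congrArg _ ?_)
      have := (Real.rpow_pos_of_pos ht a).ne'
      field_simp
  have hB : ∀ τ, ∫⁻ t, K t τ ∂haarPos ≤ ENNReal.ofReal (1 / a) := by
    intro τ
    rcases le_or_gt τ 0 with hτ | hτ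
    · have : ∀ t, K t τ = 0 := fun t => by
        simp [hK, ENNReal.ofReal_of_nonpos hτ, ha, indicator]
      simp [this]
    · rw [lintegral_haarPos]
      have : ∫⁻ t in Ioi 0, K t τ / ENNReal.ofReal t =
          ∫⁻ t in Ioi τ, ENNReal.ofReal τ ^ a * ENNReal.ofReal (t ^ (-a - 1)) := by
        rw [← lintegral_indicator measurableSet_Ioi, ← lintegral_indicator measurableSet_Ioi]
        refine lintegral_congr fun t => ?_
        by_cases h1 : τ < t
        · have h0 := hτ.trans h1
          simp only [hK, hS, indicator, mem_Ioi, mem_ofPred_eq, h0, h1, and_self, if_true,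
            ← ofReal_rpow_div_ofReal h0, div_eq_mul_inv]
          ring
        · simp [hK, hS, indicator, h1]
      rw [this, lintegral_const_mul' _ _ (by
        rw [ENNReal.ofReal_rpow_of_pos hτ]; exact ofReal_ne_top),
        lintegral_Ioi_rpow_neg_sub_one ha hτ, ENNReal.ofReal_rpow_of_pos hτ,
        ← ENNReal.ofReal_mul (by positivity), Real.rpow_neg hτ.le]
      refine le_of_eq (congrArg _ ?_)
      have := (Real.rpow_pos_of_pos hτ a).ne'
      field_simp
  have h := lintegral_rpow_lintegral_mul_le hp hKm hA hB hφ.aemeasurable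
  rw [lintegral_haarPos_congr fun t ht => by rw [hrow φ t ht]] at h
  refine h.trans_eq ?_
  congr 1
  have h1 : ENNReal.ofReal (1 / a) ≠ 0 := by simpa using ha
  conv_lhs => rw [← ENNReal.rpow_one (ENNReal.ofReal (1 / a))]
  rw [← ENNReal.rpow_mul, ← ENNReal.rpow_add _ _ h1 ofReal_ne_top]
  congr 1; ring

/-- Hardy's inequality for tails `(t, ∞)`. -/
theorem lintegral_hardy_Ioi {p a : ℝ} (hp : 1 < p) (ha : 0 < a) {φ : ℝ → ℝ≥0∞}
    (hφ : Measurable φ) :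
    ∫⁻ t, (ENNReal.ofReal t ^ a *
        ∫⁻ τ in Ioi t, ENNReal.ofReal τ ^ (-a) * φ τ / ENNReal.ofReal τ) ^ p ∂haarPos ≤
      ENNReal.ofReal (1 / a) ^ p * ∫⁻ t, φ t ^ p ∂haarPos := by
  set S : Set (ℝ × ℝ) := {z | z.1 < z.2 ∧ 0 < z.1} with hS
  have hSm : MeasurableSet S := (measurableSet_lt measurable_fst measurable_snd).inter
    (measurableSet_lt measurable_const measurable_fst)
  -- The transposed kernel `(t/τ)^a` on `t < τ`, with the same marginals.
  set K : ℝ → ℝ → ℝ≥0∞ := fun t τ =>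
    S.indicator (fun z => ENNReal.ofReal z.1 ^ a * ENNReal.ofReal z.2 ^ (-a)) (t, τ) with hK
  have hKm : Measurable (Function.uncurry K) := by
    have : Measurable fun z : ℝ × ℝ => ENNReal.ofReal z.1 ^ a * ENNReal.ofReal z.2 ^ (-a) := by
      fun_prop
    exact this.indicator hSm
  have hrow : ∀ (ψ : ℝ → ℝ≥0∞) (t : ℝ), 0 < t → ∫⁻ τ, K t τ * ψ τ ∂haarPos =
      ENNReal.ofReal t ^ a * ∫⁻ τ in Ioi t, ENNReal.ofReal τ ^ (-a) * ψ τ / ENNReal.ofReal τ := by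
    intro ψ t ht
    rw [lintegral_haarPos, ← lintegral_const_mul' _ _ (by
      rw [ENNReal.ofReal_rpow_of_pos ht]; exact ofReal_ne_top),
      ← lintegral_indicator measurableSet_Ioi, ← lintegral_indicator measurableSet_Ioi]
    refine lintegral_congr fun τ => ?_
    by_cases h1 : t < τ
    · have h0 := ht.trans h1
      simp only [hK, hS, indicator, mem_Ioi, mem_ofPred_eq, h0, h1, ht, and_self,
          if_true, div_eq_mul_inv, mul_assoc]
    · simp [hK, hS, indicator, h1]
  have hA : ∀ t, ∫⁻ τ, K t τ ∂haarPos ≤ ENNReal.ofReal (1 / a) := by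
    intro t
    rcases le_or_gt t 0 with ht | ht
    · have : ∀ τ, K t τ = 0 := fun τ => by simp [hK, hS, indicator, not_lt.2 ht]
      simp [this]
    · have h := hrow (fun _ => 1) t ht
      simp only [mul_one] at h
      rw [h, setLIntegral_congr_fun measurableSet_Ioi fun τ hτ =>
          ofReal_rpow_div_ofReal (ht.trans hτ) (-a),
        lintegral_Ioi_rpow_neg_sub_one ha ht, ENNReal.ofReal_rpow_of_pos ht,
        ← ENNReal.ofReal_mul (by positivity), Real.rpow_neg ht.le]
      refine le_of_eq (congrArg _ ?_)
      have := (Real.rpow_pos_of_pos ht a).ne'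
      field_simp
  have hB : ∀ τ, ∫⁻ t, K t τ ∂haarPos ≤ ENNReal.ofReal (1 / a) := by
    intro τ
    rcases le_or_gt τ 0 with hτ | hτ
    · have : ∀ t, K t τ = 0 := fun t => by
        by_cases h : t < τ
        · simp [hK, hS, indicator, not_lt.2 (h.le.trans hτ)]
        · simp [hK, hS, indicator, h]
      simp [this]
    · rw [lintegral_haarPos]
      have : ∫⁻ t in Ioi 0, K t τ / ENNReal.ofReal t =
          ∫⁻ t in Ioo 0 τ, ENNReal.ofReal τ ^ (-a) * ENNReal.ofReal (t ^ (a - 1)) := by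
        rw [← lintegral_indicator measurableSet_Ioi, ← lintegral_indicator measurableSet_Ioo]
        refine lintegral_congr fun t => ?_
        by_cases h0 : 0 < t
        · by_cases h1 : t < τ
          · simp only [hK, hS, indicator, mem_Ioi, mem_Ioo, mem_ofPred_eq, h0, h1, and_self,
              if_true, ← ofReal_rpow_div_ofReal h0, div_eq_mul_inv]
            ring
          · simp [hK, hS, indicator, h1]
        · simp [h0]
      rw [this, lintegral_const_mul' _ _ (by
        rw [ENNReal.ofReal_rpow_of_pos hτ]; exact ofReal_ne_top),
        lintegral_Ioo_rpow_sub_one ha hτ, ENNReal.ofReal_rpow_of_pos hτ,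
        ← ENNReal.ofReal_mul (by positivity), Real.rpow_neg hτ.le]
      refine le_of_eq (congrArg _ ?_)
      have := (Real.rpow_pos_of_pos hτ a).ne'
      field_simp
  have h := lintegral_rpow_lintegral_mul_le hp hKm hA hB hφ.aemeasurable
  rw [lintegral_haarPos_congr fun t ht => by rw [hrow φ t ht]] at h
  refine h.trans_eq ?_
  congr 1
  have h1 : ENNReal.ofReal (1 / a) ≠ 0 := by simpa using ha
  conv_lhs => rw [← ENNReal.rpow_one (ENNReal.ofReal (1 / a))]
  rw [← ENNReal.rpow_mul, ← ENNReal.rpow_add _ _ h1 ofReal_ne_top]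
  congr 1; ring

end Hardy

/-! ### Decreasing rearrangement -/

section Rearrangement

open ENNReal

/-- Layer cake formula. -/
theorem volume_Ioi_inter_ofReal_lt (a : ℝ≥0∞) :
    volume {l : ℝ | 0 < l ∧ ENNReal.ofReal l < a} = a := by
  rcases eq_or_ne a ⊤ with rfl | ha
  · have : {l : ℝ | 0 < l ∧ ENNReal.ofReal l < ⊤} = Ioi 0 := by ext; simp
    rw [this, Real.volume_Ioi]
  · have : {l : ℝ | 0 < l ∧ ENNReal.ofReal l < a} = Ioo 0 a.toReal := by
      ext l
      simp only [mem_ofPred_eq, mem_Ioo, and_congr_right_iff]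
      exact fun hl => ENNReal.ofReal_lt_iff_lt_toReal hl.le ha
    rw [this, Real.volume_Ioo, sub_zero, ENNReal.ofReal_toReal ha]

theorem volume_Ioi_inter_ofReal_le (a : ℝ≥0∞) :
    volume {l : ℝ | 0 < l ∧ ENNReal.ofReal l ≤ a} = a := by
  rcases eq_or_ne a ⊤ with rfl | ha
  · have : {l : ℝ | 0 < l ∧ ENNReal.ofReal l ≤ ⊤} = Ioi 0 := by ext; simp
    rw [this, Real.volume_Ioi]
  · have : {l : ℝ | 0 < l ∧ ENNReal.ofReal l ≤ a} = Ioc 0 a.toReal := by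
      ext l
      simp only [mem_ofPred_eq, mem_Ioc, and_congr_right_iff]
      exact fun hl => ENNReal.ofReal_le_iff_le_toReal ha
    rw [this, Real.volume_Ioc, sub_zero, ENNReal.ofReal_toReal ha]

theorem lintegral_eq_lintegral_measure_lt {X : Type*} [MeasurableSpace X] {μ : Measure X}
    [SFinite μ] {f : X → ℝ≥0∞} (hf : Measurable f) :
    ∫⁻ x, f x ∂μ = ∫⁻ l in Ioi (0 : ℝ), μ {x | ENNReal.ofReal l < f x} := by
  set S : Set (X × ℝ) := {z | ENNReal.ofReal z.2 < f z.1} with hS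
  have hSm : MeasurableSet S :=
    measurableSet_lt (by fun_prop) (hf.comp measurable_fst)
  calc ∫⁻ x, f x ∂μ = ∫⁻ x, (∫⁻ l in Ioi (0 : ℝ), S.indicator 1 (x, l)) ∂μ := by
        refine lintegral_congr fun x => ?_
        have hm : MeasurableSet {l : ℝ | ENNReal.ofReal l < f x} :=
          measurableSet_lt (by fun_prop) measurable_const
        have : ∀ l : ℝ, S.indicator (1 : X × ℝ → ℝ≥0∞) (x, l) =
            {l : ℝ | ENNReal.ofReal l < f x}.indicator 1 l := fun l => by
          simp [hS, indicator]
        simp only [this]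
        rw [lintegral_indicator_one hm, Measure.restrict_apply hm, inter_comm]
        exact (volume_Ioi_inter_ofReal_lt (f x)).symm
    _ = ∫⁻ l in Ioi (0 : ℝ), (∫⁻ x, S.indicator 1 (x, l) ∂μ) :=
        lintegral_lintegral_swap (measurable_one.indicator hSm).aemeasurable
    _ = _ := by
        refine lintegral_congr fun l => ?_
        have hm : MeasurableSet {x : X | ENNReal.ofReal l < f x} :=
          measurableSet_lt measurable_const hf
        have : ∀ x : X, S.indicator (1 : X × ℝ → ℝ≥0∞) (x, l) =
            {x : X | ENNReal.ofReal l < f x}.indicator 1 x := fun l => by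
          simp [hS, indicator]
        simp only [this]
        rw [lintegral_indicator_one hm]

variable {X : Type*} [MeasurableSpace X] {μ : Measure X}

/-- The decreasing rearrangement of a function with values in `[0, ∞]`. -/
noncomputable def rearr (μ : Measure X) (f : X → ℝ≥0∞) (t : ℝ) : ℝ≥0∞ :=
  sInf {l | μ {x | l < f x} < ENNReal.ofReal t}

theorem rearr_antitone (f : X → ℝ≥0∞) : Antitone (rearr μ f) := fun _ _ h =>
  sInf_le_sInf fun _ hl => lt_of_lt_of_le hl (ENNReal.ofReal_le_ofReal h)

theorem measurable_rearr (f : X → ℝ≥0∞) : Measurable (rearr μ f) := (rearr_antitone f).measurable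

theorem le_measure_of_lt_rearr {f : X → ℝ≥0∞} {l : ℝ≥0∞} {t : ℝ} (h : l < rearr μ f t) :
    ENNReal.ofReal t ≤ μ {x | l < f x} := by
  by_contra! hc
  have h' : rearr μ f t ≤ l := sInf_le hc
  exact h'.not_gt h

theorem le_rearr_of_le_measure {f : X → ℝ≥0∞} {l : ℝ≥0∞} {t : ℝ}
    (h : ENNReal.ofReal t ≤ μ {x | l < f x}) : l ≤ rearr μ f t := by
  refine le_sInf fun l' hl' => ?_
  by_contra! hc
  exact (hl'.trans_le h).not_ge (measure_mono fun x (hx : l < f x) => hc.trans hx)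

/-- The set `{f > l}` is the increasing union of the sets `{f > l + 1/(n+1)}`. By continuity from
below a level strictly above `l` still has measure exceeding `t`, which gives strictness. -/
theorem lt_rearr_of_lt_measure {f : X → ℝ≥0∞} {l t : ℝ} (hl : 0 ≤ l)
    (h : ENNReal.ofReal t < μ {x | ENNReal.ofReal l < f x}) : ENNReal.ofReal l < rearr μ f t := by
  have hU : {x | ENNReal.ofReal l < f x} =
      ⋃ n : ℕ, {x | ENNReal.ofReal l + ENNReal.ofReal (1 / ((n : ℝ) + 1)) < f x} := by
    ext x
    simp only [mem_ofPred_eq, mem_iUnion]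
    refine ⟨fun hx => ?_, fun ⟨n, hn⟩ => lt_of_le_of_lt le_self_add hn⟩
    obtain ⟨r, hr0, hr⟩ := ENNReal.lt_iff_exists_real_btwn.1 hx
    obtain ⟨hlr, hrx⟩ := hr
    have hlr' : l < r := by
      by_contra! hc
      exact (ENNReal.ofReal_le_ofReal hc).not_gt hlr
    obtain ⟨n, hn⟩ := exists_nat_one_div_lt (sub_pos.2 hlr')
    refine ⟨n, lt_of_le_of_lt ?_ hrx⟩
    rw [← ENNReal.ofReal_add hl (by positivity)]
    exact ENNReal.ofReal_le_ofReal (by linarith)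
  have hmono : Monotone fun n : ℕ =>
      {x | ENNReal.ofReal l + ENNReal.ofReal (1 / ((n : ℝ) + 1)) < f x} := by
    intro m n hmn x hx
    refine lt_of_le_of_lt ?_ (show _ < f x from hx)
    gcongr
  rw [hU, hmono.measure_iUnion, lt_iSup_iff] at h
  obtain ⟨n, hn⟩ := h
  refine lt_of_lt_of_le ?_ (le_rearr_of_le_measure hn.le)
  exact ENNReal.lt_add_right ofReal_ne_top (by simp; positivity)

/-- Layer cake on both sides. At level `l` the slice inside `A` has measure at most the minimum of
`μ {f > l}` and `t`, while every `τ` below this minimum lies in `(0, t)` and has rearrangement above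
`l`. -/
theorem setLIntegral_le_lintegral_rearr [SFinite μ] {f : X → ℝ≥0∞} (hf : Measurable f) {A : Set X}
    {t : ℝ} (hA : μ A ≤ ENNReal.ofReal t) :
    ∫⁻ x in A, f x ∂μ ≤ ∫⁻ τ in Ioo 0 t, rearr μ f τ := by
  rw [lintegral_eq_lintegral_measure_lt hf, lintegral_eq_lintegral_measure_lt (measurable_rearr f)]
  refine lintegral_mono_ae ?_
  filter_upwards [ae_restrict_mem measurableSet_Ioi] with l hl
  rw [Measure.restrict_apply (measurableSet_lt measurable_const hf),
    Measure.restrict_apply (measurableSet_lt measurable_const (measurable_rearr f))]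
  set m := min (μ {x | ENNReal.ofReal l < f x}) (ENNReal.ofReal t) with hm
  calc μ ({x | ENNReal.ofReal l < f x} ∩ A) ≤ m :=
        le_min (measure_mono inter_subset_left) ((measure_mono inter_subset_right).trans hA)
    _ = volume {τ : ℝ | 0 < τ ∧ ENNReal.ofReal τ < m} := (volume_Ioi_inter_ofReal_lt m).symm
    _ ≤ _ := by
        refine measure_mono fun τ hτ => ⟨?_, hτ.1, ?_⟩
        · exact lt_rearr_of_lt_measure (le_of_lt hl) (hτ.2.trans_le (min_le_left _ _))
        · exact (ENNReal.ofReal_lt_ofReal_iff_of_nonneg hτ.1.le).1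
            (hτ.2.trans_le (min_le_right _ _))

/-- Layer cake again: the rearrangement exceeds `l` at `τ` only if `τ ≤ μ {f > l}`. This half of
equimeasurability is all that is needed. -/
theorem lintegral_rearr_le [SFinite μ] {f : X → ℝ≥0∞} (hf : Measurable f) :
    ∫⁻ τ in Ioi 0, rearr μ f τ ≤ ∫⁻ x, f x ∂μ := by
  rw [lintegral_eq_lintegral_measure_lt hf, lintegral_eq_lintegral_measure_lt (measurable_rearr f)]
  refine lintegral_mono_ae ?_
  filter_upwards [ae_restrict_mem measurableSet_Ioi] with l hl
  rw [Measure.restrict_apply (measurableSet_lt measurable_const (measurable_rearr f))]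
  refine le_trans (measure_mono fun τ hτ => ?_) (volume_Ioi_inter_ofReal_le _).le
  exact ⟨hτ.2, le_measure_of_lt_rearr hτ.1⟩

/-- The power map is an order isomorphism of `[0, ∞]`, hence commutes with the infimum. -/
theorem rearr_rpow {p : ℝ} (hp : 0 < p) (f : X → ℝ≥0∞) (t : ℝ) :
    rearr μ (fun x => f x ^ p) t = rearr μ f t ^ p := by
  rw [rearr, rearr, ← ENNReal.orderIsoRpow_apply p hp, OrderIso.map_sInf_eq_sInf_symm_preimage]
  congr 1
  ext l
  simp only [mem_ofPred_eq, mem_preimage, ENNReal.orderIsoRpow_symm_apply,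
    ENNReal.orderIsoRpow_apply]
  have : {x | l ^ (1 / p) < f x} = {x | l < f x ^ p} := by
    ext x
    simp only [mem_ofPred_eq]
    rw [one_div, ENNReal.rpow_inv_lt_iff hp]
  rw [this]

end Rearrangement

/-! ### Averages of decreasing functions -/

section HardyLittlewood

open ENNReal

theorem measurable_setLIntegral_Ioo (r : ℝ → ℝ≥0∞) :
    Measurable fun t : ℝ => ∫⁻ τ in Ioo 0 t, r τ := by
  refine Monotone.measurable fun s t hst => ?_
  exact lintegral_mono_set (Ioo_subset_Ioo_right hst)

/-- Hardy's inequality with `a = 1 - b` applied to `t^b r(t)`: the weights inside the integral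
cancel, leaving the plain average of `r`. -/
theorem lintegral_hardy_average {p b : ℝ} (hp : 1 < p) (hb : b < 1) {r : ℝ → ℝ≥0∞}
    (hr : Measurable r) :
    ∫⁻ t, (ENNReal.ofReal t ^ b * ((∫⁻ τ in Ioo 0 t, r τ) / ENNReal.ofReal t)) ^ p ∂haarPos ≤
      ENNReal.ofReal (1 / (1 - b)) ^ p * ∫⁻ t, (ENNReal.ofReal t ^ b * r t) ^ p ∂haarPos := by
  refine le_trans (le_of_eq ?_) (lintegral_hardy_Ioo hp (sub_pos.2 hb)
    (φ := fun t => ENNReal.ofReal t ^ b * r t) (by fun_prop))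
  refine lintegral_haarPos_congr fun t ht => ?_
  congr 1
  have h0 : ENNReal.ofReal t ≠ 0 := by simpa
  have e : ∀ τ ∈ Ioo 0 t, ENNReal.ofReal τ ^ (1 - b) * (ENNReal.ofReal τ ^ b * r τ) /
      ENNReal.ofReal τ = r τ := by
    intro τ hτ
    have h0 : ENNReal.ofReal τ ≠ 0 := by simpa using hτ.1
    rw [← mul_assoc, ← ENNReal.rpow_add _ _ h0 ofReal_ne_top, sub_add_cancel, ENNReal.rpow_one,
      mul_comm, ENNReal.mul_div_cancel_right h0 ofReal_ne_top]
  rw [setLIntegral_congr_fun measurableSet_Ioo e, neg_sub,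
    ENNReal.rpow_sub _ _ h0 ofReal_ne_top, ENNReal.rpow_one]
  simp only [div_eq_mul_inv]; ring

/-- The average of a decreasing function over `(0, t)` decreases. -/
theorem setLIntegral_Ioo_div_antitoneOn {r : ℝ → ℝ≥0∞} (hr : Antitone r) :
    AntitoneOn (fun t => (∫⁻ τ in Ioo 0 t, r τ) / ENNReal.ofReal t) (Ioi 0) := by
  intro s hs t ht hst
  have hs : 0 < s := hs
  have ht : 0 < t := ht
  have h0 : ENNReal.ofReal s ≠ 0 := by simpa
  set k := ∫⁻ τ in Ioo 0 s, r τ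
  have h1 : ENNReal.ofReal s * r s ≤ k := by
    calc ENNReal.ofReal s * r s = ∫⁻ τ in Ioo 0 s, r s := by simp [mul_comm]
      _ ≤ k := setLIntegral_mono' measurableSet_Ioo fun τ hτ => hr hτ.2.le
  have h2 : ∫⁻ τ in Ioo 0 t, r τ ≤ k + ENNReal.ofReal (t - s) * r s := by
    have hsub : Ioo 0 t ⊆ Ioo 0 s ∪ Ico s t := by
      intro x hx
      rcases lt_or_ge x s with h | h
      · exact Or.inl ⟨hx.1, h⟩
      · exact Or.inr ⟨h, hx.2⟩
    calc ∫⁻ τ in Ioo 0 t, r τ ≤ ∫⁻ τ in Ioo 0 s ∪ Ico s t, r τ := lintegral_mono_set hsub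
      _ ≤ k + ∫⁻ τ in Ico s t, r τ := lintegral_union_le _ _ _
      _ ≤ k + ∫⁻ τ in Ico s t, r s := by
        refine add_le_add_right ?_ _
        exact setLIntegral_mono' measurableSet_Ico fun τ hτ => hr hτ.1
      _ = _ := by simp [mul_comm]
  have h3 : r s ≤ k / ENNReal.ofReal s := by
    rw [ENNReal.le_div_iff_mul_le (Or.inl h0) (Or.inl ofReal_ne_top), mul_comm]
    exact h1
  simp only
  rw [ENNReal.div_le_iff (by simpa) ofReal_ne_top]
  refine h2.trans ?_
  calc k + ENNReal.ofReal (t - s) * r s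
      ≤ ENNReal.ofReal s * (k / ENNReal.ofReal s) +
        ENNReal.ofReal (t - s) * (k / ENNReal.ofReal s) := by
        gcongr
        rw [ENNReal.mul_div_cancel h0 ofReal_ne_top]
    _ = _ := by
        rw [← add_mul, ← ENNReal.ofReal_add hs.le (by linarith), mul_comm]
        congr 2; ring

end HardyLittlewood

/-! ### Rearrangement estimates for Riesz potentials -/

section Riesz

open ENNReal

variable {E : Type*} [NormedAddCommGroup E] [InnerProductSpace ℝ E] [FiniteDimensional ℝ E]
  [MeasurableSpace E] [BorelSpace E]

/-- The Riesz potential (not normalized) of order `α` of a nonnegative function. -/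
noncomputable def rieszPotential (α : ℝ) (f : E → ℝ≥0∞) (x : E) : ℝ≥0∞ :=
  ∫⁻ y, ENNReal.ofReal (‖x - y‖ ^ (α - Module.finrank ℝ E)) * f y

theorem measurable_rieszPotential {α : ℝ} {f : E → ℝ≥0∞} (hf : Measurable f) :
    Measurable (rieszPotential α f) := by
  have : Measurable (Function.uncurry fun x y : E =>
      ENNReal.ofReal (‖x - y‖ ^ (α - Module.finrank ℝ E)) * f y) := by
    unfold Function.uncurry
    fun_prop
  exact this.lintegral_prod_right'

/-- The ball centred at the origin of volume `τ`. -/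
def ballOfVolume (E : Type*) [NormedAddCommGroup E] [InnerProductSpace ℝ E]
    [FiniteDimensional ℝ E] [MeasurableSpace E] [BorelSpace E] (τ : ℝ) : Set E :=
  {z | volume.real (Metric.ball (0 : E) 1) * ‖z‖ ^ Module.finrank ℝ E < τ}

theorem volume_real_ball_pos : 0 < volume.real (Metric.ball (0 : E) 1) :=
  ENNReal.toReal_pos (Metric.measure_ball_pos _ _ one_pos).ne' measure_ball_lt_top.ne

theorem volume_ballOfVolume_le (hd : 0 < Module.finrank ℝ E) {τ : ℝ} (hτ : 0 < τ) :
    volume (ballOfVolume E τ) ≤ ENNReal.ofReal τ := by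
  set v := volume.real (Metric.ball (0 : E) 1) with hv
  have hv0 : 0 < v := volume_real_ball_pos
  have hsub : ballOfVolume E τ ⊆ Metric.ball 0 ((τ / v) ^ (1 / (Module.finrank ℝ E : ℝ))) := by
    intro z hz
    have hz : v * ‖z‖ ^ Module.finrank ℝ E < τ := hz
    rw [mem_ball_zero_iff, one_div, Real.lt_rpow_inv_iff_of_pos (norm_nonneg z) (by positivity)
      (by exact_mod_cast hd), Real.rpow_natCast, lt_div_iff₀' hv0]
    exact hz
  have : Nontrivial E := Module.finrank_pos_iff.1 hd
  refine (measure_mono hsub).trans ?_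
  rw [Measure.addHaar_ball _ _ (by positivity), ← Real.rpow_natCast, ← Real.rpow_mul (by positivity),
    one_div_mul_cancel (by positivity), Real.rpow_one,
    ← ENNReal.ofReal_toReal (measure_ball_lt_top (x := (0 : E)) (r := 1)).ne,
    ← ENNReal.ofReal_mul (by positivity)]
  change ENNReal.ofReal (τ / v * v) ≤ _
  rw [div_mul_cancel₀ _ hv0.ne']

theorem measurableSet_ballOfVolume (τ : ℝ) : MeasurableSet (ballOfVolume E τ) :=
  measurableSet_lt (f := fun z : E => volume.real (Metric.ball (0 : E) 1) *
    ‖z‖ ^ Module.finrank ℝ E) (by fun_prop) measurable_const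

/-- The constant in the layer cake representation of the Riesz kernel. -/
noncomputable def rieszConst (E : Type*) [NormedAddCommGroup E] [InnerProductSpace ℝ E]
    [FiniteDimensional ℝ E] [MeasurableSpace E] [BorelSpace E] (α : ℝ) : ℝ :=
  volume.real (Metric.ball (0 : E) 1) ^ (1 - α / Module.finrank ℝ E) *
    (1 - α / Module.finrank ℝ E)

/-- Let `m` be the volume of the centred ball with `z` on its boundary. The kernel is a constant
times `m^(α/d - 1)`, that is, times the integral of `τ^(α/d - 2)` over `τ > m`, and `τ > m` says
that `z` lies in the ball of volume `τ`. At `z = 0` the real power is `0` by convention, so only an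
inequality holds there. -/
theorem ofReal_norm_rpow_le_lintegral {α : ℝ} (hα : α < Module.finrank ℝ E) (z : E) :
    ENNReal.ofReal (‖z‖ ^ (α - Module.finrank ℝ E)) ≤
      ENNReal.ofReal (rieszConst E α) * ∫⁻ τ in Ioi (0 : ℝ),
        ENNReal.ofReal (τ ^ (α / Module.finrank ℝ E - 2)) *
          (ballOfVolume E τ).indicator 1 z := by
  set v := volume.real (Metric.ball (0 : E) 1) with hv
  have hv0 : 0 < v := volume_real_ball_pos
  rcases eq_or_ne z 0 with rfl | hz
  · rw [norm_zero, Real.zero_rpow (by linarith)]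
    simp
  have hz0 : 0 < ‖z‖ := norm_pos_iff.2 hz
  have hd : 0 < Module.finrank ℝ E := Module.finrank_pos_iff_exists_ne_zero.2 ⟨z, hz⟩
  have hd' : (0 : ℝ) < Module.finrank ℝ E := by exact_mod_cast hd
  have hθ : 0 < 1 - α / Module.finrank ℝ E := by
    rw [sub_pos, div_lt_one hd']; exact hα
  set m := v * ‖z‖ ^ Module.finrank ℝ E with hm
  have hm0 : 0 < m := by positivity
  have h1 : ∫⁻ τ in Ioi (0 : ℝ), ENNReal.ofReal (τ ^ (α / Module.finrank ℝ E - 2)) *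
          (ballOfVolume E τ).indicator 1 z =
      ∫⁻ τ in Ioi m, ENNReal.ofReal (τ ^ (-(1 - α / Module.finrank ℝ E) - 1)) := by
    rw [← lintegral_indicator measurableSet_Ioi, ← lintegral_indicator measurableSet_Ioi]
    refine lintegral_congr fun τ => ?_
    have e : -(1 - α / Module.finrank ℝ E) - 1 = α / Module.finrank ℝ E - 2 := by ring
    by_cases h : m < τ
    · have h2 : z ∈ ballOfVolume E τ := h
      rw [e]
      simp [h, h2, hm0.trans h]
    · have h2 : z ∉ ballOfVolume E τ := h
      simp [h, h2]
  rw [h1, lintegral_Ioi_rpow_neg_sub_one hθ hm0, rieszConst, ← ENNReal.ofReal_mul (by positivity)]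
  refine ENNReal.ofReal_le_ofReal (le_of_eq ?_)
  rw [hm, Real.mul_rpow hv0.le (by positivity), ← Real.rpow_natCast, ← Real.rpow_mul hz0.le,
    Real.rpow_neg hv0.le]
  have e : (Module.finrank ℝ E : ℝ) * -(1 - α / Module.finrank ℝ E) = α - Module.finrank ℝ E := by
    field_simp; ring
  rw [e]
  have := (Real.rpow_pos_of_pos hv0 (1 - α / Module.finrank ℝ E)).ne'
  rw [← hv]
  generalize 1 - α / Module.finrank ℝ E = b at *
  field_simp

/-- An upper bound for the averages of a Riesz potential over sets of measure `t`. -/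
noncomputable def rieszBound (α : ℝ) (f : E → ℝ≥0∞) (t : ℝ) : ℝ≥0∞ :=
  ENNReal.ofReal (rieszConst E α) * ∫⁻ τ in Ioi (0 : ℝ),
    ENNReal.ofReal (τ ^ (α / Module.finrank ℝ E - 2)) *
      min (ENNReal.ofReal τ * ((∫⁻ σ in Ioo 0 t, rearr volume f σ) / ENNReal.ofReal t))
        (∫⁻ σ in Ioo 0 τ, rearr volume f σ)

theorem rieszBound_antitoneOn (α : ℝ) (f : E → ℝ≥0∞) : AntitoneOn (rieszBound α f) (Ioi 0) := by
  intro s hs t ht hst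
  unfold rieszBound
  gcongr ENNReal.ofReal (rieszConst E α) * ∫⁻ τ in Ioi (0 : ℝ),
    ENNReal.ofReal (τ ^ (α / Module.finrank ℝ E - 2)) *  min (ENNReal.ofReal τ * ?_) _
  exact setLIntegral_Ioo_div_antitoneOn (rearr_antitone f) hs ht hst

/-- Once the kernel is a superposition of ball indicators, each ball leaves a double integral over
`A` and the ball that can be bounded in two ways. Integrating `f` over a ball first gives `t ∫_0^τ
f*`; integrating `f` over a translate of `A` first gives `τ ∫_0^t f*`. The minimum of the two is
kept, and no rearrangement inequality for convolutions is needed. -/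
theorem setLIntegral_rieszPotential_le (hd : 0 < Module.finrank ℝ E) {α : ℝ}
    (hα : α < Module.finrank ℝ E) {f : E → ℝ≥0∞} (hf : Measurable f) {A : Set E} {t : ℝ}
    (ht : 0 < t) (hA : volume A ≤ ENNReal.ofReal t) :
    ∫⁻ x in A, rieszPotential α f x ≤ ENNReal.ofReal t * rieszBound α f t := by
  set w : ℝ → ℝ≥0∞ := fun τ => ENNReal.ofReal (τ ^ (α / Module.finrank ℝ E - 2)) with hw
  set K : ℝ → ℝ≥0∞ := fun t => ∫⁻ σ in Ioo 0 t, rearr volume f σ with hK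
  have hwm : Measurable w := by fun_prop
  have hind : Measurable fun q : (E × E) × ℝ =>
      (ballOfVolume E q.2).indicator (1 : E → ℝ≥0∞) (q.1.1 - q.1.2) := by
    have : MeasurableSet {q : (E × E) × ℝ | q.1.1 - q.1.2 ∈ ballOfVolume E q.2} :=
      measurableSet_lt (f := fun q : (E × E) × ℝ => volume.real (Metric.ball (0 : E) 1) *
        ‖q.1.1 - q.1.2‖ ^ Module.finrank ℝ E) (by fun_prop) measurable_snd
    exact measurable_one.indicator this
  have hJ1 : ∀ τ, 0 < τ → ∫⁻ x in A, ∫⁻ y, (ballOfVolume E τ).indicator 1 (x - y) * f y ≤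
      ENNReal.ofReal t * K τ := by
    intro τ hτ
    have hmB := measurableSet_ballOfVolume (E := E) τ
    calc ∫⁻ x in A, ∫⁻ y, (ballOfVolume E τ).indicator 1 (x - y) * f y
        ≤ ∫⁻ x in A, K τ := by
          refine lintegral_mono fun x => ?_
          have hpre : MeasurableSet ((fun y => x - y) ⁻¹' ballOfVolume E τ) :=
            hmB.preimage (by fun_prop)
          have : ∀ y, (ballOfVolume E τ).indicator 1 (x - y) * f y =
              ((fun y => x - y) ⁻¹' ballOfVolume E τ).indicator f y := fun y => by
            have e : y ∈ (fun y => x - y) ⁻¹' ballOfVolume E τ ↔ x - y ∈ ballOfVolume E τ := Iff.rfl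
            by_cases h : x - y ∈ ballOfVolume E τ
            · rw [indicator_of_mem h, indicator_of_mem (e.2 h), Pi.one_apply, one_mul]
            · rw [indicator_of_notMem h, indicator_of_notMem (mt e.1 h), zero_mul]
          simp only [this]
          rw [lintegral_indicator hpre]
          refine setLIntegral_le_lintegral_rearr hf ?_
          rw [(Measure.measurePreserving_sub_left volume x).measure_preimage hmB.nullMeasurableSet]
          exact volume_ballOfVolume_le hd hτ
      _ ≤ _ := by
          rw [setLIntegral_const, mul_comm]; gcongr
  have hJ2 : ∀ τ, 0 < τ → ∫⁻ x in A, ∫⁻ y, (ballOfVolume E τ).indicator 1 (x - y) * f y ≤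
      ENNReal.ofReal τ * K t := by
    intro τ hτ
    have hmB := measurableSet_ballOfVolume (E := E) τ
    calc ∫⁻ x in A, ∫⁻ y, (ballOfVolume E τ).indicator 1 (x - y) * f y
        = ∫⁻ x in A, ∫⁻ z, (ballOfVolume E τ).indicator 1 z * f (x - z) := by
          refine lintegral_congr fun x => ?_
          rw [← lintegral_sub_left_eq_self _ x]
          simp
      _ = ∫⁻ z, ∫⁻ x in A, (ballOfVolume E τ).indicator 1 z * f (x - z) := by
          refine lintegral_lintegral_swap (Measurable.aemeasurable ?_)
          exact ((measurable_one.indicator hmB).comp measurable_snd).mul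
            (hf.comp (measurable_fst.sub measurable_snd))
      _ ≤ ∫⁻ z, (ballOfVolume E τ).indicator 1 z * K t := by
          refine lintegral_mono fun z => ?_
          rw [lintegral_const_mul _ (f := fun x => f (x - z)) (hf.comp (by fun_prop))]
          gcongr
          have h1 : ∫⁻ x in A, f (x - z) = ∫⁻ x in (fun x => x + z) ⁻¹' A, f x := by
            rw [← (measurePreserving_add_right volume z).setLIntegral_comp_preimage_emb
              (measurableEmbedding_addRight z) (fun x => f (x - z))]
            simp
          rw [h1]
          refine setLIntegral_le_lintegral_rearr hf ?_
          rwa [measure_preimage_add_right]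
      _ = volume (ballOfVolume E τ) * K t := by
          rw [lintegral_mul_const _ (measurable_one.indicator hmB), lintegral_indicator_one hmB]
      _ ≤ _ := by
          gcongr
          exact volume_ballOfVolume_le hd hτ
  have h0 : ENNReal.ofReal t ≠ 0 := by simpa
  calc ∫⁻ x in A, rieszPotential α f x
      ≤ ∫⁻ x in A, ∫⁻ y, (ENNReal.ofReal (rieszConst E α) * ∫⁻ τ in Ioi (0 : ℝ),
          w τ * (ballOfVolume E τ).indicator 1 (x - y)) * f y := by
        refine lintegral_mono fun x => lintegral_mono fun y => ?_
        gcongr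
        exact ofReal_norm_rpow_le_lintegral hα _
    _ = ∫⁻ z : E × E, (ENNReal.ofReal (rieszConst E α) * ∫⁻ τ in Ioi (0 : ℝ),
          w τ * (ballOfVolume E τ).indicator 1 (z.1 - z.2)) * f z.2
          ∂((volume.restrict A).prod volume) := by
        rw [lintegral_prod]
        refine Measurable.aemeasurable ?_
        refine (Measurable.const_mul ?_ _).mul (hf.comp measurable_snd)
        exact Measurable.lintegral_prod_right' (f := fun q : (E × E) × ℝ =>
          w q.2 * (ballOfVolume E q.2).indicator 1 (q.1.1 - q.1.2))
          ((hwm.comp measurable_snd).mul hind)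
    _ = ENNReal.ofReal (rieszConst E α) * ∫⁻ z : E × E, (∫⁻ τ in Ioi (0 : ℝ),
          w τ * ((ballOfVolume E τ).indicator 1 (z.1 - z.2) * f z.2))
          ∂((volume.restrict A).prod volume) := by
        rw [← lintegral_const_mul' _ _ ofReal_ne_top]
        refine lintegral_congr fun z => ?_
        rw [mul_assoc, ← lintegral_mul_const]
        · simp only [mul_assoc]
        · exact hwm.mul (hind.comp (measurable_const.prodMk measurable_id))
    _ = ENNReal.ofReal (rieszConst E α) * ∫⁻ τ in Ioi (0 : ℝ), ∫⁻ z : E × E,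
          w τ * ((ballOfVolume E τ).indicator 1 (z.1 - z.2) * f z.2)
          ∂((volume.restrict A).prod volume) := by
        congr 1
        refine lintegral_lintegral_swap (Measurable.aemeasurable ?_)
        exact (hwm.comp measurable_snd).mul (hind.mul (hf.comp (by fun_prop)))
    _ = ENNReal.ofReal (rieszConst E α) * ∫⁻ τ in Ioi (0 : ℝ),
          w τ * ∫⁻ x in A, ∫⁻ y, (ballOfVolume E τ).indicator 1 (x - y) * f y := by
        congr 1
        refine lintegral_congr fun τ => ?_
        have hm : Measurable fun z : E × E =>
            (ballOfVolume E τ).indicator 1 (z.1 - z.2) * f z.2 :=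
          (hind.comp (measurable_id.prodMk measurable_const)).mul (hf.comp measurable_snd)
        rw [lintegral_const_mul _ hm, lintegral_prod _ hm.aemeasurable]
    _ ≤ ENNReal.ofReal (rieszConst E α) * ∫⁻ τ in Ioi (0 : ℝ),
          ENNReal.ofReal t * (w τ * min (ENNReal.ofReal τ * (K t / ENNReal.ofReal t)) (K τ)) := by
        gcongr _ * ?_
        refine setLIntegral_mono' measurableSet_Ioi fun τ hτ => ?_
        rw [mul_left_comm]
        gcongr
        rw [mul_min]
        refine le_min ((hJ2 τ hτ).trans_eq ?_) (hJ1 τ hτ)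
        rw [mul_left_comm, ENNReal.mul_div_cancel h0 ofReal_ne_top]
    _ = _ := by
        rw [lintegral_const_mul' _ _ ofReal_ne_top, mul_left_comm]
        rfl

/-- The first term of the minimum is used for `τ < t`, the second for `τ > t`. The near part is a
multiple of `t^(α/d) f**(t)`, the far part a tail integral of `f**` handled by Hardy's inequality
for tails; positivity of `1/p - α/d` makes the latter available. Hardy's inequality for averages
then passes from `f**` to `f*`, hence to `f`. -/
theorem exists_lintegral_rieszBound_le (hd : 0 < Module.finrank ℝ E) {α p : ℝ} (hα0 : 0 < α)
    (hp : 1 < p) (hpα : 0 < 1 / p - α / Module.finrank ℝ E) :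
    ∃ C : ℝ≥0∞, C ≠ ⊤ ∧ ∀ f : E → ℝ≥0∞, Measurable f →
      ∫⁻ t, (ENNReal.ofReal t ^ (1 / p - α / Module.finrank ℝ E) * rieszBound α f t) ^ p ∂haarPos ≤
        C * ∫⁻ x, f x ^ p := by
  set θ := α / Module.finrank ℝ E with hθ
  have hd' : (0 : ℝ) < Module.finrank ℝ E := by exact_mod_cast hd
  have hθ0 : 0 < θ := by positivity
  set a := 1 / p - θ with ha
  have hp0 : 0 < p := zero_lt_one.trans hp
  set D := ENNReal.ofReal (rieszConst E α) ^ p * (2 ^ (p - 1) *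
      (ENNReal.ofReal (1 / θ) ^ p + ENNReal.ofReal (1 / a) ^ p) *
      ENNReal.ofReal (1 / (1 - 1 / p)) ^ p) with hD
  have hDt : D ≠ ⊤ := by
    have : ∀ x : ℝ, ENNReal.ofReal x ^ p ≠ ⊤ := fun x =>
      ENNReal.rpow_ne_top_of_nonneg hp0.le ofReal_ne_top
    have h2 : (2 : ℝ≥0∞) ^ (p - 1) ≠ ⊤ := ENNReal.rpow_ne_top_of_nonneg (by linarith) (by simp)
    exact mul_ne_top (this _) (mul_ne_top (mul_ne_top h2 (add_ne_top.2 ⟨this _, this _⟩)) (this _))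
  refine ⟨D, hDt, fun f hf => ?_⟩
  -- `M` is `f**` and `φ = t^(1/p) f**`, so `∫ φ^p dt/t` is the `p`-th power integral of `f**`.
  set M : ℝ → ℝ≥0∞ := fun t => (∫⁻ σ in Ioo 0 t, rearr volume f σ) / ENNReal.ofReal t with hM
  have hMm : Measurable M := (measurable_setLIntegral_Ioo _).div (by fun_prop)
  set φ : ℝ → ℝ≥0∞ := fun t => ENNReal.ofReal t ^ (1 / p) * M t with hφ
  have hφm : Measurable φ := by fun_prop
  have hφp : ∫⁻ t, φ t ^ p ∂haarPos ≤ ENNReal.ofReal (1 / (1 - 1 / p)) ^ p * ∫⁻ x, f x ^ p := by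
    refine (lintegral_hardy_average hp (by rw [div_lt_one hp0]; exact hp)
      (measurable_rearr f)).trans ?_
    gcongr
    refine le_trans (le_of_eq ?_) (lintegral_rearr_le (hf.pow_const p))
    rw [lintegral_haarPos]
    refine setLIntegral_congr_fun measurableSet_Ioi fun t ht => ?_
    have h0 : ENNReal.ofReal t ≠ 0 := by simpa using ht
    rw [rearr_rpow hp0, ENNReal.mul_rpow_of_nonneg _ _ hp0.le, ← ENNReal.rpow_mul,
      one_div_mul_cancel hp0.ne', ENNReal.rpow_one, mul_comm,
      ENNReal.mul_div_cancel_right h0 ofReal_ne_top]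
  have hpt : ∀ t, 0 < t → ENNReal.ofReal t ^ a * rieszBound α f t ≤ ENNReal.ofReal (rieszConst E α) *
      (ENNReal.ofReal (1 / θ) * φ t + ENNReal.ofReal t ^ a *
        ∫⁻ τ in Ioi t, ENNReal.ofReal τ ^ (-a) * φ τ / ENNReal.ofReal τ) := by
    intro t ht
    have h0 : ENNReal.ofReal t ≠ 0 := by simpa
    have hsub : Ioi (0 : ℝ) ⊆ Ioc 0 t ∪ Ioi t := fun x hx => by
      rcases le_or_gt x t with h | h
      · exact Or.inl ⟨hx, h⟩
      · exact Or.inr h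
    unfold rieszBound
    rw [mul_left_comm]
    gcongr
    rw [show ENNReal.ofReal (1 / θ) * φ t = ENNReal.ofReal t ^ a *
      (ENNReal.ofReal (t ^ θ / θ) * M t) by
        simp only [hφ]
        rw [ENNReal.ofReal_rpow_of_pos ht, ENNReal.ofReal_rpow_of_pos ht, ← mul_assoc,
          ← mul_assoc, ← ENNReal.ofReal_mul (by positivity), ← ENNReal.ofReal_mul (by positivity)]
        congr 2
        rw [mul_div_assoc', ← Real.rpow_add ht, ha, sub_add_cancel]; ring, ← mul_add]
    gcongr
    refine (lintegral_mono_set hsub).trans ((lintegral_union_le _ _ _).trans ?_)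
    gcongr ?_ + ?_
    · rw [← setLIntegral_congr Ioo_ae_eq_Ioc, ← lintegral_Ioo_rpow_sub_one hθ0 ht,
        ← lintegral_mul_const _ (by fun_prop)]
      refine setLIntegral_mono' measurableSet_Ioo fun τ hτ => ?_
      calc _ ≤ ENNReal.ofReal (τ ^ (θ - 2)) * (ENNReal.ofReal τ * M t) := by
            gcongr; exact min_le_left _ _
        _ = _ := by
          rw [← mul_assoc, ← ENNReal.ofReal_mul (Real.rpow_nonneg hτ.1.le _)]
          congr 2
          rw [← Real.rpow_add_one hτ.1.ne']; congr 1; ring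
    · refine setLIntegral_mono' measurableSet_Ioi fun τ hτ => ?_
      have hτ0 : 0 < τ := ht.trans hτ
      have h0 : ENNReal.ofReal τ ≠ 0 := by simpa
      calc _ ≤ ENNReal.ofReal (τ ^ (θ - 2)) * ∫⁻ σ in Ioo 0 τ, rearr volume f σ := by
            gcongr; exact min_le_right _ _
        _ = ENNReal.ofReal (τ ^ (θ - 2)) * (ENNReal.ofReal τ * M τ) := by
          rw [hM, ENNReal.mul_div_cancel h0 ofReal_ne_top]
        _ = _ := by
          rw [← mul_assoc, ← ENNReal.ofReal_mul (Real.rpow_nonneg hτ0.le _), hφ, ← mul_assoc,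
            ← ENNReal.rpow_add _ _ h0 ofReal_ne_top, mul_comm _ (M τ), mul_comm _ (M τ),
            mul_div_assoc, ofReal_rpow_div_ofReal hτ0, ← Real.rpow_add_one hτ0.ne']
          congr 3
          rw [ha]; ring
  calc _ ≤ ∫⁻ t, (ENNReal.ofReal (rieszConst E α) *
      (ENNReal.ofReal (1 / θ) * φ t + ENNReal.ofReal t ^ a *
        ∫⁻ τ in Ioi t, ENNReal.ofReal τ ^ (-a) * φ τ / ENNReal.ofReal τ)) ^ p ∂haarPos :=
        lintegral_haarPos_mono fun t ht => ENNReal.rpow_le_rpow (hpt t ht) hp0.le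
    _ ≤ ∫⁻ t, ENNReal.ofReal (rieszConst E α) ^ p * (2 ^ (p - 1) *
        (ENNReal.ofReal (1 / θ) ^ p * φ t ^ p + (ENNReal.ofReal t ^ a *
        ∫⁻ τ in Ioi t, ENNReal.ofReal τ ^ (-a) * φ τ / ENNReal.ofReal τ) ^ p)) ∂haarPos := by
        refine lintegral_mono fun t => ?_
        simp only
        rw [ENNReal.mul_rpow_of_nonneg _ _ hp0.le]
        gcongr
        refine (ENNReal.rpow_add_le_mul_rpow_add_rpow _ _ hp.le).trans_eq ?_
        rw [ENNReal.mul_rpow_of_nonneg _ _ hp0.le]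
    _ = ENNReal.ofReal (rieszConst E α) ^ p * (2 ^ (p - 1) *
        (ENNReal.ofReal (1 / θ) ^ p * ∫⁻ t, φ t ^ p ∂haarPos + ∫⁻ t, (ENNReal.ofReal t ^ a *
        ∫⁻ τ in Ioi t, ENNReal.ofReal τ ^ (-a) * φ τ / ENNReal.ofReal τ) ^ p ∂haarPos)) := by
        rw [lintegral_const_mul' _ _ (ENNReal.rpow_ne_top_of_nonneg hp0.le ofReal_ne_top),
          lintegral_const_mul' _ _ (ENNReal.rpow_ne_top_of_nonneg (by linarith) (by simp)),
          lintegral_add_left (by fun_prop), lintegral_const_mul _ (by fun_prop)]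
    _ ≤ ENNReal.ofReal (rieszConst E α) ^ p * (2 ^ (p - 1) *
        (ENNReal.ofReal (1 / θ) ^ p * ∫⁻ t, φ t ^ p ∂haarPos +
          ENNReal.ofReal (1 / a) ^ p * ∫⁻ t, φ t ^ p ∂haarPos)) := by
        gcongr
        exact lintegral_hardy_Ioi hp hpα hφm
    _ ≤ ENNReal.ofReal (rieszConst E α) ^ p * (2 ^ (p - 1) *
        (ENNReal.ofReal (1 / θ) ^ p * (ENNReal.ofReal (1 / (1 - 1 / p)) ^ p * ∫⁻ x, f x ^ p) +
          ENNReal.ofReal (1 / a) ^ p *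
            (ENNReal.ofReal (1 / (1 - 1 / p)) ^ p * ∫⁻ x, f x ^ p))) := by gcongr
    _ = _ := by rw [hD]; ring

end Riesz

/-! ### Lorentz norms of truncations -/

section Truncation

open ENNReal

theorem AntitoneOn.aemeasurable_haarPos {Ψ : ℝ → ℝ≥0∞} (h : AntitoneOn Ψ (Ioi 0)) :
    AEMeasurable Ψ haarPos :=
  (aemeasurable_restrict_of_antitoneOn measurableSet_Ioi h).mono_ac
    (withDensity_absolutelyContinuous _ _)

/-- Since `1/m < 1`, Hardy's inequality replaces `v**` by `v*`, so that only pointwise bounds on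
rearrangements are needed afterwards. -/
theorem lorentzNorm_le {d : ℕ} {m q : ℝ} (hm : 1 < m) (hq : 1 < q)
    (v : EuclideanSpace ℝ (Fin d) → ℝ) :
    lorentzNorm m q v ≤ ENNReal.ofReal (1 / (1 - 1 / m)) *
      (∫⁻ t, (ENNReal.ofReal t ^ (1 / m) * rearr volume (fun x => ‖v x‖ₑ) t) ^ q ∂haarPos) ^
        (1 / q) := by
  have hq0 : 0 < q := zero_lt_one.trans hq
  have h := lintegral_hardy_average hq (b := 1 / m) (by rw [div_lt_one (by linarith)]; exact hm)
    (measurable_rearr (μ := volume) fun x => ‖v x‖ₑ)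
  have e : lorentzNorm m q v = (∫⁻ t, (ENNReal.ofReal t ^ (1 / m) *
      ((∫⁻ τ in Ioo 0 t, rearr volume (fun x => ‖v x‖ₑ) τ) / ENNReal.ofReal t)) ^ q
      ∂haarPos) ^ (1 / q) := by
    rw [lintegral_haarPos]; rfl
  rw [e]
  calc _ ≤ (ENNReal.ofReal (1 / (1 - 1 / m)) ^ q * ∫⁻ t, (ENNReal.ofReal t ^ (1 / m) *
        rearr volume (fun x => ‖v x‖ₑ) t) ^ q ∂haarPos) ^ (1 / q) := by gcongr
    _ = _ := by
      rw [ENNReal.mul_rpow_of_nonneg _ _ (by positivity), ← ENNReal.rpow_mul,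
        mul_one_div_cancel hq0.ne', ENNReal.rpow_one]

/-- The interval `(t/2, t)` carries a fixed share of the integral: there `Ψ ≥ Ψ(t)`, `τ^a ≥ (t/2)^a`
and `1/τ ≥ 1/t`. This is the passage from second index `p` to weak type. -/
theorem rpow_mul_le_lintegral_of_antitoneOn {Ψ : ℝ → ℝ≥0∞} (h : AntitoneOn Ψ (Ioi 0)) {a p t : ℝ}
    (ha : 0 < a) (hp : 0 < p) (ht : 0 < t) :
    (ENNReal.ofReal t ^ a * Ψ t) ^ p ≤ ENNReal.ofReal (2 * 2 ^ (a * p)) *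
      ∫⁻ τ, (ENNReal.ofReal τ ^ a * Ψ τ) ^ p ∂haarPos := by
  have h1 : ENNReal.ofReal (1 / 2 * (2 : ℝ)⁻¹ ^ (a * p)) * (ENNReal.ofReal t ^ a * Ψ t) ^ p ≤
      ∫⁻ τ, (ENNReal.ofReal τ ^ a * Ψ τ) ^ p ∂haarPos := by
    calc ENNReal.ofReal (1 / 2 * (2 : ℝ)⁻¹ ^ (a * p)) * (ENNReal.ofReal t ^ a * Ψ t) ^ p
        = (ENNReal.ofReal (2⁻¹ * t) ^ a * Ψ t) ^ p / ENNReal.ofReal t *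
            ENNReal.ofReal (t - 2⁻¹ * t) := by
          have e1 : ENNReal.ofReal (t - 2⁻¹ * t) = ENNReal.ofReal (1 / 2) * ENNReal.ofReal t := by
            rw [← ENNReal.ofReal_mul (by norm_num)]; congr 1; ring
          have h0 : ENNReal.ofReal t ≠ 0 := by simpa
          rw [e1, mul_left_comm, ENNReal.div_mul_cancel h0 ofReal_ne_top,
            ENNReal.ofReal_mul (by norm_num : (0 : ℝ) ≤ 2⁻¹),
            ENNReal.mul_rpow_of_nonneg (ENNReal.ofReal 2⁻¹) _ ha.le, mul_assoc,
            ENNReal.mul_rpow_of_nonneg (ENNReal.ofReal 2⁻¹ ^ a) _ hp.le, ← ENNReal.rpow_mul,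
            ENNReal.ofReal_rpow_of_pos (by norm_num : (0 : ℝ) < 2⁻¹),
            ENNReal.ofReal_mul (by norm_num : (0 : ℝ) ≤ 1 / 2), mul_assoc]
      _ = ∫⁻ τ in Ioo (2⁻¹ * t) t,
            (ENNReal.ofReal (2⁻¹ * t) ^ a * Ψ t) ^ p / ENNReal.ofReal t := by
          rw [setLIntegral_const, Real.volume_Ioo]
      _ ≤ ∫⁻ τ in Ioo (2⁻¹ * t) t, (ENNReal.ofReal τ ^ a * Ψ τ) ^ p / ENNReal.ofReal τ := by
          refine setLIntegral_mono' measurableSet_Ioo fun τ hτ => ?_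
          have hτ0 : 0 < τ := lt_trans (by positivity) hτ.1
          gcongr
          · exact hτ.1.le
          · exact h hτ0 ht hτ.2.le
          · exact hτ.2.le
      _ ≤ ∫⁻ τ in Ioi 0, (ENNReal.ofReal τ ^ a * Ψ τ) ^ p / ENNReal.ofReal τ :=
          lintegral_mono_set fun τ hτ => lt_trans (by positivity) hτ.1
      _ = _ := (lintegral_haarPos _).symm
  calc (ENNReal.ofReal t ^ a * Ψ t) ^ p
      = ENNReal.ofReal (2 * 2 ^ (a * p)) * (ENNReal.ofReal (1 / 2 * (2 : ℝ)⁻¹ ^ (a * p)) *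
          (ENNReal.ofReal t ^ a * Ψ t) ^ p) := by
        rw [← mul_assoc, ← ENNReal.ofReal_mul (by positivity)]
        have : 2 * (2 : ℝ) ^ (a * p) * (1 / 2 * 2⁻¹ ^ (a * p)) = 1 := by
          rw [Real.inv_rpow (by norm_num)]
          have := (Real.rpow_pos_of_pos (zero_lt_two' ℝ) (a * p)).ne'
          field_simp
        rw [this, ENNReal.ofReal_one, one_mul]
    _ ≤ _ := by gcongr

theorem rearr_mono {X : Type*} [MeasurableSpace X] {μ : Measure X} {f g : X → ℝ≥0∞}
    (h : ∀ x, f x ≤ g x) (t : ℝ) : rearr μ f t ≤ rearr μ g t :=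
  sInf_le_sInf fun _ hl => lt_of_le_of_lt (measure_mono fun x hx => lt_of_lt_of_le hx (h x)) hl

theorem abs_truncT_le {k : ℝ} (hk : 0 ≤ k) (τ : ℝ) : |truncT k τ| ≤ k := by
  unfold truncT
  rw [abs_le]
  exact ⟨le_max_left _ _, max_le (by linarith) (min_le_right _ _)⟩

theorem abs_truncT_le_abs {k : ℝ} (hk : 0 ≤ k) (τ : ℝ) : |truncT k τ| ≤ |τ| := by
  unfold truncT
  rcases max_cases (-k) (min τ k) with h | h <;> rcases min_cases τ k with h' | h' <;>
    rcases abs_cases τ with h'' | h'' <;> rw [abs_le] <;> constructor <;> linarith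

theorem abs_truncG_le_abs {k : ℝ} (hk : 0 ≤ k) (τ : ℝ) : |truncG k τ| ≤ |τ| := by
  unfold truncG truncT
  rcases max_cases (-k) (min τ k) with h | h <;> rcases min_cases τ k with h' | h' <;>
    rcases abs_cases τ with h'' | h'' <;> rw [abs_le] <;> constructor <;> linarith

theorem truncG_eq_zero {k τ : ℝ} (h : |τ| ≤ k) : truncG k τ = 0 := by
  rw [abs_le] at h
  unfold truncG truncT
  rw [min_eq_left h.2, max_eq_right h.1, sub_self]

/-- All bounds are homogeneous in `k`, so the point beyond which the rearrangement of `u` drops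
below `k` depends only on `A`, `p`, `a₁` and `a₂`. Cutting the values of `u` at `k` thus amounts to
cutting the half line at a fixed `t₀`, on either side of which one of the two powers of `t`
dominates the other up to a constant. -/
theorem exists_lorentzNorm_trunc_le {p a₁ a₂ : ℝ} (hp : 1 < p) (ha₂ : 0 < a₂) (h21 : a₂ < a₁)
    (ha₁ : a₁ < 1) {A : ℝ≥0∞} (hA : A ≠ ⊤) :
    ∃ C : ℝ≥0∞, C ≠ ⊤ ∧ ∀ (d : ℕ) (u : EuclideanSpace ℝ (Fin d) → ℝ) (k : ℝ), 0 < k →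
      ∀ Ψ₁ Ψ₂ : ℝ → ℝ≥0∞, AntitoneOn Ψ₁ (Ioi 0) → AntitoneOn Ψ₂ (Ioi 0) →
      (∀ t, 0 < t → rearr volume (fun x => ‖u x‖ₑ) t ≤ Ψ₁ t + Ψ₂ t) →
      ∫⁻ t, (ENNReal.ofReal t ^ a₁ * Ψ₁ t) ^ p ∂haarPos ≤ A * ENNReal.ofReal k ^ p →
      ∫⁻ t, (ENNReal.ofReal t ^ a₂ * Ψ₂ t) ^ p ∂haarPos ≤ A * ENNReal.ofReal k ^ p →
      lorentzNorm (1 / a₁) p (fun x => truncG k (u x)) +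
        lorentzNorm (1 / a₂) p (fun x => truncT k (u x)) ≤ C * ENNReal.ofReal k := by
  have hp0 : 0 < p := zero_lt_one.trans hp
  have ha₁0 : 0 < a₁ := ha₂.trans h21
  -- The weak-type constant for the larger exponent `a₁`, which also serves for `a₂`.
  set c : ℝ := 2 * 2 ^ (a₁ * p) with hc
  set D : ℝ≥0∞ := (ENNReal.ofReal c * A) ^ (1 / p) with hD
  have hDt : D ≠ ⊤ := ENNReal.rpow_ne_top_of_nonneg (by positivity) (mul_ne_top ofReal_ne_top hA)
  -- Chosen so that `t₀^(a₂) = 2 D + 1`: each `Ψ_j` is at most `D k / t^(a_j)` by the weak-type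
  -- bound, so beyond `t₀` their sum is at most `2 D k / (2 D + 1) < k`. As `t₀ ≥ 1`, the same
  -- choice works for `a₁ ≥ a₂`.
  set t₀ : ℝ := (2 * D.toReal + 1) ^ (1 / a₂) with ht₀
  have ht₀1 : 1 ≤ t₀ := Real.one_le_rpow (by linarith [D.toReal_nonneg]) (by positivity)
  have ht₀0 : 0 < t₀ := zero_lt_one.trans_le ht₀1
  have ht₀a : t₀ ^ a₂ = 2 * D.toReal + 1 := by
    rw [ht₀, ← Real.rpow_mul (by positivity), one_div_mul_cancel ha₂.ne', Real.rpow_one]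
  set e : ℝ≥0∞ := ENNReal.ofReal (t₀ ^ (a₁ - a₂)) ^ p with he
  have het : e ≠ ⊤ := ENNReal.rpow_ne_top_of_nonneg hp0.le ofReal_ne_top
  have h2t : (2 : ℝ≥0∞) ^ (p - 1) ≠ ⊤ := ENNReal.rpow_ne_top_of_nonneg (by linarith) (by simp)
  set X₁ : ℝ≥0∞ := 2 ^ (p - 1) * (A + e * A) with hX₁
  set X₂ : ℝ≥0∞ := ENNReal.ofReal (t₀ ^ (a₂ * p) / (a₂ * p)) + 2 ^ (p - 1) * (A + A) with hX₂
  have hX₁t : X₁ ≠ ⊤ := by finiteness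
  have hX₂t : X₂ ≠ ⊤ := by finiteness
  have hrt : ∀ X : ℝ≥0∞, X ≠ ⊤ → X ^ (1 / p) ≠ ⊤ := fun X hX =>
    ENNReal.rpow_ne_top_of_nonneg (by positivity) hX
  refine ⟨ENNReal.ofReal (1 / (1 - a₁)) * X₁ ^ (1 / p) +
    ENNReal.ofReal (1 / (1 - a₂)) * X₂ ^ (1 / p), add_ne_top.2
    ⟨mul_ne_top ofReal_ne_top (hrt _ hX₁t), mul_ne_top ofReal_ne_top (hrt _ hX₂t)⟩, ?_⟩
  intro d u k hk Ψ₁ Ψ₂ hΨ₁ hΨ₂ hu hI₁ hI₂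
  set κ := ENNReal.ofReal k with hκ
  have hκ0 : κ ≠ 0 := by simpa [hκ] using hk
  have hκt : κ ≠ ⊤ := ofReal_ne_top
  have hm₁ := hΨ₁.aemeasurable_haarPos
  have hm₂ := hΨ₂.aemeasurable_haarPos
  -- the rearrangement of `u` is below the level `k` beyond `t₀`
  have hptw : ∀ (Ψ : ℝ → ℝ≥0∞) (a : ℝ), AntitoneOn Ψ (Ioi 0) → a₂ ≤ a → a ≤ a₁ →
      ∫⁻ t, (ENNReal.ofReal t ^ a * Ψ t) ^ p ∂haarPos ≤ A * κ ^ p → ∀ t, t₀ < t →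
      ENNReal.ofReal (2 * D.toReal + 1) * Ψ t ≤ D * κ := by
    intro Ψ a hΨ h1 h2 hI t ht
    have ha : 0 < a := ha₂.trans_le h1
    have ht0 : 0 < t := ht₀0.trans ht
    have h3 := rpow_mul_le_lintegral_of_antitoneOn hΨ ha hp0 ht0
    have h4 : (ENNReal.ofReal t ^ a * Ψ t) ^ p ≤ (ENNReal.ofReal c * A) * κ ^ p := by
      refine h3.trans ?_
      rw [mul_assoc]
      gcongr
      · rw [hc]
        gcongr
        norm_num
    have h5 : ENNReal.ofReal t ^ a * Ψ t ≤ D * κ := by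
      rw [← ENNReal.rpow_le_rpow_iff hp0, ENNReal.mul_rpow_of_nonneg D _ hp0.le, hD,
        ← ENNReal.rpow_mul, one_div_mul_cancel hp0.ne', ENNReal.rpow_one]
      exact h4
    refine le_trans ?_ h5
    gcongr
    rw [ENNReal.ofReal_rpow_of_pos ht0, ← ht₀a]
    refine ENNReal.ofReal_le_ofReal ?_
    calc t₀ ^ a₂ ≤ t₀ ^ a := Real.rpow_le_rpow_of_exponent_le ht₀1 h1
      _ ≤ t ^ a := Real.rpow_le_rpow ht₀0.le ht.le ha.le
  have hsmall : ∀ t, t₀ < t → rearr volume (fun x => ‖u x‖ₑ) t < κ := by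
    intro t ht
    refine (hu t (ht₀0.trans ht)).trans_lt ?_
    have h1 := hptw Ψ₁ a₁ hΨ₁ h21.le le_rfl hI₁ t ht
    have h2 := hptw Ψ₂ a₂ hΨ₂ le_rfl h21.le hI₂ t ht
    set G := ENNReal.ofReal (2 * D.toReal + 1) with hG
    have hG0 : G ≠ 0 := by
      have := D.toReal_nonneg
      simp [hG]; linarith
    have hG2 : 2 * D < G := by
      rw [hG, ENNReal.ofReal_add (by positivity) (by norm_num), ENNReal.ofReal_mul (by norm_num),
        ENNReal.ofReal_toReal hDt]
      simpa using ENNReal.lt_add_right (mul_ne_top (by simp) hDt) one_ne_zero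
    have h3 : G * (Ψ₁ t + Ψ₂ t) < G * κ := by
      calc G * (Ψ₁ t + Ψ₂ t) ≤ 2 * D * κ := by
            rw [mul_add, two_mul, add_mul]; exact add_le_add h1 h2
        _ < G * κ := ENNReal.mul_lt_mul_left hκ0 hκt hG2
    exact lt_of_mul_lt_mul_left' h3
  have hG0 : ∀ t, t₀ < t → rearr volume (fun x => ‖truncG k (u x)‖ₑ) t = 0 := by
    intro t ht
    obtain ⟨l, hl, hlk⟩ := sInf_lt_iff.1 (hsmall t ht)
    refine le_antisymm (sInf_le (lt_of_le_of_lt (measure_mono fun x hx => ?_) hl)) bot_le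
    have hx : 0 < ‖truncG k (u x)‖ₑ := hx
    by_contra! hc
    have hux : ‖u x‖ₑ ≤ κ := (not_lt.1 hc).trans hlk.le
    rw [hκ, ← ofReal_norm, ENNReal.ofReal_le_ofReal_iff hk.le] at hux
    rw [truncG_eq_zero hux] at hx
    simp at hx
  have hGle : ∀ t, rearr volume (fun x => ‖truncG k (u x)‖ₑ) t ≤
      rearr volume (fun x => ‖u x‖ₑ) t := rearr_mono fun x => by
    rw [← ofReal_norm, ← ofReal_norm]
    exact ENNReal.ofReal_le_ofReal (abs_truncG_le_abs hk.le _)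
  have hTle : ∀ t, rearr volume (fun x => ‖truncT k (u x)‖ₑ) t ≤
      rearr volume (fun x => ‖u x‖ₑ) t := rearr_mono fun x => by
    rw [← ofReal_norm, ← ofReal_norm]
    exact ENNReal.ofReal_le_ofReal (abs_truncT_le_abs hk.le _)
  have hTk : ∀ t, 0 < t → rearr volume (fun x => ‖truncT k (u x)‖ₑ) t ≤ κ := by
    intro t ht
    refine sInf_le ?_
    have : {x | κ < ‖truncT k (u x)‖ₑ} = ∅ := by
      ext x
      simp only [mem_ofPred_eq, mem_empty_iff_false, iff_false, not_lt]
      rw [← ofReal_norm]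
      exact ENNReal.ofReal_le_ofReal (abs_truncT_le hk.le _)
    simp only [mem_ofPred_eq, this, measure_empty]
    simpa using ht
  have hadd : ∀ x y : ℝ≥0∞, (x + y) ^ p ≤ 2 ^ (p - 1) * (x ^ p + y ^ p) := fun x y =>
    ENNReal.rpow_add_le_mul_rpow_add_rpow x y hp.le
  -- Beyond `t₀` the rearrangement of `G_k(u)` vanishes. Up to `t₀`, `t^(a₁) ≤ t₀^(a₁ - a₂) t^(a₂)`
  -- makes `Ψ₂` admissible with the exponent `a₁`.
  have hG : ∫⁻ t, (ENNReal.ofReal t ^ a₁ * rearr volume (fun x => ‖truncG k (u x)‖ₑ) t) ^ p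
      ∂haarPos ≤ X₁ * κ ^ p := by
    calc _ ≤ ∫⁻ t, 2 ^ (p - 1) * ((ENNReal.ofReal t ^ a₁ * Ψ₁ t) ^ p +
          e * (ENNReal.ofReal t ^ a₂ * Ψ₂ t) ^ p) ∂haarPos := by
          refine lintegral_haarPos_mono fun t ht => ?_
          rcases lt_or_ge t₀ t with h | h
          · rw [hG0 t h]; simp [hp0]
          · refine le_trans (ENNReal.rpow_le_rpow ?_ hp0.le)
              ((hadd (ENNReal.ofReal t ^ a₁ * Ψ₁ t)
                (ENNReal.ofReal (t₀ ^ (a₁ - a₂)) * (ENNReal.ofReal t ^ a₂ * Ψ₂ t))).trans_eq ?_)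
            · calc _ ≤ ENNReal.ofReal t ^ a₁ * (Ψ₁ t + Ψ₂ t) := by
                    gcongr; exact (hGle t).trans (hu t ht)
                _ ≤ _ := by
                    rw [mul_add]
                    refine add_le_add le_rfl ?_
                    rw [← mul_assoc]
                    gcongr
                    rw [ENNReal.ofReal_rpow_of_pos ht, ENNReal.ofReal_rpow_of_pos ht,
                      ← ENNReal.ofReal_mul (by positivity)]
                    refine ENNReal.ofReal_le_ofReal ?_
                    calc t ^ a₁ = t ^ (a₁ - a₂) * t ^ a₂ := by
                          rw [← Real.rpow_add ht]; congr 1; ring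
                      _ ≤ _ := by gcongr
            · rw [he, ENNReal.mul_rpow_of_nonneg (ENNReal.ofReal (t₀ ^ (a₁ - a₂))) _ hp0.le]
      _ = 2 ^ (p - 1) * (∫⁻ t, (ENNReal.ofReal t ^ a₁ * Ψ₁ t) ^ p ∂haarPos +
          e * ∫⁻ t, (ENNReal.ofReal t ^ a₂ * Ψ₂ t) ^ p ∂haarPos) := by
          rw [lintegral_const_mul' _ _ h2t, lintegral_add_left' (by fun_prop),
            lintegral_const_mul' _ _ het]
      _ ≤ 2 ^ (p - 1) * (A * κ ^ p + e * (A * κ ^ p)) := by gcongr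
      _ = _ := by rw [hX₁]; ring
  -- Below `t₀` the bound `k` is enough because `t^(a₂ p)` is integrable for `dt / t` near zero.
  -- From `t₀ ≥ 1` on, `t^(a₂) ≤ t^(a₁)` makes `Ψ₁` admissible with the exponent `a₂`.
  have hT : ∫⁻ t, (ENNReal.ofReal t ^ a₂ * rearr volume (fun x => ‖truncT k (u x)‖ₑ) t) ^ p
      ∂haarPos ≤ X₂ * κ ^ p := by
    calc _ ≤ ∫⁻ t, ((Iio t₀).indicator (fun t => κ ^ p * ENNReal.ofReal t ^ (a₂ * p)) t +
          2 ^ (p - 1) * ((ENNReal.ofReal t ^ a₁ * Ψ₁ t) ^ p +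
          (ENNReal.ofReal t ^ a₂ * Ψ₂ t) ^ p)) ∂haarPos := by
          refine lintegral_haarPos_mono fun t ht => ?_
          rcases lt_or_ge t t₀ with h | h
          · refine le_add_right ?_
            rw [indicator_of_mem (mem_Iio.2 h), ENNReal.mul_rpow_of_nonneg _ _ hp0.le,
              ← ENNReal.rpow_mul, mul_comm]
            gcongr
            exact hTk t ht
          · refine le_add_left ?_
            refine le_trans (ENNReal.rpow_le_rpow ?_ hp0.le) (hadd _ _)
            calc _ ≤ ENNReal.ofReal t ^ a₂ * (Ψ₁ t + Ψ₂ t) := by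
                  gcongr; exact (hTle t).trans (hu t ht)
              _ ≤ _ := by
                  rw [mul_add]
                  gcongr
                  exact ENNReal.one_le_ofReal.2 (ht₀1.trans h)
      _ = κ ^ p * ENNReal.ofReal (t₀ ^ (a₂ * p) / (a₂ * p)) +
          2 ^ (p - 1) * (∫⁻ t, (ENNReal.ofReal t ^ a₁ * Ψ₁ t) ^ p ∂haarPos +
          ∫⁻ t, (ENNReal.ofReal t ^ a₂ * Ψ₂ t) ^ p ∂haarPos) := by
          have hmeas : Measurable fun t : ℝ => κ ^ p * ENNReal.ofReal t ^ (a₂ * p) := by fun_prop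
          rw [lintegral_add_left (hmeas.indicator measurableSet_Iio),
            lintegral_const_mul' _ _ h2t, lintegral_add_left' (by fun_prop)]
          congr 1
          rw [lintegral_haarPos, ← lintegral_Ioo_rpow_sub_one (by positivity) ht₀0,
            ← lintegral_const_mul _ (by fun_prop), ← lintegral_indicator measurableSet_Ioi,
            ← lintegral_indicator measurableSet_Ioo]
          refine lintegral_congr fun t => ?_
          by_cases h0 : 0 < t
          · by_cases h1 : t < t₀
            · simp only [indicator, mem_Ioi, mem_Iio, mem_Ioo, h0, h1, and_self, if_true,
                ← ofReal_rpow_div_ofReal h0, mul_div_assoc]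
            · simp [h1]
          · simp [h0]
      _ ≤ κ ^ p * ENNReal.ofReal (t₀ ^ (a₂ * p) / (a₂ * p)) +
          2 ^ (p - 1) * (A * κ ^ p + A * κ ^ p) := by gcongr
      _ = _ := by rw [hX₂]; ring
  have hfin : ∀ X : ℝ≥0∞, (X * κ ^ p) ^ (1 / p) = X ^ (1 / p) * κ := fun X => by
    rw [ENNReal.mul_rpow_of_nonneg _ _ (by positivity), ← ENNReal.rpow_mul,
      mul_one_div_cancel hp0.ne', ENNReal.rpow_one]
  have hq : ∀ a : ℝ, 0 < a → a < 1 → 1 < 1 / a := fun a h0 h1 => by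
    rw [lt_div_iff₀ h0]; linarith
  rw [add_mul, mul_assoc, mul_assoc, ← hfin, ← hfin]
  gcongr
  · refine (lorentzNorm_le (hq _ ha₁0 ha₁) hp _).trans ?_
    rw [one_div_one_div]
    gcongr
  · refine (lorentzNorm_le (hq _ ha₂ (h21.trans ha₁)) hp _).trans ?_
    rw [one_div_one_div]
    gcongr

end Truncation

/-! ### Directional derivatives under the Fourier transform -/

section LineDerivative

open FourierTransform Filter Module

variable {E : Type*} [NormedAddCommGroup E] [InnerProductSpace ℝ E] [FiniteDimensional ℝ E]
  [MeasurableSpace E] [BorelSpace E]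

/-- By Fubini the integral vanishes on every line parallel to the last axis that misses `x₀` and
carries integrable data. As there is at least one transverse dimension, the line through `x₀` is
negligible. -/
theorem integral_hasLineDerivAt_eq_zero_aux {m : ℕ} (hm : 0 < m) {μ : Measure ((Fin m → ℝ) × ℝ)}
    [μ.IsAddHaarMeasure] {f f' : (Fin m → ℝ) × ℝ → ℂ} {x₀ : (Fin m → ℝ) × ℝ}
    (hf : Integrable f μ) (hf' : Integrable f' μ)
    (h : ∀ x, x ≠ x₀ → HasLineDerivAt ℝ f (f' x) x (0, 1)) : ∫ x, f' x ∂μ = 0 := by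
  have : Nonempty (Fin m) := ⟨⟨0, hm⟩⟩
  let ν : Measure (Fin m → ℝ) := volume
  have A : ν.prod volume = (Measure.addHaarScalarFactor (ν.prod volume) μ) • μ :=
    Measure.isAddLeftInvariant_eq_smul _ _
  have Hf : Integrable f (ν.prod volume) := by rw [A]; exact hf.smul_measure_nnreal
  have Hf' : Integrable f' (ν.prod volume) := by rw [A]; exact hf'.smul_measure_nnreal
  rw [Measure.isAddLeftInvariant_eq_smul μ (ν.prod volume), integral_smul_nnreal_measure,
    integral_prod _ Hf']
  suffices H : ∀ᵐ y ∂ν, ∫ t, f' (y, t) = 0 by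
    rw [integral_congr_ae H]; simp
  have hne : ∀ᵐ y ∂ν, y ≠ x₀.1 := by simp [ae_iff, ν]
  filter_upwards [Hf.prod_right_ae, Hf'.prod_right_ae, hne] with y h1 h2 h3
  refine integral_eq_zero_of_hasDerivAt_of_integrable (fun t => ?_) h2 h1
  have : (y, t) ≠ x₀ := fun h => h3 (by rw [← h])
  convert! (h (y, t) this).scomp_of_eq t ((hasDerivAt_id t).add (hasDerivAt_const t (-t)))
        (by simp) <;> simp

/-- In dimension at least two, the integral of an integrable directional derivative vanishes, even
if the function fails to be differentiable at one point. -/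
theorem integral_hasLineDerivAt_eq_zero (hn : 2 ≤ finrank ℝ E) {f f' : E → ℂ} {v x₀ : E}
    (hf : Integrable f) (hf' : Integrable f')
    (h : ∀ x, x ≠ x₀ → HasLineDerivAt ℝ f (f' x) x v) : ∫ x, f' x = 0 := by
  have : Nontrivial E := Module.nontrivial_of_finrank_pos (R := ℝ) (by lia)
  rcases eq_or_ne v 0 with rfl | hv
  · have hne : ∀ᵐ y : E, y ≠ x₀ := by simp [ae_iff]
    rw [integral_eq_zero_of_ae]
    filter_upwards [hne] with x hx
    simpa using (h x hx).unique (hasLineDerivAt_zero (f := f) (x := x))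
  let n := finrank ℝ E
  let E' := Fin (n - 1) → ℝ
  -- A linear change of variables makes `v` the last coordinate vector; the pushed-forward volume is
  -- again a Haar measure.
  obtain ⟨L, hL⟩ : ∃ L : E ≃L[ℝ] (E' × ℝ), L v = (0, 1) := by
    have : finrank ℝ (E' × ℝ) = n := by simpa [this, E'] using Nat.sub_add_cancel finrank_pos
    have L₀ : E ≃L[ℝ] (E' × ℝ) := (ContinuousLinearEquiv.ofFinrankEq this).symm
    obtain ⟨M, hM⟩ : ∃ M : (E' × ℝ) ≃L[ℝ] (E' × ℝ), M (L₀ v) = (0, 1) := by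
      apply SeparatingDual.exists_continuousLinearEquiv_apply_eq
      · simpa using hv
      · simp
    exact ⟨L₀.trans M, by simp [hM]⟩
  let ν := Measure.map L (volume : Measure E)
  have L_emb : MeasurableEmbedding L := L.toHomeomorph.measurableEmbedding
  have h1 : ∫ x, f' x = ∫ x, f' (L.symm x) ∂ν := by
    rw [L_emb.integral_map]; simp
  rw [h1]
  refine integral_hasLineDerivAt_eq_zero_aux (f := fun x => f (L.symm x)) (x₀ := L x₀)
    (by lia) ?_ ?_ fun x hx => ?_
  · simpa [ν, L_emb.integrable_map_iff, Function.comp_def] using hf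
  · simpa [ν, L_emb.integrable_map_iff, Function.comp_def] using hf'
  · have h2 : f = (f ∘ L.symm) ∘ (L : E →ₗ[ℝ] (E' × ℝ)) := by ext y; simp
    have h3 := h (L.symm x) (fun h => hx (by rw [← h]; simp))
    rw [h2] at h3
    convert! h3.of_comp using 1
    · simp
    · simp [← hL]

omit [FiniteDimensional ℝ E] [MeasurableSpace E] [BorelSpace E] in
theorem hasLineDerivAt_mul_fourierChar {f : E → ℂ} {f' : ℂ} {v x : E}
    (h : HasLineDerivAt ℝ f f' x v) (ξ : E) :
    HasLineDerivAt ℝ (fun y => (Real.fourierChar (-inner ℝ y ξ) : ℂ) * f y)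
      ((Real.fourierChar (-inner ℝ x ξ) : ℂ) * f' -
        2 * Real.pi * Complex.I * inner ℝ v ξ * ((Real.fourierChar (-inner ℝ x ξ) : ℂ) * f x))
      x v := by
  have h1 : HasDerivAt (fun t : ℝ => (Real.fourierChar (-inner ℝ (x + t • v) ξ) : ℂ))
      (-(2 * Real.pi * Complex.I * inner ℝ v ξ) * (Real.fourierChar (-inner ℝ x ξ) : ℂ)) 0 := by
    simp only [Real.fourierChar_apply, inner_add_left, real_inner_smul_left]
    have h2 : HasDerivAt (fun t : ℝ => ((2 * Real.pi * -(inner ℝ x ξ + t * inner ℝ v ξ) : ℝ) : ℂ)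
        * Complex.I) (((2 * Real.pi * -(1 * inner ℝ v ξ) : ℝ) : ℂ) * Complex.I) 0 := by
      refine HasDerivAt.mul_const ?_ _
      exact (((hasDerivAt_id (0 : ℝ)).mul_const (inner ℝ v ξ)).const_add _ |>.neg
        |>.const_mul (2 * Real.pi)).ofReal_comp
    convert! h2.cexp using 1
    push_cast
    simp
    ring
  have h3 : HasDerivAt (fun t : ℝ => f (x + t • v)) f' 0 := h
  have h4 := h1.mul h3
  simp only [zero_smul, add_zero] at h4
  unfold HasLineDerivAt
  convert! h4 using 1
  ring

theorem integrable_fourierChar_mul {f : E → ℂ} (hf : Integrable f) (ξ : E) :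
    Integrable fun y => (Real.fourierChar (-inner ℝ y ξ) : ℂ) * f y := by
  simpa [Circle.smul_def] using (Real.fourierIntegral_convergent_iff ξ).2 hf

/-- Fourier transform of a directional derivative, in dimension at least two; the function may fail
to be differentiable at the origin. -/
theorem fourier_hasLineDerivAt (hn : 2 ≤ finrank ℝ E) {f f' : E → ℂ} {v : E}
    (hf : Integrable f) (hf' : Integrable f')
    (h : ∀ x, x ≠ 0 → HasLineDerivAt ℝ f (f' x) x v) (ξ : E) :
    𝓕 f' ξ = 2 * Real.pi * Complex.I * inner ℝ v ξ * 𝓕 f ξ := by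
  have h1 := integrable_fourierChar_mul hf ξ
  have h2 := integrable_fourierChar_mul hf' ξ
  have := integral_hasLineDerivAt_eq_zero hn h1 (h2.sub (h1.const_mul
    (2 * Real.pi * Complex.I * inner ℝ v ξ))) (x₀ := 0) (v := v)
    fun x hx => hasLineDerivAt_mul_fourierChar (h x hx) ξ
  simp only [Pi.sub_apply] at this
  rw [integral_sub h2 (h1.const_mul _), integral_const_mul, sub_eq_zero] at this
  simpa [Real.fourier_eq, Circle.smul_def] using this

/-- Fubini's theorem for the Fourier transform of a superposition. -/
theorem fourier_integral_right {T : Type*} [MeasurableSpace T] {ν : Measure T} [SFinite ν]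
    {F : T → E → ℂ} (hF : Integrable (Function.uncurry F) (ν.prod volume)) (ξ : E) :
    𝓕 (fun x => ∫ t, F t x ∂ν) ξ = ∫ t, 𝓕 (F t) ξ ∂ν := by
  simp only [Real.fourier_eq, Circle.smul_def, smul_eq_mul, ← integral_const_mul]
  rw [integral_integral_swap]
  have h1 : Integrable (fun z : E × T => Function.uncurry F z.swap) (volume.prod ν) := hF.swap
  refine (h1.bdd_mul (c := 1) (f := fun z : E × T => (Real.fourierChar (-inner ℝ z.1 ξ) : ℂ))
    ?_ ?_)
  · have : Continuous fun y : E => (Real.fourierChar (-inner ℝ y ξ) : ℂ) :=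
      continuous_subtype_val.comp <| Real.continuous_fourierChar.comp (by fun_prop)
    exact (this.measurable.comp measurable_fst).aestronglyMeasurable
  · exact Eventually.of_forall fun z => (Circle.norm_coe _).le

/-- The derivative rule is applied at each parameter and integrated on the Fourier side, so the
superposition itself is never differentiated. -/
theorem fourier_integral_hasLineDerivAt (hn : 2 ≤ finrank ℝ E) {T : Type*} [MeasurableSpace T]
    {ν : Measure T} [SFinite ν] {F F' : T → E → ℂ} {v : E}
    (hF : Integrable (Function.uncurry F) (ν.prod volume))
    (hF' : Integrable (Function.uncurry F') (ν.prod volume))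
    (h : ∀ᵐ t ∂ν, ∀ x, x ≠ 0 → HasLineDerivAt ℝ (F t) (F' t x) x v) (ξ : E) :
    𝓕 (fun x => ∫ t, F' t x ∂ν) ξ =
      2 * Real.pi * Complex.I * inner ℝ v ξ * 𝓕 (fun x => ∫ t, F t x ∂ν) ξ := by
  rw [fourier_integral_right hF, fourier_integral_right hF', ← integral_const_mul]
  refine integral_congr_ae ?_
  filter_upwards [h, hF.prod_right_ae, hF'.prod_right_ae] with t h1 h2 h3
  exact fourier_hasLineDerivAt hn h2 h3 h1 ξ

end LineDerivative

/-! ### The heat kernel -/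

section Heat

open FourierTransform Filter Module Real

/-- The integrand identity for the substitution `t ↦ t⁻¹`, which reduces the integrals with `exp
(-A/t)` to Gamma integrals. -/
theorem rpow_neg_one_substitution (a A : ℝ) {t : ℝ} (ht : 0 < t) :
    (|(-1 : ℝ)| * t ^ (-1 - 1 : ℝ)) • ((t ^ (-1 : ℝ)) ^ (a - 1) * exp (-(A * t ^ (-1 : ℝ)))) =
      t ^ (-a - 1) * exp (-(A / t)) := by
  rw [← rpow_mul ht.le, rpow_neg_one, abs_neg, abs_one, one_mul, smul_eq_mul, ← mul_assoc,
    ← rpow_add ht, ← div_eq_mul_inv]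
  congr 2; ring

theorem integrableOn_rpow_mul_exp_neg_div {a A : ℝ} (ha : 0 < a) (hA : 0 < A) :
    IntegrableOn (fun t : ℝ => t ^ (-a - 1) * exp (-(A / t))) (Ioi 0) := by
  have h : IntegrableOn (fun t : ℝ => t ^ (a - 1) * exp (-(A * t))) (Ioi 0) := by
    simpa [neg_mul] using integrableOn_rpow_mul_exp_neg_mul_rpow (s := a - 1) (p := 1)
      (b := A) (by linarith) one_pos hA
  rw [← integrableOn_Ioi_comp_rpow_iff _ (p := -1) (by norm_num)] at h
  refine h.congr_fun (fun t (ht : 0 < t) => ?_) measurableSet_Ioi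
  exact rpow_neg_one_substitution a A ht

theorem integral_rpow_mul_exp_neg_div {a A : ℝ} (ha : 0 < a) (hA : 0 < A) :
    ∫ t in Ioi (0 : ℝ), t ^ (-a - 1) * exp (-(A / t)) = A ^ (-a) * Gamma a := by
  have h := Real.integral_rpow_mul_exp_neg_mul_Ioi ha hA
  rw [← integral_comp_rpow_Ioi _ (p := -1) (by norm_num), one_div, inv_rpow hA.le,
    ← rpow_neg hA.le] at h
  rw [← h]
  refine setIntegral_congr_fun measurableSet_Ioi (fun t (ht : 0 < t) => ?_)
  exact (rpow_neg_one_substitution a A ht).symm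

variable {E : Type*} [NormedAddCommGroup E] [InnerProductSpace ℝ E]

/-- The Gaussian whose Fourier transform is `ξ ↦ exp (-t * ‖ξ‖ ^ 2)`. -/
noncomputable def heat (t : ℝ) (x : E) : ℝ :=
  (π / t) ^ (finrank ℝ E / 2 : ℝ) * exp (-(π ^ 2 / t) * ‖x‖ ^ 2)

theorem heat_pos {t : ℝ} (ht : 0 < t) (x : E) : 0 < heat t x := by
  unfold heat; positivity

theorem continuousOn_heat : ContinuousOn (fun z : ℝ × E => heat z.1 z.2) (Ioi 0 ×ˢ univ) := by
  unfold heat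
  have h : ∀ z ∈ (Ioi 0 ×ˢ univ : Set (ℝ × E)), z.1 ≠ 0 := fun z hz => (mem_prod.1 hz).1.ne'
  refine ContinuousOn.mul (ContinuousOn.rpow_const ?_ fun z hz => ?_) ?_
  · exact continuousOn_const.div continuousOn_fst h
  · have : 0 < z.1 := (mem_prod.1 hz).1
    left; positivity
  · refine Real.continuous_exp.comp_continuousOn (ContinuousOn.mul ?_ (by fun_prop))
    exact (continuousOn_const.div continuousOn_fst h).neg

theorem heat_two_mul {t : ℝ} (ht : 0 < t) (x : E) :
    2 ^ (finrank ℝ E / 2 : ℝ) * heat (2 * t) x =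
      (π / t) ^ (finrank ℝ E / 2 : ℝ) * exp (-(π ^ 2 / (2 * t)) * ‖x‖ ^ 2) := by
  unfold heat
  rw [← mul_assoc, ← mul_rpow (by positivity) (by positivity)]
  congr 2
  field_simp

/-- Half of the Gaussian exponent absorbs `‖x‖^m` at the price `t^(m/2)`; the other half is a
multiple of the heat kernel at time `2 t`, which has unit mass. The case `m = 1` serves one
derivative, `m = 2` a derivative times a factor vanishing linearly at the origin. -/
theorem norm_pow_mul_heat_le {t : ℝ} (ht : 0 < t) (x : E) {m : ℕ} (hm : m ≤ 2) :
    ‖x‖ ^ m * heat t x ≤ t ^ (m / 2 : ℝ) * (2 ^ (finrank ℝ E / 2 : ℝ) * heat (2 * t) x) := by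
  rw [heat_two_mul ht, heat]
  have h1 : exp (-(π ^ 2 / t) * ‖x‖ ^ 2) =
      exp (-(π ^ 2 / (2 * t)) * ‖x‖ ^ 2) * exp (-(π ^ 2 / (2 * t)) * ‖x‖ ^ 2) := by
    rw [← exp_add]; congr 1; field_simp; ring
  set s := Real.sqrt t with hs
  have hs0 : 0 < s := Real.sqrt_pos.2 ht
  have hst : t = s ^ 2 := (Real.sq_sqrt ht.le).symm
  have h2 : t ^ (m / 2 : ℝ) = s ^ m := by
    rw [hst, ← rpow_natCast, ← rpow_natCast, ← rpow_mul hs0.le]; congr 1; push_cast; ring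
  have h3 : ‖x‖ ^ m * exp (-(π ^ 2 / (2 * t)) * ‖x‖ ^ 2) ≤ s ^ m := by
    set y := ‖x‖ / s with hy
    have hx : ‖x‖ = y * s := by rw [hy]; field_simp
    have hy0 : 0 ≤ y := by positivity
    have h4 : π ^ 2 / (2 * t) * ‖x‖ ^ 2 = π ^ 2 / 2 * y ^ 2 := by
      rw [hx, hst]; field_simp
    have h5 : y ^ m ≤ exp (π ^ 2 / 2 * y ^ 2) := by
      have h6 : y ^ m ≤ 1 + π ^ 2 / 2 * y ^ 2 := by
        have hpi := Real.pi_gt_three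
        have : y ^ 2 * 4 ≤ π ^ 2 / 2 * y ^ 2 := by
          rw [mul_comm]; gcongr; nlinarith
        interval_cases m <;> nlinarith [sq_nonneg (y - 1)]
      linarith [add_one_le_exp (π ^ 2 / 2 * y ^ 2)]
    rw [neg_mul, h4, exp_neg, hx, mul_pow, mul_right_comm]
    have : y ^ m * (exp (π ^ 2 / 2 * y ^ 2))⁻¹ ≤ 1 := by
      rw [← div_eq_mul_inv]; exact div_le_one_of_le₀ h5 (exp_pos _).le
    exact mul_le_of_le_one_left (by positivity) this
  calc ‖x‖ ^ m * ((π / t) ^ (finrank ℝ E / 2 : ℝ) * exp (-(π ^ 2 / t) * ‖x‖ ^ 2))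
      = (‖x‖ ^ m * exp (-(π ^ 2 / (2 * t)) * ‖x‖ ^ 2)) * ((π / t) ^ (finrank ℝ E / 2 : ℝ) *
        exp (-(π ^ 2 / (2 * t)) * ‖x‖ ^ 2)) := by rw [h1]; ring
    _ ≤ _ := by rw [h2]; gcongr

theorem hasLineDerivAt_heat (t : ℝ) (x e : E) :
    HasLineDerivAt ℝ (heat t) (-(2 * π ^ 2 / t) * inner ℝ x e * heat t x) x e := by
  unfold HasLineDerivAt heat
  have h1 : HasDerivAt (fun τ : ℝ => ‖x + τ • e‖ ^ 2) (2 * inner ℝ x e) 0 := by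
    have : HasDerivAt (fun τ : ℝ => x + τ • e) e 0 := by
      simpa using ((hasDerivAt_id (0 : ℝ)).smul_const e).const_add x
    simpa using this.norm_sq
  convert! (((h1.const_mul (-(π ^ 2 / t))).exp).const_mul ((π / t) ^ (finrank ℝ E / 2 : ℝ))) using 1
  simp; ring

variable [FiniteDimensional ℝ E] [MeasurableSpace E] [BorelSpace E]

theorem integral_heat {t : ℝ} (ht : 0 < t) : ∫ x : E, heat t x = 1 := by
  unfold heat
  rw [integral_const_mul, GaussianFourier.integral_rexp_neg_mul_sq_norm (by positivity),
    ← mul_rpow (by positivity) (by positivity)]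
  have : π / t * (π / (π ^ 2 / t)) = 1 := by field_simp
  rw [this, one_rpow]

theorem integrable_heat {t : ℝ} (ht : 0 < t) : Integrable fun x : E => heat t x :=
  Integrable.of_integral_ne_zero (by rw [integral_heat ht]; exact one_ne_zero)

theorem fourier_heat {t : ℝ} (ht : 0 < t) (ξ : E) :
    𝓕 (fun x : E => (heat t x : ℂ)) ξ = (exp (-(t * ‖ξ‖ ^ 2)) : ℝ) := by
  have hb : 0 < ((π ^ 2 / t : ℝ) : ℂ).re := by rw [Complex.ofReal_re]; positivity
  have h1 : (fun x : E => (heat t x : ℂ)) = ((((π / t) ^ (finrank ℝ E / 2 : ℝ) : ℝ) : ℂ)) •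
      fun v : E => Complex.exp (-((π ^ 2 / t : ℝ) : ℂ) * ‖v‖ ^ 2) := by
    ext x; simp [heat]
  have h2 : 𝓕 (((((π / t) ^ (finrank ℝ E / 2 : ℝ) : ℝ) : ℂ)) •
      fun v : E => Complex.exp (-((π ^ 2 / t : ℝ) : ℂ) * ‖v‖ ^ 2)) ξ =
      (((π / t) ^ (finrank ℝ E / 2 : ℝ) : ℝ) : ℂ) *
        𝓕 (fun v : E => Complex.exp (-((π ^ 2 / t : ℝ) : ℂ) * ‖v‖ ^ 2)) ξ := by
    simp only [Real.fourier_eq, Pi.smul_apply, smul_eq_mul, ← integral_const_mul]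
    congr 1; ext v; simp only [Circle.smul_def, smul_eq_mul]; ring
  rw [h1, h2, fourier_gaussian_innerProductSpace hb]
  have h3 : ((π : ℂ) / ((π ^ 2 / t : ℝ) : ℂ)) ^ (finrank ℝ E / 2 : ℂ) =
      (((π / (π ^ 2 / t)) ^ (finrank ℝ E / 2 : ℝ) : ℝ) : ℂ) := by
    rw [Complex.ofReal_cpow (by positivity)]; push_cast; rfl
  rw [h3, ← mul_assoc, ← Complex.ofReal_mul, ← mul_rpow (by positivity) (by positivity)]
  have : π / t * (π / (π ^ 2 / t)) = 1 := by field_simp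
  rw [this, one_rpow, Complex.ofReal_exp]
  push_cast
  rw [one_mul]
  congr 1
  have : (π : ℂ) ≠ 0 := by exact_mod_cast pi_ne_zero
  have : (t : ℂ) ≠ 0 := by exact_mod_cast ht.ne'
  field_simp

theorem aestronglyMeasurable_of_continuousOn_Ioi {f : ℝ × E → ℂ}
    (hf : ContinuousOn f (Ioi 0 ×ˢ univ)) :
    AEStronglyMeasurable f ((volume.restrict (Ioi (0 : ℝ))).prod (volume : Measure E)) := by
  have h : (volume.restrict (Ioi (0 : ℝ))).prod (volume : Measure E) =
      (volume.prod volume).restrict (Ioi 0 ×ˢ univ) := by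
    rw [← Measure.prod_restrict, Measure.restrict_univ]
  rw [h]
  exact hf.aestronglyMeasurable (measurableSet_Ioi.prod MeasurableSet.univ)

theorem integrable_mul_heat {A : ℝ → ℝ} (hA : IntegrableOn A (Ioi 0))
    (hc : ContinuousOn A (Ioi 0)) {c : ℝ} (h0 : 0 < c) :
    Integrable (fun z : ℝ × E => (A z.1 * heat (c * z.1) z.2 : ℂ))
      ((volume.restrict (Ioi 0)).prod volume) := by
  have hmeas : AEStronglyMeasurable (fun z : ℝ × E => (A z.1 * heat (c * z.1) z.2 : ℂ))
      ((volume.restrict (Ioi 0)).prod volume) := by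
    refine aestronglyMeasurable_of_continuousOn_Ioi (ContinuousOn.mul ?_ ?_)
    · exact Complex.continuous_ofReal.comp_continuousOn
        (hc.comp continuousOn_fst fun z hz => (mem_prod.1 hz).1)
    · refine Complex.continuous_ofReal.comp_continuousOn
        (continuousOn_heat.comp (g := fun z : ℝ × E => heat z.1 z.2)
          (f := fun z : ℝ × E => (c * z.1, z.2)) (by fun_prop) fun z hz => ?_)
      exact ⟨mul_pos h0 (mem_prod.1 hz).1, trivial⟩
  rw [integrable_prod_iff hmeas]
  constructor
  · filter_upwards [ae_restrict_mem measurableSet_Ioi] with t ht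
    exact ((integrable_heat (mul_pos h0 ht)).ofReal.const_mul _)
  · refine hA.norm.congr ?_
    filter_upwards [ae_restrict_mem measurableSet_Ioi] with t (ht : 0 < t)
    have : ∀ y : E, ‖(A t * heat (c * t) y : ℂ)‖ = ‖A t‖ * heat (c * t) y := fun y => by
      rw [norm_mul, Complex.norm_real, Complex.norm_real,
        Real.norm_of_nonneg (heat_pos (mul_pos h0 ht) y).le]
    simp only [this, integral_const_mul, integral_heat (mul_pos h0 ht), mul_one]

end Heat

/-! ### Bessel kernels by subordination to the heat kernel -/

section Bessel

open FourierTransform Filter Module Real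

variable {E : Type*} [NormedAddCommGroup E] [InnerProductSpace ℝ E]

/-- The Bessel kernel of order `2 * a`, up to normalization. -/
noncomputable def bessel (a : ℝ) (x : E) : ℂ :=
  ∫ t in Ioi (0 : ℝ), ((t ^ (a - 1) * exp (-t) * heat t x : ℝ) : ℂ)

/-- The derivative of `bessel a` in direction `e`. -/
noncomputable def besselDeriv (a : ℝ) (e x : E) : ℂ :=
  ∫ t in Ioi (0 : ℝ), ((t ^ (a - 1) * exp (-t) * (-(2 * π ^ 2 / t) * inner ℝ x e * heat t x) : ℝ) : ℂ)

theorem heat_le_heat_two_mul {t : ℝ} (ht : 0 < t) (x : E) :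
    heat t x ≤ 2 ^ (finrank ℝ E / 2 : ℝ) * heat (2 * t) x := by
  simpa using norm_pow_mul_heat_le ht x (m := 0) (by norm_num)

theorem abs_heatDeriv_le {t : ℝ} (ht : 0 < t) (x e : E) :
    |-(2 * π ^ 2 / t) * inner ℝ x e * heat t x| ≤ 2 * π ^ 2 * ‖e‖ / t * (‖x‖ * heat t x) := by
  rw [abs_mul, abs_mul, abs_neg, abs_of_pos (heat_pos ht x), abs_of_pos (by positivity)]
  have := abs_real_inner_le_norm x e
  have := (heat_pos ht x).le
  calc 2 * π ^ 2 / t * |inner ℝ x e| * heat t x ≤ 2 * π ^ 2 / t * (‖x‖ * ‖e‖) * heat t x := by gcongr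
    _ = _ := by ring

theorem heat_eq_mul_exp {t : ℝ} (ht : 0 < t) (x : E) :
    heat t x = π ^ (finrank ℝ E / 2 : ℝ) * (t ^ (-(finrank ℝ E / 2 : ℝ)) *
      exp (-(π ^ 2 * ‖x‖ ^ 2 / t))) := by
  rw [heat, div_rpow pi_pos.le ht.le, rpow_neg ht.le, div_eq_mul_inv, ← mul_assoc]
  congr 2; ring

theorem heat_le {t : ℝ} (ht : 0 < t) (x : E) :
    heat t x ≤ π ^ (finrank ℝ E / 2 : ℝ) * t ^ (-(finrank ℝ E / 2 : ℝ)) := by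
  rw [heat_eq_mul_exp ht]
  gcongr
  refine mul_le_of_le_one_right (by positivity) (exp_le_one_iff.2 ?_)
  rw [neg_nonpos]; positivity

theorem rpow_mul_heat {t : ℝ} (ht : 0 < t) (b : ℝ) (x : E) :
    t ^ (b - 1) * heat t x = π ^ (finrank ℝ E / 2 : ℝ) * (t ^ (-(finrank ℝ E / 2 - b) - 1 : ℝ) *
      exp (-(π ^ 2 * ‖x‖ ^ 2 / t))) := by
  rw [heat_eq_mul_exp ht, mul_left_comm, ← mul_assoc (t ^ (b - 1)), ← rpow_add ht]
  congr 3; ring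

theorem integrableOn_rpow_mul_heat {b : ℝ} (hb : b < finrank ℝ E / 2) {x : E} (hx : x ≠ 0) :
    IntegrableOn (fun t => t ^ (b - 1) * heat t x) (Ioi 0) := by
  have h := (integrableOn_rpow_mul_exp_neg_div (a := finrank ℝ E / 2 - b) (A := π ^ 2 * ‖x‖ ^ 2)
    (by linarith) (by positivity)).const_mul (π ^ (finrank ℝ E / 2 : ℝ))
  exact IntegrableOn.congr_fun h (fun t ht => (rpow_mul_heat ht b x).symm) measurableSet_Ioi

/-- The constant relating Riesz kernels to heat kernels. -/
noncomputable def heatConst (E : Type*) [NormedAddCommGroup E] [InnerProductSpace ℝ E] (b : ℝ) : ℝ :=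
  π ^ (finrank ℝ E / 2 : ℝ) * ((π ^ 2) ^ (-(finrank ℝ E / 2 - b)) * Gamma (finrank ℝ E / 2 - b))

theorem heatConst_pos {b : ℝ} (hb : b < finrank ℝ E / 2) : 0 < heatConst E b := by
  have := Real.Gamma_pos_of_pos (s := finrank ℝ E / 2 - b) (by linarith)
  unfold heatConst; positivity

theorem integral_rpow_mul_heat {b : ℝ} (hb : b < finrank ℝ E / 2) {x : E} (hx : x ≠ 0) :
    ∫ t in Ioi (0 : ℝ), t ^ (b - 1) * heat t x = heatConst E b * ‖x‖ ^ (2 * b - finrank ℝ E) := by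
  rw [setIntegral_congr_fun measurableSet_Ioi (fun t ht => rpow_mul_heat ht b x),
    integral_const_mul, integral_rpow_mul_exp_neg_div (by linarith) (by positivity),
    mul_rpow (by positivity) (by positivity), ← rpow_natCast (‖x‖), ← rpow_mul (norm_nonneg x),
    heatConst]
  have : ((2 : ℕ) : ℝ) * -(finrank ℝ E / 2 - b) = 2 * b - finrank ℝ E := by push_cast; ring
  rw [this]; ring

/-- Dropping `exp (-t)` leaves `‖x‖` times a heat superposition with weight `t^(a-2)`, which is a
Riesz kernel of order `2 (a - 1)`. For `a = (1 + s)/2` the resulting power is `s - d`. -/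
theorem norm_besselDeriv_le {a : ℝ} (ha : a < finrank ℝ E / 2 + 1) (e : E) {x : E} (hx : x ≠ 0) :
    ‖besselDeriv a e x‖ ≤ 2 * π ^ 2 * ‖e‖ * heatConst E (a - 1) *
      ‖x‖ ^ (2 * a - 1 - finrank ℝ E) := by
  have h1 := ((integrableOn_rpow_mul_heat (b := a - 1) (by linarith) hx).const_mul
    (2 * π ^ 2 * ‖e‖ * ‖x‖))
  have h2 := norm_integral_le_of_norm_le (μ := volume.restrict (Ioi (0 : ℝ)))
    (f := fun t => ((t ^ (a - 1) * exp (-t) * (-(2 * π ^ 2 / t) * inner ℝ x e * heat t x) : ℝ) : ℂ))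
    h1 ?_
  · refine h2.trans_eq ?_
    rw [integral_const_mul, integral_rpow_mul_heat (by linarith) hx]
    have h3 : ‖x‖ ^ (2 * a - 1 - finrank ℝ E) = ‖x‖ ^ (2 * (a - 1) - finrank ℝ E) * ‖x‖ := by
      rw [← rpow_add_one (norm_pos_iff.2 hx).ne']; congr 1; ring
    rw [h3]; ring
  · filter_upwards [ae_restrict_mem measurableSet_Ioi] with t (ht : 0 < t)
    rw [Complex.norm_real, norm_mul, norm_mul, norm_of_nonneg (exp_pos _).le,
      norm_of_nonneg (rpow_nonneg ht.le _)]
    have h4 := abs_heatDeriv_le ht x e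
    have h5 : exp (-t) ≤ 1 := exp_le_one_iff.2 (by linarith)
    have h6 := (heat_pos ht x).le
    calc t ^ (a - 1) * exp (-t) * ‖-(2 * π ^ 2 / t) * inner ℝ x e * heat t x‖
        ≤ t ^ (a - 1) * 1 * (2 * π ^ 2 * ‖e‖ / t * (‖x‖ * heat t x)) := by
          rw [norm_eq_abs]; gcongr
      _ = 2 * π ^ 2 * ‖e‖ * ‖x‖ * (t ^ (a - 1) * t⁻¹ * heat t x) := by ring
      _ = _ := by rw [← rpow_neg_one t, ← rpow_add ht]; ring_nf

theorem integrableOn_rpow_mul_exp_neg {a : ℝ} (ha : 0 < a) :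
    IntegrableOn (fun t : ℝ => t ^ (a - 1) * exp (-t)) (Ioi 0) := by
  simpa [neg_mul] using integrableOn_rpow_mul_exp_neg_mul_rpow (s := a - 1) (p := 1)
      (b := 1) (by linarith) one_pos one_pos

theorem continuousOn_rpow_mul_exp_neg (a : ℝ) :
    ContinuousOn (fun t : ℝ => t ^ (a - 1) * exp (-t)) (Ioi 0) :=
  (continuousOn_id.rpow_const fun t ht => Or.inl (ne_of_gt ht)).mul (by fun_prop)

variable [FiniteDimensional ℝ E] [MeasurableSpace E] [BorelSpace E]

theorem integrable_bessel_uncurry {a : ℝ} (ha : 0 < a) :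
    Integrable (Function.uncurry fun (t : ℝ) (x : E) =>
      ((t ^ (a - 1) * exp (-t) * heat t x : ℝ) : ℂ)) ((volume.restrict (Ioi 0)).prod volume) := by
  have := integrable_mul_heat (E := E) (integrableOn_rpow_mul_exp_neg ha)
    (continuousOn_rpow_mul_exp_neg a) one_pos
  simpa [Function.uncurry_def] using this

theorem integrable_bessel {a : ℝ} (ha : 0 < a) : Integrable (bessel a : E → ℂ) :=
  (integrable_bessel_uncurry ha).swap.integral_prod_left

/-- The heat kernel transforms to `exp (-t ‖ξ‖²)`, which leaves a Gamma integral in `t`. -/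
theorem fourier_bessel {a : ℝ} (ha : 0 < a) (ξ : E) :
    𝓕 (bessel a : E → ℂ) ξ = ((Gamma a * (1 + ‖ξ‖ ^ 2) ^ (-a) : ℝ) : ℂ) := by
  have h0 := fourier_integral_right (integrable_bessel_uncurry ha) ξ
  have h1 : ∀ t ∈ Ioi (0 : ℝ), 𝓕 (fun x : E => ((t ^ (a - 1) * exp (-t) * heat t x : ℝ) : ℂ)) ξ =
      ((t ^ (a - 1) * exp (-((1 + ‖ξ‖ ^ 2) * t)) : ℝ) : ℂ) := fun t ht => by
    have h2 : 𝓕 (fun x : E => ((t ^ (a - 1) * exp (-t) * heat t x : ℝ) : ℂ)) ξ =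
        ((t ^ (a - 1) * exp (-t) : ℝ) : ℂ) * 𝓕 (fun x : E => (heat t x : ℂ)) ξ := by
      simp only [Real.fourier_eq, ← integral_const_mul]
      congr 1; ext v; simp only [Circle.smul_def, smul_eq_mul, Complex.ofReal_mul]; ring
    rw [h2, fourier_heat ht, ← Complex.ofReal_mul, mul_assoc, ← exp_add]
    congr 3; ring_nf
  change 𝓕 (fun x : E => ∫ t in Ioi (0 : ℝ), ((t ^ (a - 1) * exp (-t) * heat t x : ℝ) : ℂ)) ξ = _
  rw [h0, setIntegral_congr_fun measurableSet_Ioi h1, integral_complex_ofReal,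
    integral_rpow_mul_exp_neg_mul_Ioi ha (by positivity), one_div, inv_rpow (by positivity),
    rpow_neg (by positivity), mul_comm]

omit [FiniteDimensional ℝ E] [MeasurableSpace E] [BorelSpace E] in
theorem continuousOn_heatDeriv (e : E) :
    ContinuousOn (fun z : ℝ × E => -(2 * π ^ 2 / z.1) * inner ℝ z.2 e * heat z.1 z.2)
      (Ioi 0 ×ˢ univ) := by
  refine ContinuousOn.mul (ContinuousOn.mul ?_ (by fun_prop)) continuousOn_heat
  exact (continuousOn_const.div continuousOn_fst fun z hz => (mem_prod.1 hz).1.ne').neg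

/-- A derivative of the heat kernel has `L¹` norm of order `t^(-1/2)`, so the weight becomes `t^(a -
3/2) exp (-t)`, integrable at zero because `a > 1/2`. -/
theorem integrable_besselDeriv_uncurry {a : ℝ} (ha : 1 / 2 < a) (e : E) :
    Integrable (Function.uncurry fun (t : ℝ) (x : E) =>
      ((t ^ (a - 1) * exp (-t) * (-(2 * π ^ 2 / t) * inner ℝ x e * heat t x) : ℝ) : ℂ))
      ((volume.restrict (Ioi 0)).prod volume) := by
  have h1 := (integrable_mul_heat (E := E) (integrableOn_rpow_mul_exp_neg (a := a - 1 / 2)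
    (by linarith)) (continuousOn_rpow_mul_exp_neg (a - 1 / 2)) two_pos).const_mul
    ((2 * π ^ 2 * ‖e‖ * 2 ^ (finrank ℝ E / 2 : ℝ) : ℝ) : ℂ)
  refine h1.mono (aestronglyMeasurable_of_continuousOn_Ioi ?_) ?_
  · refine Complex.continuous_ofReal.comp_continuousOn
      (ContinuousOn.mul ?_ (continuousOn_heatDeriv e))
    exact (continuousOn_rpow_mul_exp_neg a).comp continuousOn_fst fun z hz => (mem_prod.1 hz).1
  · have : ∀ᵐ z : ℝ × E ∂((volume.restrict (Ioi 0)).prod volume), 0 < z.1 :=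
      Measure.quasiMeasurePreserving_fst.ae (ae_restrict_mem measurableSet_Ioi)
    filter_upwards [this] with ⟨t, x⟩ (ht : 0 < t)
    simp only [Function.uncurry]
    have h4 := abs_heatDeriv_le ht x e
    have h5 := norm_pow_mul_heat_le ht x (m := 1) (by norm_num)
    have h6 := heat_pos (mul_pos two_pos ht) x
    rw [pow_one] at h5
    rw [← Complex.ofReal_mul, ← Complex.ofReal_mul, Complex.norm_real, Complex.norm_real,
      norm_eq_abs, norm_eq_abs, abs_mul (t ^ (a - 1) * exp (-t)),
      abs_of_nonneg (show 0 ≤ t ^ (a - 1) * exp (-t) by positivity)]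
    refine le_trans ?_ (le_abs_self _)
    calc t ^ (a - 1) * exp (-t) * |-(2 * π ^ 2 / t) * inner ℝ x e * heat t x|
        ≤ t ^ (a - 1) * exp (-t) * (2 * π ^ 2 * ‖e‖ / t *
          (t ^ ((1 : ℕ) / 2 : ℝ) * (2 ^ (finrank ℝ E / 2 : ℝ) * heat (2 * t) x))) := by
          gcongr; exact h4.trans (by gcongr)
      _ = (t ^ (a - 1) * t⁻¹ * t ^ ((1 : ℕ) / 2 : ℝ)) * (2 * π ^ 2 * ‖e‖ * exp (-t) *
          (2 ^ (finrank ℝ E / 2 : ℝ) * heat (2 * t) x)) := by ring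
      _ = _ := by
        rw [← rpow_neg_one t, ← rpow_add ht, ← rpow_add ht]
        have : a - 1 + -1 + ((1 : ℕ) / 2 : ℝ) = a - 1 / 2 - 1 := by push_cast; ring
        rw [this]; ring

theorem integrable_besselDeriv {a : ℝ} (ha : 1 / 2 < a) (e : E) : Integrable (besselDeriv a e) :=
  (integrable_besselDeriv_uncurry ha e).swap.integral_prod_left

theorem fourier_besselDeriv (hn : 2 ≤ finrank ℝ E) {a : ℝ} (ha : 1 / 2 < a) (e ξ : E) :
    𝓕 (besselDeriv a e) ξ = 2 * π * Complex.I * inner ℝ e ξ * 𝓕 (bessel a : E → ℂ) ξ := by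
  refine fourier_integral_hasLineDerivAt hn (integrable_bessel_uncurry (by linarith))
    (integrable_besselDeriv_uncurry ha e) (Eventually.of_forall fun t x _ => ?_) ξ
  exact ((hasLineDerivAt_heat t x e).const_mul (t ^ (a - 1) * exp (-t))).ofReal_comp

end Bessel

/-! ### Comparing the truncated Riesz kernel with the Bessel kernel -/

section HeatCutoff

open FourierTransform Filter Module Real

/-- Here `y` stands for `‖x‖`, `h` for the heat kernel, `D` for its directional derivative, `η` and
`η'` for a cutoff and its derivative at the point, `H` and `Q` for two majorants of `h`. For `t ≤
1`, `|η - exp (-t)| ≤ K y + t` compensates the `1/t` in the bound for `D`. For `t > 1` and `y ≤ R`,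
`Q` takes over. For `t > 1` and `y > R` only `exp (-t)` is left of the difference. The factor `3`
comes from `3 exp (-t) ≥ 1` on `t ≤ 1`. -/
theorem abs_cutoff_mul_le {t y h H Q η η' K L R D : ℝ} (ht : 0 < t) (hy : 0 ≤ y) (h0 : 0 ≤ h)
    (h1 : h ≤ H) (h2 : y * h ≤ √t * H) (h3 : y ^ 2 * h ≤ t * H) (hQ : h ≤ Q) (hK : 0 ≤ K)
    (hL : 0 ≤ L) (hR : 0 ≤ R) (hη : |η| ≤ 1) (hη1 : |η - 1| ≤ K * y) (hη' : |η'| ≤ K)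
    (hz : R < y → η = 0 ∧ η' = 0) (hD : |D| ≤ L / t * (y * h)) :
    |(η - exp (-t)) * h| ≤ 3 * (2 + K + K * L + L + L * R) *
        (exp (-t) * H + if 1 < t ∧ y ≤ R then Q else 0) ∧
    |η' * h + (η - exp (-t)) * D| ≤ 3 * (2 + K + K * L + L + L * R) *
        (exp (-t) * H + if 1 < t ∧ y ≤ R then Q else 0) := by
  have hH : 0 ≤ H := h0.trans h1
  have hQ0 : 0 ≤ Q := h0.trans hQ
  have hKL := mul_nonneg hK hL
  have hLR := mul_nonneg hL hR
  have he0 := exp_pos (-t)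
  have he1 : exp (-t) ≤ 1 := exp_le_one_iff.2 (by linarith)
  have het : 1 - exp (-t) ≤ t := by linarith [add_one_le_exp (-t)]
  set C := 2 + K + K * L + L + L * R with hC
  have habs : |η - exp (-t)| ≤ 2 := by rw [abs_le] at hη ⊢; constructor <;> linarith [hη.1, hη.2]
  have hstep : |η' * h + (η - exp (-t)) * D| ≤ |η'| * h + |η - exp (-t)| * (L / t * (y * h)) := by
    refine (abs_add_le _ _).trans ?_
    rw [abs_mul, abs_mul, abs_of_nonneg h0]
    gcongr
  have hdiff : |(η - exp (-t)) * h| = |η - exp (-t)| * h := by rw [abs_mul, abs_of_nonneg h0]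
  rcases le_or_gt t 1 with h1t | h1t
  · rw [if_neg (by rintro ⟨h, -⟩; linarith), add_zero]
    have he3 : 1 ≤ 3 * exp (-t) := by
      have : exp (-1) ≤ exp (-t) := exp_le_exp.2 (by linarith)
      have h5 : exp 1 * exp (-1) = 1 := by rw [← exp_add]; simp
      have := exp_one_lt_d9
      nlinarith [exp_pos (-1)]
    have hst : √t ≤ 1 := sqrt_le_one.2 h1t
    have hfin : C * H ≤ 3 * C * (exp (-t) * H) := by
      have : C * H * 1 ≤ C * H * (3 * exp (-t)) := by gcongr
      linarith
    refine ⟨?_, ?_⟩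
    · rw [hdiff]
      refine le_trans ?_ hfin
      calc |η - exp (-t)| * h ≤ 2 * H := by gcongr
        _ ≤ C * H := by gcongr; linarith
    · refine hstep.trans (le_trans ?_ hfin)
      have hb : |η - exp (-t)| ≤ K * y + t := by
        calc |η - exp (-t)| = |(η - 1) + (1 - exp (-t))| := by ring_nf
          _ ≤ |η - 1| + |1 - exp (-t)| := abs_add_le _ _
          _ ≤ K * y + t := by rw [abs_of_nonneg (by linarith : 0 ≤ 1 - exp (-t))]; linarith
      calc |η'| * h + |η - exp (-t)| * (L / t * (y * h))
          ≤ K * H + (K * y + t) * (L / t * (y * h)) := by gcongr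
        _ = K * H + K * L * (y ^ 2 * h) / t + L * (y * h) := by field_simp; ring
        _ ≤ K * H + K * L * (t * H) / t + L * (1 * H) := by
            have : y * h ≤ 1 * H := h2.trans (by gcongr)
            gcongr K * H + ?_ + L * ?_
            gcongr
        _ = (K + K * L + L) * H := by field_simp
        _ ≤ C * H := by gcongr; linarith
  · have ht2 : √t / t ≤ 1 := by
      rw [div_le_one ht, sqrt_le_left ht.le]; nlinarith
    have hyt : L / t * (y * h) ≤ L * H := by
      calc L / t * (y * h) ≤ L / t * (√t * H) := by gcongr
        _ = L * H * (√t / t) := by ring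
        _ ≤ L * H * 1 := by gcongr
        _ = L * H := by ring
    have heH : 0 ≤ exp (-t) * H := by positivity
    rcases le_or_gt y R with hyR | hyR
    · rw [if_pos ⟨h1t, hyR⟩]
      have hb : |η - exp (-t)| ≤ 1 + exp (-t) := by
        refine (abs_sub _ _).trans ?_
        rw [abs_of_pos he0]; linarith
      refine ⟨?_, hstep.trans ?_⟩
      · rw [hdiff]
        calc |η - exp (-t)| * h ≤ (1 + exp (-t)) * h := by gcongr
          _ = h + exp (-t) * h := by ring
          _ ≤ Q + exp (-t) * H := by gcongr
          _ = 1 * (exp (-t) * H + Q) := by ring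
          _ ≤ 3 * C * (exp (-t) * H + Q) := by gcongr; linarith
      · have hyt2 : L / t * (y * h) ≤ L * R * Q := by
          calc L / t * (y * h) ≤ L / 1 * (R * Q) := by gcongr
            _ = _ := by ring
        calc |η'| * h + |η - exp (-t)| * (L / t * (y * h))
            ≤ K * Q + (1 + exp (-t)) * (L / t * (y * h)) := by gcongr
          _ = K * Q + L / t * (y * h) + exp (-t) * (L / t * (y * h)) := by ring
          _ ≤ K * Q + L * R * Q + exp (-t) * (L * H) := by gcongr
          _ = L * (exp (-t) * H) + (K + L * R) * Q := by ring
          _ ≤ (3 * C) * (exp (-t) * H) + (3 * C) * Q := by gcongr <;> linarith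
          _ = _ := by ring
    · obtain ⟨rfl, rfl⟩ := hz hyR
      rw [if_neg (by rintro ⟨-, h⟩; linarith), add_zero]
      have hb : |0 - exp (-t)| = exp (-t) := by rw [zero_sub, abs_neg, abs_of_pos he0]
      refine ⟨?_, hstep.trans ?_⟩
      · rw [hdiff, hb]
        calc exp (-t) * h ≤ 1 * (exp (-t) * H) := by rw [one_mul]; gcongr
          _ ≤ 3 * C * (exp (-t) * H) := by gcongr; linarith
      · rw [hb, abs_zero, zero_mul, zero_add]
        calc exp (-t) * (L / t * (y * h)) ≤ exp (-t) * (L * H) := by gcongr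
          _ = L * (exp (-t) * H) := by ring
          _ ≤ 3 * C * (exp (-t) * H) := by gcongr; linarith

variable {E : Type*} [NormedAddCommGroup E] [InnerProductSpace ℝ E] [FiniteDimensional ℝ E]
  [MeasurableSpace E] [BorelSpace E]

theorem integrable_heatMajorant {β : ℝ} (hβ0 : 0 < β) (hβ : β < finrank ℝ E / 2) (C R : ℝ) :
    Integrable (fun z : ℝ × E => z.1 ^ (β - 1) * (C * (exp (-z.1) *
      (2 ^ (finrank ℝ E / 2 : ℝ) * heat (2 * z.1) z.2) + if 1 < z.1 ∧ ‖z.2‖ ≤ R then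
      π ^ (finrank ℝ E / 2 : ℝ) * z.1 ^ (-(finrank ℝ E / 2 : ℝ)) else 0)))
      ((volume.restrict (Ioi 0)).prod volume) := by
  have h1 := (integrable_mul_heat (E := E) (integrableOn_rpow_mul_exp_neg hβ0)
    (continuousOn_rpow_mul_exp_neg β) two_pos).re.const_mul (C * 2 ^ (finrank ℝ E / 2 : ℝ))
  have h2 : Integrable ((Ioi (1 : ℝ)).indicator fun t : ℝ => t ^ (β - 1 - finrank ℝ E / 2))
      (volume.restrict (Ioi 0)) := by
    rw [integrable_indicator_iff measurableSet_Ioi]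
    exact (integrableOn_Ioi_rpow_of_lt (by linarith) one_pos).mono_measure Measure.restrict_le_self
  have h3 : Integrable ((Metric.closedBall (0 : E) R).indicator fun _ => (1 : ℝ)) :=
    (integrable_indicator_iff Metric.isClosed_closedBall.measurableSet).2
      (integrableOn_const measure_closedBall_lt_top.ne)
  have h4 := (h2.mul_prod h3).const_mul (C * π ^ (finrank ℝ E / 2 : ℝ))
  refine (h1.add h4).congr ?_
  have : ∀ᵐ z : ℝ × E ∂((volume.restrict (Ioi 0)).prod volume), 0 < z.1 :=
    Measure.quasiMeasurePreserving_fst.ae (ae_restrict_mem measurableSet_Ioi)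
  filter_upwards [this] with ⟨t, x⟩ (ht : 0 < t)
  have h5 : t ^ (β - 1 - finrank ℝ E / 2) = t ^ (β - 1) * t ^ (-(finrank ℝ E / 2 : ℝ)) := by
    rw [← rpow_add ht]; congr 1
  simp only [Pi.add_apply, indicator, mem_Ioi, Metric.mem_closedBall, dist_zero_right, h5,
    ← Complex.ofReal_mul, RCLike.re_to_complex, Complex.ofReal_re]
  by_cases h6 : 1 < t <;> by_cases h7 : ‖x‖ ≤ R <;> simp [h6, h7] <;> ring

/-- The Riesz and Bessel kernels are heat superpositions with weights `t^(β-1)` and `t^(β-1) exp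
(-t)`, so `S` has weight `t^(β-1) (η - exp (-t))`. For `β ≤ 1/2` a Riesz kernel of order `2 β` has
no integrable gradient at the origin. In `S` the singularities cancel because `η 0 = 1`, and for
large `t` the compact support of `η` takes over. -/
theorem exists_heatCutoff (hn : 2 ≤ finrank ℝ E) {β : ℝ} (hβ0 : 0 < β) (hβ : β < finrank ℝ E / 2)
    {η : E → ℝ} (hη : ContDiff ℝ ∞ η) (hc : HasCompactSupport η) (hη1 : ∀ x, |η x| ≤ 1)
    (hη0 : η 0 = 1) :
    ∃ S : E → ℂ, Integrable S ∧
      (∀ e, ∃ D : E → ℂ, Integrable D ∧ ∀ ξ, 𝓕 D ξ = 2 * π * Complex.I * inner ℝ e ξ * 𝓕 S ξ) ∧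
      ∀ x, x ≠ 0 → ((heatConst E β * (η x * ‖x‖ ^ (2 * β - finrank ℝ E)) : ℝ) : ℂ) =
        S x + bessel β x := by
  obtain ⟨K, hK⟩ := ContDiff.lipschitzWith_of_hasCompactSupport hc hη (by simp)
  obtain ⟨R, hR0, hR⟩ : ∃ R : ℝ, 0 ≤ R ∧ tsupport η ⊆ Metric.closedBall 0 R := by
    obtain ⟨R, hR⟩ := (hc.isCompact.isBounded).subset_closedBall 0
    exact ⟨max R 0, le_max_right _ _, hR.trans (Metric.closedBall_subset_closedBall (le_max_left _ _))⟩
  have hz : ∀ e x, R < ‖x‖ → η x = 0 ∧ fderiv ℝ η x e = 0 := fun e x hx => by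
    have h1 : x ∉ tsupport η := fun h => by simpa using (hR h).trans_lt hx
    refine ⟨image_eq_zero_of_notMem_tsupport h1, ?_⟩
    rw [image_eq_zero_of_notMem_tsupport fun h => h1 (tsupport_fderiv_subset ℝ h)]; rfl
  have hη2 : ∀ x, |η x - 1| ≤ K * ‖x‖ := fun x => by
    simpa [hη0, Real.dist_eq] using hK.dist_le_mul x 0
  have hη' : ∀ e x, |fderiv ℝ η x e| ≤ K * ‖e‖ := fun e x =>
    ((fderiv ℝ η x).le_opNorm e).trans (by gcongr; exact norm_fderiv_le_of_lipschitz ℝ hK)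
  let F : ℝ → E → ℂ := fun t x => ((t ^ (β - 1) * ((η x - exp (-t)) * heat t x) : ℝ) : ℂ)
  let F' : E → ℝ → E → ℂ := fun e t x => ((t ^ (β - 1) * (fderiv ℝ η x e * heat t x +
    (η x - exp (-t)) * (-(2 * π ^ 2 / t) * inner ℝ x e * heat t x)) : ℝ) : ℂ)
  have hdom : ∀ e : E, ∃ C : ℝ, ∀ᵐ z : ℝ × E ∂((volume.restrict (Ioi 0)).prod volume),
      ‖Function.uncurry F z‖ ≤ z.1 ^ (β - 1) * (C * (exp (-z.1) *
      (2 ^ (finrank ℝ E / 2 : ℝ) * heat (2 * z.1) z.2) + if 1 < z.1 ∧ ‖z.2‖ ≤ R then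
      π ^ (finrank ℝ E / 2 : ℝ) * z.1 ^ (-(finrank ℝ E / 2 : ℝ)) else 0)) ∧
      ‖Function.uncurry (F' e) z‖ ≤ z.1 ^ (β - 1) * (C * (exp (-z.1) *
      (2 ^ (finrank ℝ E / 2 : ℝ) * heat (2 * z.1) z.2) + if 1 < z.1 ∧ ‖z.2‖ ≤ R then
      π ^ (finrank ℝ E / 2 : ℝ) * z.1 ^ (-(finrank ℝ E / 2 : ℝ)) else 0)) := fun e => by
    set K' := K * (1 + ‖e‖) with hK'
    set L := 2 * π ^ 2 * ‖e‖ with hL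
    refine ⟨3 * (2 + K' + K' * L + L + L * R), ?_⟩
    · have : ∀ᵐ z : ℝ × E ∂((volume.restrict (Ioi 0)).prod volume), 0 < z.1 :=
        Measure.quasiMeasurePreserving_fst.ae (ae_restrict_mem measurableSet_Ioi)
      filter_upwards [this] with ⟨t, x⟩ (ht : 0 < t)
      have h1 := norm_pow_mul_heat_le ht x (m := 1) (by norm_num)
      have h2 := norm_pow_mul_heat_le ht x (m := 2) (by norm_num)
      have h3 : t ^ ((1 : ℕ) / 2 : ℝ) = √t := by rw [sqrt_eq_rpow]; norm_num
      have h4 : t ^ ((2 : ℕ) / 2 : ℝ) = t := by norm_num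
      rw [h3, pow_one] at h1
      rw [h4] at h2
      have key := abs_cutoff_mul_le (K := K') (η := η x) (η' := fderiv ℝ η x e)
        (L := L) ht (norm_nonneg x) (heat_pos ht x).le (heat_le_heat_two_mul ht x)
        h1 h2 (heat_le ht x) (by positivity) (by positivity) hR0 (hη1 x)
        ((hη2 x).trans (by rw [hK']; gcongr; exact le_mul_of_one_le_right K.2 (by simp)))
        ((hη' e x).trans (by rw [hK']; gcongr; simp)) (hz e x) (abs_heatDeriv_le ht x e)
      simp only [Function.uncurry, F, F', Complex.norm_real, norm_eq_abs,
        abs_mul (t ^ (β - 1)), abs_of_nonneg (rpow_nonneg ht.le (β - 1))]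
      exact ⟨mul_le_mul_of_nonneg_left key.1 (by positivity),
        mul_le_mul_of_nonneg_left key.2 (by positivity)⟩
  have hrp : ContinuousOn (fun z : ℝ × E => z.1 ^ (β - 1)) (Ioi 0 ×ˢ univ) :=
    continuousOn_fst.rpow_const fun z hz => Or.inl (mem_prod.1 hz).1.ne'
  have hsub : Continuous (fun z : ℝ × E => η z.2 - exp (-z.1)) := by
    have := hη.continuous
    fun_prop
  have hFi : Integrable (Function.uncurry F) ((volume.restrict (Ioi 0)).prod volume) := by
    obtain ⟨C, hC⟩ := hdom 0
    refine (integrable_heatMajorant hβ0 hβ C R).mono' (aestronglyMeasurable_of_continuousOn_Ioi ?_)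
      (hC.mono fun z h => h.1)
    exact Complex.continuous_ofReal.comp_continuousOn
      (hrp.mul (hsub.continuousOn.mul continuousOn_heat))
  have hF'i : ∀ e, Integrable (Function.uncurry (F' e)) ((volume.restrict (Ioi 0)).prod volume) := by
    intro e
    obtain ⟨C, hC⟩ := hdom e
    refine (integrable_heatMajorant hβ0 hβ C R).mono' (aestronglyMeasurable_of_continuousOn_Ioi ?_)
      (hC.mono fun z h => h.2)
    have h1 : Continuous fun z : ℝ × E => fderiv ℝ η z.2 e :=
      ((hη.continuous_fderiv (by simp)).clm_apply continuous_const).comp continuous_snd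
    exact Complex.continuous_ofReal.comp_continuousOn
      (hrp.mul ((h1.continuousOn.mul continuousOn_heat).add
        (hsub.continuousOn.mul (continuousOn_heatDeriv e))))
  refine ⟨fun x => ∫ t in Ioi (0 : ℝ), F t x, hFi.swap.integral_prod_left, fun e =>
    ⟨fun x => ∫ t in Ioi (0 : ℝ), F' e t x, (hF'i e).swap.integral_prod_left, fun ξ => ?_⟩,
    fun x hx => ?_⟩
  · refine fourier_integral_hasLineDerivAt hn hFi (hF'i e) (Eventually.of_forall fun t x _ => ?_) ξ
    have h1 : HasLineDerivAt ℝ η (fderiv ℝ η x e) x e :=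
      (hη.differentiable (by simp) x).hasFDerivAt.hasLineDerivAt e
    have h2 : HasDerivAt (fun τ : ℝ => (η (x + τ • e) - exp (-t)) * heat t (x + τ • e)) _ 0 :=
      (HasDerivAt.sub_const (exp (-t)) h1).mul (hasLineDerivAt_heat t x e)
    have h3 := (h2.const_mul (t ^ (β - 1))).ofReal_comp
    simpa [HasLineDerivAt, F, F'] using h3
  · have h1 : IntegrableOn (fun t => t ^ (β - 1) * heat t x) (Ioi 0) :=
      integrableOn_rpow_mul_heat hβ hx
    have h2 : IntegrableOn (fun t => t ^ (β - 1) * exp (-t) * heat t x) (Ioi 0) := by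
      refine (h1.mul_bdd (c := 1) (g := fun t => exp (-t)) (by fun_prop) ?_).congr ?_
      · filter_upwards [ae_restrict_mem measurableSet_Ioi] with t (ht : 0 < t)
        rw [norm_of_nonneg (exp_pos _).le]
        exact exp_le_one_iff.2 (by linarith)
      · exact Eventually.of_forall fun t => by ring
    have h3 := integral_rpow_mul_heat hβ hx
    simp only [F, bessel]
    rw [integral_complex_ofReal, integral_complex_ofReal, ← Complex.ofReal_add,
      mul_left_comm, ← h3, ← integral_const_mul]
    congr 1
    rw [← sub_eq_iff_eq_add, ← integral_sub (h1.const_mul _) h2]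
    congr 1
    ext t
    ring

end HeatCutoff

/-! ### The algebra of Fourier transforms of integrable functions -/

section FourierAlgebra

open FourierTransform Filter Module Real

variable {E : Type*} [NormedAddCommGroup E] [InnerProductSpace ℝ E] [FiniteDimensional ℝ E]
  [MeasurableSpace E] [BorelSpace E]

/-- The Fourier transforms of integrable functions. -/
def IsFourierOfIntegrable (F : E → ℂ) : Prop := ∃ h : E → ℂ, Integrable h ∧ 𝓕 h = F

theorem fourier_add_of_integrable {f g : E → ℂ} (hf : Integrable f) (hg : Integrable g) (ξ : E) :
    𝓕 (fun x => f x + g x) ξ = 𝓕 f ξ + 𝓕 g ξ := by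
  simp only [Real.fourier_eq, Circle.smul_def, smul_eq_mul, mul_add]
  exact integral_add (integrable_fourierChar_mul hf ξ) (integrable_fourierChar_mul hg ξ)

theorem fourier_const_mul (c : ℂ) (f : E → ℂ) (ξ : E) :
    𝓕 (fun x => c * f x) ξ = c * 𝓕 f ξ := by
  simp only [Real.fourier_eq, Circle.smul_def, smul_eq_mul, ← integral_const_mul]
  congr 1; ext v; ring

theorem IsFourierOfIntegrable.add {F G : E → ℂ} (hF : IsFourierOfIntegrable F)
    (hG : IsFourierOfIntegrable G) : IsFourierOfIntegrable fun ξ => F ξ + G ξ := by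
  obtain ⟨f, hf, rfl⟩ := hF
  obtain ⟨g, hg, rfl⟩ := hG
  exact ⟨_, hf.add hg, funext fun ξ => fourier_add_of_integrable hf hg ξ⟩

theorem IsFourierOfIntegrable.const_mul {F : E → ℂ} (hF : IsFourierOfIntegrable F) (c : ℂ) :
    IsFourierOfIntegrable fun ξ => c * F ξ := by
  obtain ⟨f, hf, rfl⟩ := hF
  exact ⟨_, hf.const_mul c, funext fun ξ => fourier_const_mul c f ξ⟩

theorem IsFourierOfIntegrable.mul {F G : E → ℂ} (hF : IsFourierOfIntegrable F)
    (hG : IsFourierOfIntegrable G) : IsFourierOfIntegrable fun ξ => F ξ * G ξ := by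
  obtain ⟨f, hf, rfl⟩ := hF
  obtain ⟨g, hg, rfl⟩ := hG
  exact ⟨_, hf.integrable_convolution (ContinuousLinearMap.mul ℂ ℂ) hg,
    funext fun ξ => Real.fourier_mul_convolution_eq hf hg ξ⟩

theorem IsFourierOfIntegrable.sum {ι : Type*} (s : Finset ι) {F : ι → E → ℂ}
    (hF : ∀ i, IsFourierOfIntegrable (F i)) : IsFourierOfIntegrable fun ξ => ∑ i ∈ s, F i ξ := by
  classical
  induction s using Finset.induction_on with
  | empty =>
    refine ⟨0, integrable_zero _ _ _, ?_⟩
    ext ξ; simp [Real.fourier_eq]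
  | insert i s hi ih =>
    simp only [Finset.sum_insert hi]
    exact (hF i).add ih

/-- A function with integrable derivatives is mapped to an integrable function by the Bessel
potential operator of negative order `-2 * β > -1`. -/
theorem isFourierOfIntegrable_rpow_mul (hn : 2 ≤ finrank ℝ E) {β : ℝ} (hβ : β < 1 / 2)
    {S : E → ℂ} (hS : Integrable S)
    (hD : ∀ e, ∃ D : E → ℂ, Integrable D ∧ ∀ ξ, 𝓕 D ξ = 2 * π * Complex.I * inner ℝ e ξ * 𝓕 S ξ) :
    IsFourierOfIntegrable fun ξ => (((1 + ‖ξ‖ ^ 2) ^ β : ℝ) : ℂ) * 𝓕 S ξ := by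
  choose D hDi hD using hD
  have hγ : 1 / 2 < 1 - β := by linarith
  have hΓ : Gamma (1 - β) ≠ 0 := (Gamma_pos_of_pos (by linarith)).ne'
  let b := stdOrthonormalBasis ℝ E
  -- Write `(1 + |ξ|²)^β` as `(1 + |ξ|²)^(-(1-β)) (1 + Σ ξ_i²)` and distribute each `ξ_i²`: one
  -- derivative falls on the Bessel kernel, integrable as `1 - β > 1/2`, the other on `S`.
  have h1 : IsFourierOfIntegrable fun ξ : E => 𝓕 (bessel (1 - β) : E → ℂ) ξ * 𝓕 S ξ :=
    IsFourierOfIntegrable.mul ⟨_, integrable_bessel (by linarith), rfl⟩ ⟨_, hS, rfl⟩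
  have h2 : ∀ i, IsFourierOfIntegrable fun ξ : E =>
      𝓕 (besselDeriv (1 - β) (b i) : E → ℂ) ξ * 𝓕 (D (b i)) ξ := fun i =>
    IsFourierOfIntegrable.mul ⟨_, integrable_besselDeriv hγ _, rfl⟩ ⟨_, hDi _, rfl⟩
  have h3 := (h1.add ((IsFourierOfIntegrable.sum Finset.univ h2).const_mul
    (-(1 / (4 * π ^ 2) : ℂ)))).const_mul ((Gamma (1 - β) : ℂ)⁻¹)
  convert! h3 using 2 with ξ
  simp only [fourier_besselDeriv hn hγ, hD]
  have h4 : ∀ i, 2 * π * Complex.I * inner ℝ (b i) ξ * 𝓕 (bessel (1 - β) : E → ℂ) ξ *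
      (2 * π * Complex.I * inner ℝ (b i) ξ * 𝓕 S ξ) =
      (-(4 * π ^ 2) * 𝓕 (bessel (1 - β) : E → ℂ) ξ * 𝓕 S ξ) * ((inner ℝ (b i) ξ ^ 2 : ℝ) : ℂ) := by
    intro i; push_cast; ring_nf; rw [Complex.I_sq]; ring
  rw [Finset.sum_congr rfl fun i _ => h4 i, ← Finset.mul_sum, ← Complex.ofReal_sum]
  have h5 : ∑ i, inner ℝ (b i) ξ ^ 2 = ‖ξ‖ ^ 2 := by
    simpa [sq_abs] using b.sum_sq_norm_inner_right ξ
  rw [h5, fourier_bessel (by linarith)]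
  have h6 : (1 + ‖ξ‖ ^ 2) ^ β = (1 + ‖ξ‖ ^ 2) ^ (-(1 - β)) * (1 + ‖ξ‖ ^ 2) := by
    rw [← rpow_add_one (by positivity)]; congr 1; ring
  rw [h6]
  have : (Gamma (1 - β) : ℂ) ≠ 0 := by exact_mod_cast hΓ
  have : (π : ℂ) ≠ 0 := by exact_mod_cast pi_ne_zero
  push_cast
  field_simp

end FourierAlgebra

/-! ### Radial majorants -/

section RadialMajorant

open Filter Module Real

variable {E : Type*} [NormedAddCommGroup E] [InnerProductSpace ℝ E]

theorem exists_hasFDerivAt_norm_rpow {x : E} (hx : x ≠ 0) (k : ℝ) :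
    ∃ L : E →L[ℝ] ℝ, HasFDerivAt (fun y : E => ‖y‖ ^ k) L x ∧ ‖L‖ ≤ |k| * ‖x‖ ^ (k - 1) := by
  have h1 : DifferentiableAt ℝ (fun y : E => ‖y‖) x := (contDiffAt_norm (n := 1) ℝ hx).differentiableAt (by simp)
  refine ⟨_, h1.hasFDerivAt.rpow_const (Or.inl (norm_ne_zero_iff.2 hx)), ?_⟩
  rw [norm_smul, norm_mul, norm_eq_abs, norm_of_nonneg (rpow_nonneg (norm_nonneg x) _)]
  refine mul_le_of_le_one_right (by positivity) ?_
  simpa using norm_fderiv_le_of_lipschitz ℝ (f := fun y : E => ‖y‖) (x₀ := x) lipschitzWith_one_norm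

variable [FiniteDimensional ℝ E] [MeasurableSpace E] [BorelSpace E]

theorem integrable_radialMajorant (hn : 1 ≤ finrank ℝ E) {m α r : ℝ} (hr : 0 < r)
    (hm : m < finrank ℝ E) (hα : finrank ℝ E < α) :
    Integrable fun x : E => if ‖x‖ < r then ‖x‖ ^ (-m) else ‖x‖ ^ (-α) := by
  have : Nontrivial E := Module.nontrivial_of_finrank_pos (R := ℝ) hn
  refine (integrable_fun_norm_addHaar volume
    (f := fun ρ : ℝ => if ρ < r then ρ ^ (-m) else ρ ^ (-α))).2 ?_
  rw [← Ioo_union_Ici_eq_Ioi hr]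
  have hpow : ∀ (k : ℝ), ∀ ρ ∈ Ioi (0 : ℝ), ρ ^ (finrank ℝ E - 1) • ρ ^ k =
      ρ ^ ((finrank ℝ E : ℝ) - 1 + k) := fun k ρ hρ => by
    rw [smul_eq_mul, rpow_add hρ, ← rpow_natCast]; push_cast [hn]; rfl
  refine IntegrableOn.union ?_ ?_
  · have h1 : IntegrableOn (fun ρ : ℝ => ρ ^ ((finrank ℝ E : ℝ) - 1 + -m)) (Ioo 0 r) :=
      (intervalIntegral.integrableOn_Ioo_rpow_iff hr).2 (by linarith)
    refine IntegrableOn.congr_fun h1 (fun ρ hρ => ?_) measurableSet_Ioo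
    simp only [hρ.2, if_true]
    exact (hpow _ ρ hρ.1).symm
  · have h1 : IntegrableOn (fun ρ : ℝ => ρ ^ ((finrank ℝ E : ℝ) - 1 + -α)) (Ici r) :=
      (integrableOn_Ici_iff_integrableOn_Ioi (by finiteness)).2
        (integrableOn_Ioi_rpow_of_lt (by linarith) hr)
    refine IntegrableOn.congr_fun h1 (fun ρ hρ => ?_) measurableSet_Ici
    simp only [not_lt.2 (mem_Ici.1 hρ), if_false]
    exact (hpow _ ρ (hr.trans_le hρ)).symm

end RadialMajorant

/-! ### Riesz-like kernels and their symbols -/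

section Kernel

open FourierTransform Filter Module Real

variable {E : Type*} [NormedAddCommGroup E] [InnerProductSpace ℝ E]

/-- A kernel that is a multiple of `‖x‖ ^ (-m)` near the origin, continuously differentiable
away from it, and has decay of order `α`. -/
structure IsRieszLikeKernel (m a r α C : ℝ) (g : E → ℝ) : Prop where
  pos : 0 < a
  radius_pos : 0 < r
  contDiffOn : ContDiffOn ℝ 1 g {0}ᶜ
  near : ∀ x, x ≠ 0 → ‖x‖ < r → g x = a * ‖x‖ ^ (-m)
  abs_le : ∀ x, x ≠ 0 → |g x| ≤ C * if ‖x‖ < r then ‖x‖ ^ (-m) else ‖x‖ ^ (-α)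
  fderiv_le : ∀ x, x ≠ 0 →
    min 1 ‖x‖ * ‖fderiv ℝ g x‖ ≤ C * if ‖x‖ < r then ‖x‖ ^ (-m) else ‖x‖ ^ (-α)

/-- Near zero and near infinity the bounds come from the explicit formulas. On the compact annulus
between, continuity gives constants, which `|R|^α ‖x‖^(-α) ≥ 1` converts to the tail profile. No
sign of `b` is assumed, so `b = 0` covers compactly supported kernels. -/
theorem exists_isRieszLikeKernel [FiniteDimensional ℝ E] {m a b r R α : ℝ} {g : E → ℝ} (hm : 0 < m)
    (ha : 0 < a) (hr : 0 < r) (hα : 0 < α) (hg : ContDiffOn ℝ 1 g {0}ᶜ)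
    (h0 : ∀ x, x ≠ 0 → ‖x‖ ≤ r → g x = a / ‖x‖ ^ m) (h1 : ∀ x, R ≤ ‖x‖ → g x = b / ‖x‖ ^ α) :
    ∃ C, IsRieszLikeKernel m a r α C g := by
  have hdiff : ∀ x : E, x ≠ 0 → DifferentiableAt ℝ g x := fun x hx =>
    (hg.differentiableOn (by simp)).differentiableAt (isOpen_compl_singleton.mem_nhds hx)
  have hcf : ContinuousOn (fun x => fderiv ℝ g x) {0}ᶜ :=
    hg.continuousOn_fderiv_of_isOpen isOpen_compl_singleton (by simp)
  have hK : IsCompact (Metric.closedBall (0 : E) R \ Metric.ball 0 r) :=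
    (isCompact_closedBall 0 R).diff Metric.isOpen_ball
  have hKsub : Metric.closedBall (0 : E) R \ Metric.ball 0 r ⊆ {0}ᶜ := by
    rintro x hx rfl
    exact hx.2 (Metric.mem_ball_self hr)
  obtain ⟨C₁, hC₁⟩ := hK.exists_bound_of_continuousOn (hg.continuousOn.mono hKsub)
  obtain ⟨C₂, hC₂⟩ := hK.exists_bound_of_continuousOn (hcf.mono hKsub)
  have hd0 : ∀ x : E, x ≠ 0 → ‖x‖ < r → ‖fderiv ℝ g x‖ ≤ a * (m * ‖x‖ ^ (-m - 1)) := by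
    intro x hx hxr
    obtain ⟨L, hL, hL'⟩ := exists_hasFDerivAt_norm_rpow hx (-m)
    have : g =ᶠ[nhds x] fun y => a * ‖y‖ ^ (-m) := by
      filter_upwards [isOpen_compl_singleton.mem_nhds hx,
        (isOpen_lt continuous_norm continuous_const).mem_nhds hxr] with y hy hyr
      rw [h0 y hy (le_of_lt hyr), rpow_neg (norm_nonneg y), div_eq_mul_inv]
    rw [this.fderiv_eq, (hL.const_mul a).fderiv, norm_smul, norm_of_nonneg ha.le]
    rw [abs_neg, abs_of_pos hm] at hL'
    gcongr
  have hd1 : ∀ x : E, x ≠ 0 → R < ‖x‖ → ‖fderiv ℝ g x‖ ≤ |b| * (α * ‖x‖ ^ (-α - 1)) := by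
    intro x hx hxr
    obtain ⟨L, hL, hL'⟩ := exists_hasFDerivAt_norm_rpow hx (-α)
    have : g =ᶠ[nhds x] fun y => b * ‖y‖ ^ (-α) := by
      filter_upwards [(isOpen_lt continuous_const continuous_norm).mem_nhds hxr] with y hyr
      rw [h1 y (le_of_lt hyr), rpow_neg (norm_nonneg y), div_eq_mul_inv]
    rw [this.fderiv_eq, (hL.const_mul b).fderiv, norm_smul, norm_eq_abs]
    rw [abs_neg, abs_of_pos hα] at hL'
    gcongr
  set C := a + a * m + |b| + |b| * α * (1 + r⁻¹) + |C₁| * |R| ^ α + |C₂| * |R| ^ α with hC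
  have p1 : 0 ≤ a * m := by positivity
  have p2 : 0 ≤ |b| * α * (1 + r⁻¹) := by positivity
  have p3 : 0 ≤ |C₁| * |R| ^ α := by positivity
  have p4 : 0 ≤ |C₂| * |R| ^ α := by positivity
  have hmid : ∀ x : E, x ≠ 0 → ‖x‖ ≤ R → 1 ≤ |R| ^ α * ‖x‖ ^ (-α) := by
    intro x hx hxR
    rw [rpow_neg (norm_nonneg x), ← div_eq_mul_inv, one_le_div (by positivity)]
    exact rpow_le_rpow (norm_nonneg x) (hxR.trans (le_abs_self R)) hα.le
  refine ⟨C, ha, hr, hg, fun x hx hxr => ?_, fun x hx => ?_, fun x hx => ?_⟩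
  · rw [h0 x hx hxr.le, rpow_neg (norm_nonneg x), div_eq_mul_inv]
  · have hx0 : 0 < ‖x‖ := norm_pos_iff.2 hx
    split_ifs with hxr
    · rw [h0 x hx hxr.le, div_eq_mul_inv, ← rpow_neg (norm_nonneg x), abs_of_nonneg (by positivity)]
      gcongr
      linarith [abs_nonneg b]
    · rcases le_or_gt ‖x‖ R with hxR | hxR
      · have h2 := hC₁ x ⟨by simpa using hxR, by simpa using hxr⟩
        calc |g x| ≤ |C₁| * 1 := by rw [mul_one]; exact h2.trans (le_abs_self _)
          _ ≤ |C₁| * (|R| ^ α * ‖x‖ ^ (-α)) := by gcongr; exact hmid x hx hxR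
          _ = |C₁| * |R| ^ α * ‖x‖ ^ (-α) := by ring
          _ ≤ C * ‖x‖ ^ (-α) := by gcongr; linarith [abs_nonneg b]
      · rw [h1 x hxR.le, div_eq_mul_inv, ← rpow_neg (norm_nonneg x), abs_mul,
          abs_of_nonneg (rpow_nonneg hx0.le _)]
        gcongr
        linarith
  · have hx0 : 0 < ‖x‖ := norm_pos_iff.2 hx
    split_ifs with hxr
    · calc min 1 ‖x‖ * ‖fderiv ℝ g x‖ ≤ ‖x‖ * (a * (m * ‖x‖ ^ (-m - 1))) := by
            gcongr
            · exact min_le_right _ _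
            · exact hd0 x hx hxr
        _ = a * m * (‖x‖ ^ (-m - 1) * ‖x‖) := by ring
        _ = a * m * ‖x‖ ^ (-m) := by rw [← rpow_add_one hx0.ne']; ring_nf
        _ ≤ C * ‖x‖ ^ (-m) := by gcongr; linarith [abs_nonneg b]
    · refine (mul_le_of_le_one_left (norm_nonneg _) (min_le_left _ _)).trans ?_
      rcases le_or_gt ‖x‖ R with hxR | hxR
      · have h2 := hC₂ x ⟨by simpa using hxR, by simpa using hxr⟩
        calc ‖fderiv ℝ g x‖ ≤ |C₂| * 1 := by rw [mul_one]; exact h2.trans (le_abs_self _)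
          _ ≤ |C₂| * (|R| ^ α * ‖x‖ ^ (-α)) := by gcongr; exact hmid x hx hxR
          _ = |C₂| * |R| ^ α * ‖x‖ ^ (-α) := by ring
          _ ≤ C * ‖x‖ ^ (-α) := by gcongr; linarith [abs_nonneg b]
      · calc ‖fderiv ℝ g x‖ ≤ |b| * (α * ‖x‖ ^ (-α - 1)) := hd1 x hx hxR
          _ = |b| * α * ‖x‖⁻¹ * ‖x‖ ^ (-α) := by rw [rpow_sub_one hx0.ne']; ring
          _ ≤ |b| * α * (1 + r⁻¹) * ‖x‖ ^ (-α) := by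
            gcongr
            have : ‖x‖⁻¹ ≤ r⁻¹ := by gcongr; exact not_lt.1 hxr
            linarith
          _ ≤ C * ‖x‖ ^ (-α) := by gcongr; linarith [abs_nonneg b]

theorem ae_ne_zero_of_finrank [FiniteDimensional ℝ E] [MeasurableSpace E] [BorelSpace E]
    (hn : 1 ≤ finrank ℝ E) : ∀ᵐ x : E, x ≠ 0 := by
  have : Nontrivial E := Module.nontrivial_of_finrank_pos (R := ℝ) hn
  simp [ae_iff]

namespace IsRieszLikeKernel

variable {m a r α C : ℝ} {g : E → ℝ} (hg : IsRieszLikeKernel m a r α C g)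
include hg

theorem hasFDerivAt {x : E} (hx : x ≠ 0) : HasFDerivAt g (fderiv ℝ g x) x :=
  ((hg.contDiffOn.differentiableOn (by simp)).differentiableAt
    (isOpen_compl_singleton.mem_nhds hx)).hasFDerivAt

variable [FiniteDimensional ℝ E] [MeasurableSpace E] [BorelSpace E]

theorem aestronglyMeasurable (hn : 1 ≤ finrank ℝ E) : AEStronglyMeasurable g volume := by
  have h : AEStronglyMeasurable g (volume.restrict {0}ᶜ) :=
    hg.contDiffOn.continuousOn.aestronglyMeasurable (measurableSet_singleton 0).compl
  rwa [Measure.restrict_eq_self_of_ae_mem] at h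
  exact ae_ne_zero_of_finrank hn

theorem aestronglyMeasurable_fderiv (hn : 1 ≤ finrank ℝ E) :
    AEStronglyMeasurable (fderiv ℝ g) volume := by
  have h : AEStronglyMeasurable (fderiv ℝ g) (volume.restrict {0}ᶜ) :=
    (hg.contDiffOn.continuousOn_fderiv_of_isOpen isOpen_compl_singleton
      (by simp)).aestronglyMeasurable (measurableSet_singleton 0).compl
  rwa [Measure.restrict_eq_self_of_ae_mem] at h
  exact ae_ne_zero_of_finrank hn

theorem integrable (hn : 1 ≤ finrank ℝ E) (hm : m < finrank ℝ E) (hα : finrank ℝ E < α) :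
    Integrable g := by
  refine ((integrable_radialMajorant hn hg.radius_pos hm hα).const_mul C).mono'
    (hg.aestronglyMeasurable hn) ?_
  filter_upwards [ae_ne_zero_of_finrank hn] with x hx using hg.abs_le x hx

/-- The Fourier transform of the kernel is comparable to that of a Bessel kernel. -/
theorem exists_symbol (hn : 2 ≤ finrank ℝ E) {β : ℝ} (hβ0 : 0 < β) (hβ : β < 1 / 2)
    (hm : m = finrank ℝ E - 2 * β) (hα : finrank ℝ E < α) :
    ∃ (σ : E → ℂ) (c : ℂ), Integrable σ ∧ c ≠ 0 ∧ ∀ ξ, 𝓕 (fun x => (g x : ℂ)) ξ =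
      (((1 + ‖ξ‖ ^ 2) ^ (-β) : ℝ) : ℂ) * (c + 𝓕 σ ξ) := by
  have hn1 : 1 ≤ finrank ℝ E := by lia
  have hn2 : (2 : ℝ) ≤ finrank ℝ E := by exact_mod_cast hn
  have hβn : β < finrank ℝ E / 2 := by linarith
  have hr := hg.radius_pos
  -- The cutoff is supported in the ball where `g` is an exact power. It splits `g` into a truncated
  -- Riesz kernel, compared with the Bessel kernel, and `W = (1 - η) g`.
  let ηb : ContDiffBump (0 : E) := ⟨r / 4, r / 2, by positivity, by linarith⟩
  let η : E → ℝ := ηb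
  have hη : ContDiff ℝ ∞ η := ηb.contDiff
  have hc : HasCompactSupport η := ηb.hasCompactSupport
  have hη1 : ∀ x, |η x| ≤ 1 := fun x => by
    rw [abs_of_nonneg ηb.nonneg]; exact ηb.le_one
  have hη0 : η 0 = 1 := ηb.one_of_mem_closedBall (by simp; positivity)
  have hηz : ∀ x, r ≤ ‖x‖ → η x = 0 := fun x hx => by
    refine ηb.zero_of_le_dist ?_
    rw [dist_zero_right]
    change r / 2 ≤ ‖x‖
    linarith
  obtain ⟨K, hK⟩ := ContDiff.lipschitzWith_of_hasCompactSupport hc hη (by simp)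
  have hη2 : ∀ x, |1 - η x| ≤ K * ‖x‖ := fun x => by
    simpa [hη0, Real.dist_eq] using hK.dist_le_mul 0 x
  have hη' : ∀ e x, |fderiv ℝ η x e| ≤ K * ‖e‖ := fun e x =>
    ((fderiv ℝ η x).le_opNorm e).trans (by gcongr; exact norm_fderiv_le_of_lipschitz ℝ hK)
  obtain ⟨S, hS, hSD, hSb⟩ := exists_heatCutoff hn hβ0 hβn hη hc hη1 hη0
  have hmaj := integrable_radialMajorant (E := E) (m := m) hn1 hg.radius_pos (by linarith) hα
  have hae := ae_ne_zero_of_finrank hn1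
  have hηc := hη.continuous
  let W : E → ℂ := fun x => (((1 - η x) * g x : ℝ) : ℂ)
  let W' : E → E → ℂ := fun e x => (((1 - η x) * fderiv ℝ g x e - fderiv ℝ η x e * g x : ℝ) : ℂ)
  have hW : Integrable W := by
    refine ((hg.integrable hn1 (by linarith) hα).bdd_mul (c := 2)
      (f := fun x => 1 - η x) (by fun_prop) (Eventually.of_forall fun x => ?_)).ofReal
    have := hη1 x
    rw [norm_eq_abs]; rw [_root_.abs_le] at this ⊢; constructor <;> linarith
  -- The gradient of `g` is too singular at the origin, but `1 - η` vanishes there linearly, which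
  -- is exactly the weight `min 1 ‖x‖` in `fderiv_le`.
  have hW' : ∀ e, Integrable (W' e) := fun e => by
    have hcont : Continuous fun x => fderiv ℝ η x e :=
      (hη.continuous_fderiv (by simp)).clm_apply continuous_const
    refine Integrable.ofReal ?_
    have hmeas : AEStronglyMeasurable (fun x => fderiv ℝ g x e) volume :=
      (hg.aestronglyMeasurable_fderiv hn1).apply_continuousLinearMap e
    refine (hmaj.const_mul ((2 + K) * ‖e‖ * C + K * ‖e‖ * C)).mono' ?_ ?_
    · exact ((by fun_prop : AEStronglyMeasurable (fun x => 1 - η x) volume).mul hmeas).sub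
        (hcont.aestronglyMeasurable.mul (hg.aestronglyMeasurable hn1))
    · filter_upwards [hae] with x hx
      set M := if ‖x‖ < r then ‖x‖ ^ (-m) else ‖x‖ ^ (-α)
      have h1 : |1 - η x| ≤ (2 + K) * min 1 ‖x‖ := by
        have h2 := hη2 x
        have h3 : |1 - η x| ≤ 2 := by
          have := hη1 x
          rw [_root_.abs_le] at this ⊢; constructor <;> linarith
        rcases min_cases 1 ‖x‖ with ⟨h, -⟩ | ⟨h, -⟩ <;> rw [h]
        · linarith [K.2]
        · linarith [norm_nonneg x]
      calc ‖(1 - η x) * fderiv ℝ g x e - fderiv ℝ η x e * g x‖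
          ≤ |1 - η x| * |fderiv ℝ g x e| + |fderiv ℝ η x e| * |g x| := by
            refine (norm_sub_le _ _).trans_eq ?_
            rw [norm_mul, norm_mul]; rfl
        _ ≤ ((2 + K) * min 1 ‖x‖) * (‖fderiv ℝ g x‖ * ‖e‖) + (K * ‖e‖) * (C * M) := by
            gcongr
            · exact (fderiv ℝ g x).le_opNorm e
            · exact hη' e x
            · exact hg.abs_le x hx
        _ = (2 + K) * ‖e‖ * (min 1 ‖x‖ * ‖fderiv ℝ g x‖) + (K * ‖e‖) * (C * M) := by ring
        _ ≤ (2 + K) * ‖e‖ * (C * M) + (K * ‖e‖) * (C * M) := by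
            gcongr (2 + K) * ‖e‖ * ?_ + _
            exact hg.fderiv_le x hx
        _ = _ := by ring
  have hWD : ∀ e ξ, 𝓕 (W' e) ξ = 2 * π * Complex.I * inner ℝ e ξ * 𝓕 W ξ := fun e ξ => by
    refine fourier_hasLineDerivAt hn hW (hW' e) (fun x hx => ?_) ξ
    have h1 : HasLineDerivAt ℝ η (fderiv ℝ η x e) x e :=
      (hη.differentiable (by simp) x).hasFDerivAt.hasLineDerivAt e
    have h2 : HasDerivAt (fun τ : ℝ => (1 - η (x + τ • e)) * g (x + τ • e)) _ 0 :=
      (HasDerivAt.const_sub 1 h1).mul ((hg.hasFDerivAt hx).hasLineDerivAt e)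
    have h3 := h2.ofReal_comp
    simp only [zero_smul, add_zero] at h3
    refine HasDerivAt.congr_deriv (h3 : HasDerivAt (fun τ : ℝ => W (x + τ • e)) _ 0) ?_
    simp only [W']
    congr 1
    ring
  -- Normalized so that `c₀` times the heat superposition reproduces `a ‖x‖^(-m)`. Then `g = S' + c₀
  -- * bessel β` almost everywhere, and multiplying transforms by `(1 + |ξ|²)^β` turns the Bessel
  -- term into a constant and `S'` into an integrable function.
  set c₀ : ℂ := ((a / heatConst E β : ℝ) : ℂ) with hc₀
  have hκ := heatConst_pos hβn
  let S' : E → ℂ := fun x => W x + c₀ * S x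
  have hS' : Integrable S' := hW.add (hS.const_mul c₀)
  have hS'D : ∀ e, ∃ D : E → ℂ, Integrable D ∧
      ∀ ξ, 𝓕 D ξ = 2 * π * Complex.I * inner ℝ e ξ * 𝓕 S' ξ := fun e => by
    obtain ⟨D, hD, hD'⟩ := hSD e
    refine ⟨fun x => W' e x + c₀ * D x, (hW' e).add (hD.const_mul c₀), fun ξ => ?_⟩
    rw [fourier_add_of_integrable (hW' e) (hD.const_mul c₀), fourier_const_mul, hWD, hD',
      fourier_add_of_integrable hW (hS.const_mul c₀), fourier_const_mul]
    ring
  obtain ⟨σ, hσ, hσ'⟩ := isFourierOfIntegrable_rpow_mul hn hβ hS' hS'D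
  refine ⟨σ, c₀ * Gamma β, hσ, mul_ne_zero ?_ ?_, fun ξ => ?_⟩
  · exact Complex.ofReal_ne_zero.2 (div_pos hg.pos hκ).ne'
  · exact_mod_cast (Gamma_pos_of_pos hβ0).ne'
  · have h1 : (fun x => (g x : ℂ)) =ᵐ[volume] fun x => S' x + c₀ * bessel β x := by
      filter_upwards [hae] with x hx
      have h2 : S' x + c₀ * bessel β x = W x + c₀ * (S x + bessel β x) := by simp only [S']; ring
      rw [h2, ← hSb x hx, hc₀, ← Complex.ofReal_mul, ← Complex.ofReal_add]
      congr 1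
      have h3 : a / heatConst E β * (heatConst E β * (η x * ‖x‖ ^ (2 * β - finrank ℝ E))) =
          η x * (a * ‖x‖ ^ (2 * β - finrank ℝ E)) := by field_simp
      rw [h3]
      rcases lt_or_ge ‖x‖ r with hxr | hxr
      · rw [hg.near x hx hxr, hm, neg_sub]; ring
      · rw [hηz x hxr]; ring
    have h4 : 𝓕 (fun x => (g x : ℂ)) ξ = 𝓕 (fun x => S' x + c₀ * bessel β x) ξ := by
      simp only [Real.fourier_eq]
      refine integral_congr_ae ?_
      filter_upwards [h1] with x hx
      rw [hx]
    rw [h4, fourier_add_of_integrable hS' ((integrable_bessel hβ0).const_mul c₀), fourier_const_mul,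
      fourier_bessel hβ0, hσ']
    have h5 : (1 + ‖ξ‖ ^ 2) ^ (-β) * (1 + ‖ξ‖ ^ 2) ^ β = 1 := by
      rw [← rpow_add (by positivity)]; simp
    have h6 : (((1 + ‖ξ‖ ^ 2) ^ (-β) : ℝ) : ℂ) * (((1 + ‖ξ‖ ^ 2) ^ β : ℝ) : ℂ) = 1 := by
      exact_mod_cast h5
    rw [mul_add, ← mul_assoc _ _ (𝓕 S' ξ), h6]
    push_cast
    ring

end IsRieszLikeKernel

end Kernel

/-! ### Polar coordinates -/

section Polar

open Filter Module Metric

variable {E : Type*} [NormedAddCommGroup E] [InnerProductSpace ℝ E] [FiniteDimensional ℝ E]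
  [MeasurableSpace E] [BorelSpace E]

theorem lintegral_polar [Nontrivial E] {f : E → ENNReal} (hf : Measurable f) :
    ∫⁻ x, f x = ∫⁻ w : sphere (0 : E) 1, (∫⁻ ρ in Ioi (0 : ℝ),
      ENNReal.ofReal (ρ ^ (finrank ℝ E - 1)) * f (ρ • (w : E))) ∂(volume : Measure E).toSphere := by
  have h1 : ∫⁻ x, f x = ∫⁻ x : ({(0 : E)}ᶜ : Set E), f x ∂(volume.comap Subtype.val) := by
    rw [lintegral_subtype_comap (measurableSet_singleton _).compl, restrict_compl_singleton]
  have h2 := (volume : Measure E).measurePreserving_homeomorphUnitSphereProd.lintegral_comp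
    (f := fun z : sphere (0 : E) 1 × Ioi (0 : ℝ) => f ((z.2 : ℝ) • (z.1 : E)))
    (hf.comp (by fun_prop))
  have h3 : ∀ x : ({(0 : E)}ᶜ : Set E), f ((homeomorphUnitSphereProd E x).2.1 •
      ((homeomorphUnitSphereProd E x).1 : E)) = f x := fun x => by
    rw [← homeomorphUnitSphereProd_symm_apply_coe, Homeomorph.symm_apply_apply]
  simp only [h3] at h2
  have hm : Measurable fun z : sphere (0 : E) 1 × Ioi (0 : ℝ) => f ((z.2 : ℝ) • (z.1 : E)) :=
    hf.comp (by fun_prop)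
  rw [h1, h2, lintegral_prod _ hm.aemeasurable]
  refine lintegral_congr fun w => ?_
  have hmw : Measurable fun y : Ioi (0 : ℝ) => f ((y : ℝ) • (w : E)) := hf.comp (by fun_prop)
  rw [Measure.volumeIoiPow, lintegral_withDensity_eq_lintegral_mul _ (by fun_prop) hmw, ← lintegral_subtype_comap measurableSet_Ioi]
  rfl

theorem integral_polar [Nontrivial E] {f : E → ℝ} (hf : Integrable f) :
    Integrable (fun w : sphere (0 : E) 1 => ∫ ρ in Ioi (0 : ℝ),
      ρ ^ (finrank ℝ E - 1) * f (ρ • (w : E))) (volume : Measure E).toSphere ∧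
    ∫ x, f x = ∫ w : sphere (0 : E) 1, (∫ ρ in Ioi (0 : ℝ),
      ρ ^ (finrank ℝ E - 1) * f (ρ • (w : E))) ∂(volume : Measure E).toSphere := by
  have h1 : ∫ x, f x = ∫ x : ({(0 : E)}ᶜ : Set E), f x ∂(volume.comap Subtype.val) := by
    rw [integral_subtype_comap (measurableSet_singleton _).compl, restrict_compl_singleton]
  have h1' : Integrable (fun x : ({(0 : E)}ᶜ : Set E) => f x) (volume.comap Subtype.val) := by
    refine (integrableOn_iff_comap_subtypeVal (measurableSet_singleton (0 : E)).compl).1 ?_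
    exact hf.integrableOn
  let F : sphere (0 : E) 1 × Ioi (0 : ℝ) → ℝ := fun z => f ((z.2 : ℝ) • (z.1 : E))
  have h3 : F ∘ homeomorphUnitSphereProd E = fun x : ({(0 : E)}ᶜ : Set E) => f x := by
    ext x
    simp only [F, Function.comp]
    rw [← homeomorphUnitSphereProd_symm_apply_coe, Homeomorph.symm_apply_apply]
  have mp := (volume : Measure E).measurePreserving_homeomorphUnitSphereProd
  have h4 : Integrable F ((volume : Measure E).toSphere.prod
      (.volumeIoiPow (finrank ℝ E - 1))) := by
    rw [← mp.integrable_comp_emb (Homeomorph.measurableEmbedding _), h3]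
    exact h1'
  have h5 := mp.integral_comp (Homeomorph.measurableEmbedding _) F
  have h6 : ∀ w : sphere (0 : E) 1, ∫ ρ : Ioi (0 : ℝ), F (w, ρ) ∂.volumeIoiPow (finrank ℝ E - 1) =
      ∫ ρ in Ioi (0 : ℝ), ρ ^ (finrank ℝ E - 1) * f (ρ • (w : E)) := fun w => by
    simp only [Measure.volumeIoiPow, ENNReal.ofReal]
    rw [integral_withDensity_eq_integral_smul,
        integral_subtype_comap measurableSet_Ioi fun a : ℝ ↦
          Real.toNNReal (a ^ (finrank ℝ E - 1)) • f (a • (w : E)),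
        setIntegral_congr_fun measurableSet_Ioi fun x hx ↦ ?_]
    · rw [NNReal.smul_def, Real.coe_toNNReal _ (pow_nonneg hx.out.le _), smul_eq_mul]
    · exact (measurable_subtype_coe.pow_const _).real_toNNReal
  have h7 := h4.integral_prod_left
  simp only [h6] at h7
  refine ⟨h7, ?_⟩
  rw [h1]
  have : ∫ x : ({(0 : E)}ᶜ : Set E), f x ∂(volume.comap Subtype.val) =
      ∫ x, F (homeomorphUnitSphereProd E x) ∂(volume.comap Subtype.val) := by
    rw [← h3]; rfl
  rw [this, h5, integral_prod _ h4]
  simp only [h6]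

end Polar

/-! ### Pólya's criterion -/

section Polya

open Filter Topology Real

/-- Affine functions are orthogonal to the cosine over full periods starting at a multiple of the
period, so one may be subtracted from the integrand on each period at no cost. -/
theorem integral_mul_cos_period (a : ℝ) (ha : 0 < a) (A B : ℝ) (i : ℕ) :
    ∫ ρ in (i * (2 * π / a))..((i + 1 : ℕ) * (2 * π / a)), (A + B * ρ) * cos (a * ρ) = 0 := by
  have h : ∀ ρ : ℝ, HasDerivAt (fun ρ => (A + B * ρ) * (sin (a * ρ) / a) + B * (cos (a * ρ) / a ^ 2))
      ((A + B * ρ) * cos (a * ρ)) ρ := fun ρ => by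
    have h0 : HasDerivAt (fun ρ : ℝ => a * ρ) a ρ := by simpa using (hasDerivAt_id ρ).const_mul a
    have h1 : HasDerivAt (fun ρ : ℝ => A + B * ρ) B ρ := by
      simpa using ((hasDerivAt_id ρ).const_mul B).const_add A
    convert! (h1.mul (h0.sin.div_const a)).add ((h0.cos.div_const (a ^ 2)).const_mul B) using 1
    field_simp; ring
  rw [intervalIntegral.integral_eq_sub_of_hasDerivAt (fun ρ _ => h ρ)
    ((by fun_prop : Continuous fun ρ : ℝ => (A + B * ρ) * cos (a * ρ)).intervalIntegrable _ _)]
  have h2 : ∀ j : ℕ, a * (j * (2 * π / a)) = j * (2 * π) := fun j => by field_simp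
  have h3 : ∀ j : ℕ, sin (j * (2 * π)) = 0 := fun j => by
    simpa using Real.sin_add_nat_mul_two_pi 0 j
  have h4 := h2 (i + 1)
  have h5 := h3 (i + 1)
  have h6 := Real.cos_nat_mul_two_pi (i + 1)
  rw [h4, h5, h6, h2, h3, Real.cos_nat_mul_two_pi]
  ring

/-- A convex function lies below its secant between the nodes and above it outside. A factor `c`
with the same sign pattern makes the product nonnegative. -/
theorem convexOn_sub_secant_mul_nonneg {k : ℝ → ℝ} (hk : ConvexOn ℝ (Ioi 0) k) {p q : ℝ}
    (hp : 0 < p) (hpq : p < q) {ρ : ℝ} (hρ : 0 < ρ) {c : ℝ}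
    (h1 : ρ < p → 0 ≤ c) (h2 : p < ρ → ρ < q → c ≤ 0) (h3 : q < ρ → 0 ≤ c) :
    0 ≤ (k ρ - (k p + (k q - k p) / (q - p) * (ρ - p))) * c := by
  have hq : 0 < q := hp.trans hpq
  have hqp : 0 < q - p := sub_pos.2 hpq
  rcases lt_trichotomy ρ p with h | h | h
  · refine mul_nonneg ?_ (h1 h)
    have := hk.slope_mono_adjacent hρ hq h hpq
    rw [div_le_iff₀ (sub_pos.2 h)] at this
    nlinarith
  · simp [h]
  · rcases lt_trichotomy ρ q with h' | h' | h'
    · refine mul_nonneg_of_nonpos_of_nonpos ?_ (h2 h h')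
      have := hk.slope_mono_adjacent (mem_Ioi.2 hp) hq h h'
      rw [div_le_div_iff₀ (sub_pos.2 h) (sub_pos.2 h')] at this
      have h4 : (k q - k p) / (q - p) * (ρ - p) = (k q - k p) * (ρ - p) / (q - p) := by ring
      rw [h4, sub_nonpos, ← sub_le_iff_le_add', le_div_iff₀ hqp]
      nlinarith
    · subst h'
      have : (k ρ - k p) / (ρ - p) * (ρ - p) = k ρ - k p := by field_simp
      rw [this]; simp
    · refine mul_nonneg ?_ (h3 h')
      have := hk.slope_mono_adjacent (mem_Ioi.2 hp) hρ hpq h'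
      rw [le_div_iff₀ (sub_pos.2 h')] at this
      have h4 : (k q - k p) / (q - p) * (q - p) = k q - k p := by field_simp
      nlinarith

theorem cos_sign_period {a : ℝ} (ha : 0 < a) (i : ℕ) {ρ : ℝ} (hl : i * (2 * π / a) ≤ ρ)
    (hr : ρ ≤ (i + 1 : ℕ) * (2 * π / a)) :
    (ρ < i * (2 * π / a) + π / (2 * a) → 0 ≤ cos (a * ρ)) ∧
    (i * (2 * π / a) + π / (2 * a) < ρ → ρ < i * (2 * π / a) + 3 * π / (2 * a) →
      cos (a * ρ) ≤ 0) ∧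
    (i * (2 * π / a) + 3 * π / (2 * a) < ρ → 0 ≤ cos (a * ρ)) := by
  have hcos : cos (a * ρ) = cos (a * ρ - i * (2 * π)) := (Real.cos_sub_nat_mul_two_pi _ i).symm
  have e1 : a * ρ - i * (2 * π) = a * (ρ - i * (2 * π / a)) := by field_simp
  have e2 : a * (π / (2 * a)) = π / 2 := by field_simp
  have e3 : a * (3 * π / (2 * a)) = 3 * π / 2 := by field_simp
  have e4 : a * (2 * π / a) = 2 * π := by field_simp
  push_cast at hr
  have hl' : 0 ≤ a * ρ - i * (2 * π) := by
    rw [e1]; exact mul_nonneg ha.le (by linarith)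
  have hr' : a * ρ - i * (2 * π) ≤ 2 * π := by
    have : ρ - i * (2 * π / a) ≤ 2 * π / a := by linarith
    rw [e1]; exact (mul_le_mul_of_nonneg_left this ha.le).trans_eq e4
  have hpi := pi_pos
  rw [hcos]
  refine ⟨fun h => ?_, fun h h' => ?_, fun h => ?_⟩
  · refine cos_nonneg_of_neg_pi_div_two_le_of_le (by linarith) ?_
    rw [e1, ← e2]; gcongr; linarith
  · refine cos_nonpos_of_pi_div_two_le_of_le ?_ ?_
    · rw [e1, ← e2]; gcongr; linarith
    · have : a * ρ - i * (2 * π) ≤ 3 * π / 2 := by rw [e1, ← e3]; gcongr; linarith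
      linarith
  · rw [← Real.cos_sub_two_pi]
    have : 3 * π / 2 ≤ a * ρ - i * (2 * π) := by rw [e1, ← e3]; gcongr; linarith
    exact cos_nonneg_of_neg_pi_div_two_le_of_le (by linarith) (by linarith)

/-- Pólya's criterion on the half line: the cosine transform of a convex function is positive. -/
theorem integral_mul_cos_pos {k : ℝ → ℝ} (hk : ConvexOn ℝ (Ioi 0) k) (hi : IntegrableOn k (Ioi 0))
    (h0 : Tendsto k (𝓝[>] 0) atTop) {a : ℝ} (ha : 0 < a) :
    0 < ∫ ρ in Ioi (0 : ℝ), k ρ * cos (a * ρ) := by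
  set T := 2 * π / a with hT
  have hT0 : 0 < T := by positivity
  have hpi := pi_pos
  have hint : IntegrableOn (fun ρ => k ρ * cos (a * ρ)) (Ioi 0) :=
    hi.mul_bdd (c := 1) (g := fun ρ => cos (a * ρ)) (by fun_prop)
      (Eventually.of_forall fun ρ => abs_cos_le_one _)
  have hii : ∀ x y : ℝ, 0 ≤ x → 0 ≤ y →
      IntervalIntegrable (fun ρ => k ρ * cos (a * ρ)) volume x y := fun x y hx hy => by
    rw [intervalIntegrable_iff]
    exact hint.mono_set fun ρ hρ => (le_min hx hy).trans_lt hρ.1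
  -- The nodes `p i` and `q i` are the two zeros of `cos (a ρ)` in the `i`-th period, and `l i` is
  -- the secant of `k` through them.
  let p : ℕ → ℝ := fun i => i * T + π / (2 * a)
  let q : ℕ → ℝ := fun i => i * T + 3 * π / (2 * a)
  let l : ℕ → ℝ → ℝ := fun i ρ => k (p i) + (k (q i) - k (p i)) / (q i - p i) * (ρ - p i)
  have hp : ∀ i, 0 < p i := fun i => by positivity
  have hpq : ∀ i, p i < q i := fun i => by
    simp only [p, q]; gcongr; linarith
  have hl : ∀ i, ∫ ρ in (i * T)..((i + 1 : ℕ) * T), l i ρ * cos (a * ρ) = 0 := fun i => by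
    rw [← integral_mul_cos_period a ha (k (p i) - (k (q i) - k (p i)) / (q i - p i) * p i)
      ((k (q i) - k (p i)) / (q i - p i)) i]
    congr 1; ext ρ; simp only [l]; ring
  have hlc : ∀ i, Continuous fun ρ => l i ρ * cos (a * ρ) := fun i => by
    simp only [l]; fun_prop
  have hnn : ∀ i : ℕ, ∀ ρ, 0 < ρ → i * T ≤ ρ → ρ ≤ (i + 1 : ℕ) * T →
      0 ≤ k ρ * cos (a * ρ) - l i ρ * cos (a * ρ) := fun i ρ hρ h1 h2 => by
    rw [← sub_mul]
    obtain ⟨c1, c2, c3⟩ := cos_sign_period ha i h1 h2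
    exact convexOn_sub_secant_mul_nonneg hk (hp i) (hpq i) hρ c1 c2 c3
  have hsplit : ∀ i : ℕ, ∫ ρ in (i * T)..((i + 1 : ℕ) * T), k ρ * cos (a * ρ) =
      ∫ ρ in (i * T)..((i + 1 : ℕ) * T), (k ρ * cos (a * ρ) - l i ρ * cos (a * ρ)) := fun i => by
    rw [intervalIntegral.integral_sub (hii _ _ (by positivity) (by positivity))
      ((hlc i).intervalIntegrable _ _), hl, sub_zero]
  have hle : ∀ i : ℕ, (i : ℝ) * T ≤ (i + 1 : ℕ) * T := fun i => by
    gcongr; simp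
  have hper : ∀ i : ℕ, 0 ≤ ∫ ρ in (i * T)..((i + 1 : ℕ) * T), k ρ * cos (a * ρ) := fun i => by
    rw [hsplit, intervalIntegral.integral_of_le (hle i)]
    refine setIntegral_nonneg measurableSet_Ioc fun ρ hρ => ?_
    exact hnn i ρ (lt_of_le_of_lt (by positivity) hρ.1) hρ.1.le hρ.2
  -- Strict positivity comes from the first period: near zero `k` blows up and exceeds its bounded
  -- secant, while the cosine is positive.
  have hfirst : 0 < ∫ ρ in ((0 : ℕ) * T)..((0 + 1 : ℕ) * T), k ρ * cos (a * ρ) := by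
    rw [hsplit]
    simp only [Nat.cast_zero, zero_mul, zero_add, Nat.cast_one, one_mul]
    obtain ⟨δ, hδ0, hδ⟩ : ∃ δ > 0, ∀ ρ ∈ Ioo (0 : ℝ) δ,
        |k (p 0)| + |(k (q 0) - k (p 0)) / (q 0 - p 0)| * p 0 < k ρ := by
      have := h0.eventually_gt_atTop (|k (p 0)| + |(k (q 0) - k (p 0)) / (q 0 - p 0)| * p 0)
      obtain ⟨δ, hδ0, hδ⟩ := mem_nhdsGT_iff_exists_Ioo_subset.1 this
      exact ⟨δ, hδ0, fun ρ hρ => hδ hρ⟩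
    have hpT : p 0 ≤ T := by
      simp only [p, T, Nat.cast_zero, zero_mul, zero_add]
      rw [div_le_div_iff₀ (by positivity) ha]; nlinarith
    have hp0 := hp 0
    set δ' := min δ (p 0) with hδ'
    have hδ'0 : 0 < δ' := lt_min hδ0 hp0
    have hδ'T : δ' ≤ T := (min_le_right _ _).trans hpT
    have hF : ∀ x y : ℝ, 0 ≤ x → 0 ≤ y → IntervalIntegrable
        (fun ρ => k ρ * cos (a * ρ) - l 0 ρ * cos (a * ρ)) volume x y := fun x y hx hy =>
      (hii x y hx hy).sub ((hlc 0).intervalIntegrable _ _)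
    rw [← intervalIntegral.integral_add_adjacent_intervals (hF 0 δ' le_rfl hδ'0.le)
      (hF δ' T hδ'0.le hT0.le)]
    refine add_pos_of_pos_of_nonneg ?_ ?_
    · refine intervalIntegral.intervalIntegral_pos_of_pos_on (hF 0 δ' le_rfl hδ'0.le)
        (fun ρ hρ => ?_) hδ'0
      have hρp : ρ < p 0 := hρ.2.trans_le (min_le_right _ _)
      rw [← sub_mul]
      refine mul_pos ?_ (cos_pos_of_mem_Ioo ⟨?_, ?_⟩)
      · have h1 := hδ ρ ⟨hρ.1, hρ.2.trans_le (min_le_left _ _)⟩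
        have h2 : (k (q 0) - k (p 0)) / (q 0 - p 0) * (ρ - p 0) ≤
            |(k (q 0) - k (p 0)) / (q 0 - p 0)| * p 0 := by
          refine (le_abs_self _).trans ?_
          rw [abs_mul]
          gcongr
          rw [abs_le]; constructor <;> linarith [hρ.1]
        have h3 := le_abs_self (k (p 0))
        simp only [l]
        linarith
      · have := mul_pos ha hρ.1
        linarith
      · have : a * p 0 = π / 2 := by simp only [p]; field_simp; simp
        rw [← this]; gcongr
    · rw [intervalIntegral.integral_of_le hδ'T]
      refine setIntegral_nonneg measurableSet_Ioc fun ρ hρ => ?_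
      refine hnn 0 ρ (hδ'0.trans hρ.1) ?_ ?_
      · simpa using (hδ'0.trans hρ.1).le
      · simpa using hρ.2
  have htend : Tendsto (fun N : ℕ => ∫ ρ in (0 : ℝ)..(N * T), k ρ * cos (a * ρ)) atTop
      (𝓝 (∫ ρ in Ioi (0 : ℝ), k ρ * cos (a * ρ))) :=
    intervalIntegral_tendsto_integral_Ioi 0 hint
      (tendsto_natCast_atTop_atTop.atTop_mul_const hT0)
  refine hfirst.trans_le (ge_of_tendsto htend ?_)
  filter_upwards [eventually_ge_atTop 1] with N hN
  have hsum := intervalIntegral.sum_integral_adjacent_intervals (μ := volume)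
    (f := fun ρ => k ρ * cos (a * ρ)) (a := fun i : ℕ => (i : ℝ) * T) (n := N)
    (fun i _ => hii _ _ (by positivity) (by positivity))
  simp only [Nat.cast_zero, zero_mul] at hsum
  rw [← hsum]
  have := Finset.single_le_sum (f := fun i : ℕ =>
    ∫ ρ in (i * T)..((i + 1 : ℕ) * T), k ρ * cos (a * ρ)) (fun i _ => hper i)
    (Finset.mem_range.2 hN : 0 ∈ Finset.range N)
  simpa using this

/-- An integrable non-increasing function on the half line cannot become negative, and the blow-up
at zero makes it positive on an interval. This covers the directions orthogonal to the frequency,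
where the cosine is constant. -/
theorem integral_pos_of_antitoneOn {k : ℝ → ℝ} (hk : AntitoneOn k (Ioi 0))
    (hi : IntegrableOn k (Ioi 0)) (h0 : Tendsto k (𝓝[>] 0) atTop) :
    0 < ∫ ρ in Ioi (0 : ℝ), k ρ := by
  have hnn : ∀ ρ, 0 < ρ → 0 ≤ k ρ := by
    intro ρ hρ
    by_contra! h
    have h1 : IntegrableOn (fun _ : ℝ => k ρ) (Ioi ρ) := by
      refine Integrable.mono (hi.mono_set (Ioi_subset_Ioi hρ.le)) (by fun_prop) ?_
      filter_upwards [ae_restrict_mem measurableSet_Ioi] with x (hx : ρ < x)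
      have := hk (mem_Ioi.2 hρ) (mem_Ioi.2 (hρ.trans hx)) hx.le
      rw [norm_eq_abs, norm_eq_abs, abs_of_neg h, abs_of_neg (this.trans_lt h)]
      linarith
    rw [integrableOn_const_iff] at h1
    simp [h.ne] at h1
  obtain ⟨δ, hδ0, hδ⟩ := mem_nhdsGT_iff_exists_Ioo_subset.1 (h0.eventually_gt_atTop 0)
  rw [setIntegral_pos_iff_support_of_nonneg_ae _ hi]
  · refine lt_of_lt_of_le ?_ (measure_mono (s := Ioo 0 δ) fun ρ hρ => ⟨(hδ hρ).ne', hρ.1⟩)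
    simpa using hδ0
  · filter_upwards [ae_restrict_mem measurableSet_Ioi] with x hx using hnn x hx

end Polya

/-! ### Positivity of the real part of the Fourier transform of the kernel -/

section FourierPositive

open FourierTransform Filter Module Real Metric Topology

variable {E : Type*} [NormedAddCommGroup E] [InnerProductSpace ℝ E] [FiniteDimensional ℝ E]
  [MeasurableSpace E] [BorelSpace E]

/-- The Fourier transform of a radial kernel with convex and non-increasing radial density does not
vanish. -/
theorem IsRieszLikeKernel.fourier_ne_zero {m a r α C s : ℝ} {g : E → ℝ}
    (hg : IsRieszLikeKernel m a r α C g) (hn : 1 ≤ finrank ℝ E) (hs0 : 0 < s) (hs1 : s < 1)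
    (hm : m = finrank ℝ E - 1 + s) (hα : finrank ℝ E < α)
    (hrad : ∀ x y, ‖x‖ = ‖y‖ → g x = g y)
    (hanti : ∀ x, x ≠ 0 → AntitoneOn (fun ρ : ℝ => ρ ^ (finrank ℝ E - 1) * g (ρ • x)) (Ioi 0))
    (hconv : ∀ x, x ≠ 0 → ConvexOn ℝ (Ioi 0) (fun ρ : ℝ => ρ ^ (finrank ℝ E - 1) * g (ρ • x)))
    (ξ : E) : 𝓕 (fun x => (g x : ℂ)) ξ ≠ 0 := by
  have : Nontrivial E := Module.nontrivial_of_finrank_pos (R := ℝ) hn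
  have hgi := hg.integrable hn (by linarith) hα
  have hki : ∀ w : sphere (0 : E) 1,
      IntegrableOn (fun ρ : ℝ => ρ ^ (finrank ℝ E - 1) * g (ρ • (w : E))) (Ioi 0) := fun w => by
    refine (integrable_fun_norm_addHaar volume (f := fun ρ : ℝ => g (ρ • (w : E)))).1 ?_
    refine hgi.congr (Eventually.of_forall fun x => hrad _ _ ?_)
    rw [norm_smul]; simp
  -- Near zero the radial density is `ρ^(d-1) * a ρ^(-(d-1+s)) = a ρ^(-s)`.
  have hk0 : ∀ w : sphere (0 : E) 1,
      Tendsto (fun ρ : ℝ => ρ ^ (finrank ℝ E - 1) * g (ρ • (w : E))) (𝓝[>] 0) atTop := fun w => by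
    have h1 : Tendsto (fun ρ : ℝ => a * ρ ^ (-s)) (𝓝[>] 0) atTop :=
      (tendsto_rpow_neg_nhdsGT_zero (by linarith)).const_mul_atTop hg.pos
    refine h1.congr' ?_
    filter_upwards [Ioo_mem_nhdsGT hg.radius_pos] with ρ hρ
    have h2 : ‖ρ • (w : E)‖ = ρ := by rw [norm_smul]; simp [abs_of_pos hρ.1]
    rw [hg.near _ (norm_pos_iff.1 (by rw [h2]; exact hρ.1)) (by rw [h2]; exact hρ.2), h2, hm,
      mul_left_comm, ← rpow_natCast, ← rpow_add hρ.1]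
    congr 2
    push_cast [hn]
    ring
  let f : E → ℝ := fun x => g x * cos (2 * π * inner ℝ x ξ)
  have hf : Integrable f := by
    refine hgi.mul_bdd (c := 1) (g := fun x => cos (2 * π * inner ℝ x ξ)) (by fun_prop)
      (Eventually.of_forall fun ρ => abs_cos_le_one _)
  -- Along the ray through `w` the character oscillates with frequency `2 π |⟨w, ξ⟩|`; Pólya's
  -- criterion applies when this is nonzero, monotonicity when it is zero.
  have hpos : ∀ w : sphere (0 : E) 1,
      0 < ∫ ρ in Ioi (0 : ℝ), ρ ^ (finrank ℝ E - 1) * f (ρ • (w : E)) := fun w => by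
    have hw : (w : E) ≠ 0 := ne_zero_of_mem_unit_sphere w
    simp only [f, ← mul_assoc, real_inner_smul_left]
    rcases eq_or_ne (inner ℝ (w : E) ξ) 0 with h | h
    · simp only [h, mul_zero, cos_zero, mul_one]
      exact integral_pos_of_antitoneOn (hanti w hw) (hki w) (hk0 w)
    · have h1 : ∀ ρ : ℝ, cos (2 * π * ρ * inner ℝ (w : E) ξ) =
          cos ((2 * π * |inner ℝ (w : E) ξ|) * ρ) := fun ρ => by
        rcases abs_choice (inner ℝ (w : E) ξ) with h' | h' <;> rw [h']
        · congr 1; ring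
        · rw [← cos_neg]; congr 1; ring
      simp only [h1]
      exact integral_mul_cos_pos (hconv w hw) (hki w) (hk0 w) (by positivity)
  obtain ⟨h1, h2⟩ := integral_polar hf
  have h3 : 0 < ∫ x, f x := by
    rw [h2, integral_pos_iff_support_of_nonneg (fun w => (hpos w).le) h1]
    have : Function.support (fun w : sphere (0 : E) 1 => ∫ ρ in Ioi (0 : ℝ),
        ρ ^ (finrank ℝ E - 1) * f (ρ • (w : E))) = univ := by
      ext w; simpa using (hpos w).ne'
    rw [this, pos_iff_ne_zero, Ne, Measure.measure_univ_eq_zero]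
    exact Measure.toSphere_ne_zero _
  have h4 : (𝓕 (fun x => (g x : ℂ)) ξ).re = ∫ x, f x := by
    rw [Real.fourier_eq]
    simp only [Circle.smul_def, smul_eq_mul]
    have hgi' : Integrable fun x => (g x : ℂ) := hgi.ofReal
    have h5 := integral_re (integrable_fourierChar_mul hgi' ξ)
    simp only [RCLike.re_to_complex] at h5
    refine Eq.trans h5.symm ?_
    congr 1; ext x
    rw [Real.fourierChar_apply]
    simp only [f, Complex.mul_re, Complex.ofReal_re, Complex.ofReal_im,
      mul_zero, sub_zero, Complex.exp_ofReal_mul_I_re]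
    rw [mul_comm, ← cos_neg]
    congr 2; ring
  intro h
  rw [h] at h4
  simp only [Complex.zero_re] at h4
  linarith

end FourierPositive

/-! ### The fractional gradient as a convolution -/

section FractionalGradient

open FourierTransform Filter Module Real

variable {E : Type*} [NormedAddCommGroup E] [InnerProductSpace ℝ E] [FiniteDimensional ℝ E]
  [MeasurableSpace E] [BorelSpace E]

omit [FiniteDimensional ℝ E] [MeasurableSpace E] [BorelSpace E] in
-- Lipschitz at short distance, bounded at long distance. The factor `min 1 ‖x - y‖` is the weight
-- against which `IsRieszLikeKernel` controls the gradient of the kernel.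
theorem exists_abs_sub_le_min {u : E → ℝ} (hu : ContDiff ℝ ∞ u) (hc : HasCompactSupport u) :
    ∃ K : ℝ, 0 ≤ K ∧ ∀ x y, |u x - u y| ≤ K * min 1 ‖x - y‖ := by
  obtain ⟨K, hK⟩ := ContDiff.lipschitzWith_of_hasCompactSupport hc hu (by simp)
  obtain ⟨M, hM⟩ := hu.continuous.bounded_above_of_compact_support hc
  have hM0 : 0 ≤ M := (norm_nonneg _).trans (hM 0)
  refine ⟨2 * M + K, by positivity, fun x y => ?_⟩
  have h1 : |u x - u y| ≤ K * ‖x - y‖ := by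
    simpa [dist_eq_norm] using hK.dist_le_mul x y
  have h2 : |u x - u y| ≤ 2 * M := by
    refine (abs_sub _ _).trans ?_
    have := hM x; have := hM y
    rw [norm_eq_abs] at *; linarith
  have h3 := K.2
  have h4 := norm_nonneg (x - y)
  rcases min_cases 1 ‖x - y‖ with ⟨h, -⟩ | ⟨h, -⟩ <;> rw [h]
  · linarith [show (0 : ℝ) ≤ K from h3]
  · have : 0 ≤ 2 * M * ‖x - y‖ := by positivity
    linarith

theorem ae_sub_ne_zero (hn : 1 ≤ finrank ℝ E) (x : E) : ∀ᵐ y : E, x - y ≠ 0 := by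
  have : Nontrivial E := Module.nontrivial_of_finrank_pos (R := ℝ) hn
  simp [ae_iff, sub_eq_zero]

namespace IsRieszLikeKernel

variable {m a r α C : ℝ} {g : E → ℝ} (hg : IsRieszLikeKernel m a r α C g)
include hg

theorem integrable_sub_smul_gradient (hn : 1 ≤ finrank ℝ E) (hm : m < finrank ℝ E)
    (hα : finrank ℝ E < α) {u : E → ℝ} (hu : ContDiff ℝ ∞ u) (hc : HasCompactSupport u) (x : E) :
    Integrable fun y => (u x - u y) • gradient g (x - y) := by
  obtain ⟨K, hK0, hK⟩ := exists_abs_sub_le_min hu hc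
  have hmaj := ((integrable_radialMajorant hn hg.radius_pos hm hα).const_mul (K * C)).comp_sub_left x
  have hmeas : AEStronglyMeasurable (fun y => gradient g (x - y)) volume := by
    have h1 : AEStronglyMeasurable (gradient g) volume :=
      (InnerProductSpace.toDual ℝ E).symm.continuous.comp_aestronglyMeasurable
        (hg.aestronglyMeasurable_fderiv hn)
    exact h1.comp_quasiMeasurePreserving
      (Measure.measurePreserving_sub_left volume x).quasiMeasurePreserving
  have huc := hu.continuous
  refine hmaj.mono' ((by fun_prop : AEStronglyMeasurable (fun y => u x - u y) volume).smul hmeas) ?_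
  filter_upwards [ae_sub_ne_zero hn x] with y hy
  have h2 : ‖gradient g (x - y)‖ = ‖fderiv ℝ g (x - y)‖ := by
    rw [gradient, LinearIsometryEquiv.norm_map]
  rw [norm_smul, h2]
  calc ‖u x - u y‖ * ‖fderiv ℝ g (x - y)‖
      ≤ (K * min 1 ‖x - y‖) * ‖fderiv ℝ g (x - y)‖ := by gcongr; exact hK x y
    _ = K * (min 1 ‖x - y‖ * ‖fderiv ℝ g (x - y)‖) := by ring
    _ ≤ _ := by
      rw [mul_assoc]
      exact mul_le_mul_of_nonneg_left (hg.fderiv_le _ hy) hK0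

/-- The nonlocal gradient is the convolution of the kernel with the gradient. -/
theorem inner_neg_integral_gradient (hn : 2 ≤ finrank ℝ E) (hm : m < finrank ℝ E)
    (hα : finrank ℝ E < α) {u : E → ℝ} (hu : ContDiff ℝ ∞ u) (hc : HasCompactSupport u) (x e : E) :
    inner ℝ (-∫ y, (u x - u y) • gradient g (x - y)) e = ∫ y, g (x - y) * fderiv ℝ u y e := by
  have hn1 : 1 ≤ finrank ℝ E := by lia
  have h1 := hg.integrable_sub_smul_gradient hn1 hm hα hu hc x
  have hgi := (hg.integrable hn1 hm hα).comp_sub_left x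
  have hu' : Continuous fun y => fderiv ℝ u y e :=
    (hu.continuous_fderiv (by simp)).clm_apply continuous_const
  have huc := hu.continuous
  obtain ⟨K, hK0, hK⟩ := exists_abs_sub_le_min hu hc
  obtain ⟨L, hL⟩ := hu'.bounded_above_of_compact_support
    ((hc.fderiv (𝕜 := ℝ)).comp_left (g := fun l : E →L[ℝ] ℝ => l e) rfl)
  have h2 : Integrable fun y => (u x - u y) * fderiv ℝ g (x - y) e := by
    have := (innerSL ℝ e).integrable_comp h1
    refine this.congr (Eventually.of_forall fun y => ?_)
    simp only [innerSL_apply_apply, inner_smul_right]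
    rw [real_inner_comm, inner_gradient_left]
  have h3 : Integrable fun y => g (x - y) * fderiv ℝ u y e :=
    hgi.mul_bdd (c := L) hu'.aestronglyMeasurable (Eventually.of_forall hL)
  have h4 : Integrable fun y => (u x - u y) * g (x - y) := by
    refine hgi.bdd_mul (c := K) (f := fun y => u x - u y) (by fun_prop)
      (Eventually.of_forall fun y => ?_)
    exact (hK x y).trans (mul_le_of_le_one_right hK0 (min_le_left _ _))
  -- Integration by parts: the derivative in `y` of `(u x - u y) g (x - y)` has integral zero.
  -- Subtracting `u y` from `u x` makes that derivative integrable across the singular point `y =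
  -- x`, where differentiability may fail.
  have h5 := integral_hasLineDerivAt_eq_zero hn (v := e) (x₀ := x)
    (f := fun y => (((u x - u y) * g (x - y) : ℝ) : ℂ))
    (f' := fun y => ((-(g (x - y) * fderiv ℝ u y e) - (u x - u y) * fderiv ℝ g (x - y) e : ℝ) : ℂ))
    h4.ofReal (h3.neg.sub h2).ofReal fun y hy => by
      have hxy : x - y ≠ 0 := sub_ne_zero.2 (Ne.symm hy)
      have d1 : HasLineDerivAt ℝ u (fderiv ℝ u y e) y e :=
        (hu.differentiable (by simp) y).hasFDerivAt.hasLineDerivAt e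
      have d2 : HasFDerivAt (fun z => g (x - z)) (-fderiv ℝ g (x - y)) y := by
        have := (hg.hasFDerivAt hxy).comp y ((hasFDerivAt_id y).const_sub x)
        convert! this using 1
        ext; simp
      have d3 : HasDerivAt (fun τ : ℝ => (u x - u (y + τ • e)) * g (x - (y + τ • e))) _ 0 :=
        (HasDerivAt.const_sub (u x) d1).mul (d2.hasLineDerivAt e)
      refine HasDerivAt.congr_deriv d3.ofReal_comp ?_
      simp only [zero_smul, add_zero]
      congr 1
      simp
      ring
  rw [integral_complex_ofReal, Complex.ofReal_eq_zero, integral_sub h3.fun_neg h2, integral_neg] at h5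
  rw [inner_neg_left, real_inner_comm, ← integral_inner h1]
  simp only [inner_smul_right]
  have h6 : ∀ y, inner ℝ e (gradient g (x - y)) = fderiv ℝ g (x - y) e := fun y => by
    rw [real_inner_comm, inner_gradient_left]
  simp only [h6]
  linarith

end IsRieszLikeKernel

end FractionalGradient

/-! ### Fourier transforms of test functions -/

section SmoothFourier

open FourierTransform Filter Module Real

variable {E : Type*} [NormedAddCommGroup E] [InnerProductSpace ℝ E] [FiniteDimensional ℝ E]
  [MeasurableSpace E] [BorelSpace E]

theorem integrable_of_contDiff {u : E → ℂ} (hu : ContDiff ℝ ∞ u) (hc : HasCompactSupport u) :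
    Integrable u := hu.continuous.integrable_of_hasCompactSupport hc

theorem integrable_fourier_of_contDiff {u : E → ℂ} (hu : ContDiff ℝ ∞ u)
    (hc : HasCompactSupport u) : Integrable (𝓕 u) := by
  have := (𝓕 (hc.toSchwartzMap hu) : SchwartzMap E ℂ).integrable (μ := volume)
  rwa [SchwartzMap.fourier_coe] at this

theorem fourierInv_fourier_of_contDiff {u : E → ℂ} (hu : ContDiff ℝ ∞ u)
    (hc : HasCompactSupport u) : 𝓕⁻ (𝓕 u) = u :=
  hu.continuous.fourierInv_fourier_eq (integrable_of_contDiff hu hc)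
    (integrable_fourier_of_contDiff hu hc)

omit [FiniteDimensional ℝ E] [MeasurableSpace E] [BorelSpace E] in
theorem contDiff_fderiv_apply_of_contDiff {u : E → ℂ} (hu : ContDiff ℝ ∞ u) (e : E) :
    ContDiff ℝ ∞ fun x => fderiv ℝ u x e :=
  (hu.fderiv_right (m := ∞) (by simp)).clm_apply contDiff_const

omit [FiniteDimensional ℝ E] [MeasurableSpace E] [BorelSpace E] in
theorem HasCompactSupport.fderiv_apply_const {u : E → ℂ} (hc : HasCompactSupport u) (e : E) :
    HasCompactSupport fun x => fderiv ℝ u x e :=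
  (hc.fderiv (𝕜 := ℝ)).comp_left (g := fun l : E →L[ℝ] ℂ => l e) rfl

theorem fourier_fderiv_apply (hn : 2 ≤ finrank ℝ E) {u : E → ℂ} (hu : ContDiff ℝ ∞ u)
    (hc : HasCompactSupport u) (e ξ : E) :
    𝓕 (fun x => fderiv ℝ u x e) ξ = 2 * π * Complex.I * inner ℝ e ξ * 𝓕 u ξ :=
  fourier_hasLineDerivAt hn (integrable_of_contDiff hu hc)
    (integrable_of_contDiff (contDiff_fderiv_apply_of_contDiff hu e) (hc.fderiv_apply_const e))
    (fun x _ => (hu.differentiable (by simp) x).hasFDerivAt.hasLineDerivAt e) ξ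

omit [InnerProductSpace ℝ E] [FiniteDimensional ℝ E] [MeasurableSpace E] [BorelSpace E] in
theorem continuous_one_add_norm_sq_rpow (b : ℝ) :
    Continuous fun ξ : E => (((1 + ‖ξ‖ ^ 2) ^ b : ℝ) : ℂ) :=
  Complex.continuous_ofReal.comp
    ((by fun_prop : Continuous fun ξ : E => 1 + ‖ξ‖ ^ 2).rpow_const fun ξ => Or.inl (by positivity))

theorem integrable_rpow_mul {b : ℝ} (hb : 0 ≤ b) {φ : E → ℂ} (hφ : Integrable φ) :
    Integrable fun ξ => (((1 + ‖ξ‖ ^ 2) ^ (-b) : ℝ) : ℂ) * φ ξ := by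
  refine hφ.bdd_mul (c := 1) (continuous_one_add_norm_sq_rpow (-b)).aestronglyMeasurable
    (Eventually.of_forall fun ξ => ?_)
  rw [Complex.norm_real, norm_of_nonneg (by positivity)]
  exact rpow_le_one_of_one_le_of_nonpos (by simp) (by linarith)

/-- Directional derivatives of an inverse Fourier transform. -/
theorem hasDerivAt_fourierInv_line {φ : E → ℂ} (hφ : Integrable φ)
    (hφ' : Integrable fun ξ => ‖ξ‖ * ‖φ ξ‖) (x w : E) (ρ : ℝ) :
    HasDerivAt (fun ρ : ℝ => 𝓕⁻ φ (x + ρ • w))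
      (𝓕⁻ (fun ξ => 2 * π * Complex.I * inner ℝ w ξ * φ ξ) (x + ρ • w)) ρ := by
  have h1 := Real.hasFDerivAt_fourier hφ hφ' (-(x + ρ • w))
  have h2 : HasDerivAt (fun ρ : ℝ => -(x + ρ • w)) (-w) ρ := by
    have := (((hasDerivAt_id ρ).smul_const w).const_add x).fun_neg
    simpa only [id_eq, one_smul] using this
  have h3 := h1.comp_hasDerivAt ρ h2
  simp only [Real.fourierInv_eq_fourier_neg]
  refine h3.congr_deriv ?_
  rw [Real.fourier_eq, Real.fourier_eq]
  have hi : Integrable fun v => Real.fourierChar (-inner ℝ v (-(x + ρ • w))) •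
      VectorFourier.fourierSMulRight (innerSL ℝ) φ v := by
    refine (Real.fourierIntegral_convergent_iff _).2 ?_
    refine (hφ'.const_mul (2 * π * ‖innerSL ℝ (E := E)‖)).mono' hφ.1.fourierSMulRight
      (Eventually.of_forall fun v => ?_)
    refine (VectorFourier.norm_fourierSMulRight_le _ _ _).trans_eq ?_
    ring
  rw [ContinuousLinearMap.integral_apply hi]
  congr 1
  ext v
  simp only [Circle.smul_def, smul_eq_mul, smul_apply,
    VectorFourier.fourierSMulRight_apply, inner_neg_right]
  rw [real_inner_comm v w]
  have e : (innerSL ℝ v) w = inner ℝ v w := rfl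
  simp
  erw [e]
  ring

end SmoothFourier

/-! ### Pointwise control by Riesz potentials -/

section Representation

open FourierTransform Filter Module Real Topology ENNReal Metric

variable {E : Type*} [NormedAddCommGroup E] [InnerProductSpace ℝ E] [FiniteDimensional ℝ E]
  [MeasurableSpace E] [BorelSpace E]

/-- The Riemann–Lebesgue lemma, restricted to a ray. -/
theorem tendsto_fourierInv_line (φ : E → ℂ) (x : E) {w : E} (hw : ‖w‖ = 1) :
    Tendsto (fun ρ : ℝ => 𝓕⁻ φ (x + ρ • w)) atTop (𝓝 0) := by
  simp only [Real.fourierInv_eq_fourier_neg]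
  have h1 : Tendsto (𝓕 φ) (cocompact E) (𝓝 0) := tendsto_integral_exp_inner_smul_cocompact φ
  refine h1.comp ?_
  rw [← Metric.cobounded_eq_cocompact, ← tendsto_norm_atTop_iff_cobounded]
  refine tendsto_atTop_mono (f := fun ρ : ℝ => ρ - ‖x‖) (fun ρ => ?_)
    (tendsto_atTop_add_const_right _ _ tendsto_id)
  rw [norm_neg]
  have h2 : ‖ρ • w‖ ≤ ‖x + ρ • w‖ + ‖x‖ := by
    simpa using norm_sub_le (x + ρ • w) x
  rw [norm_smul, hw, mul_one] at h2
  linarith [le_abs_self ρ, norm_eq_abs ρ]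

theorem fourierInv_sum_const_mul {ι : Type*} (s : Finset ι) (c : ι → ℂ) {φ : ι → E → ℂ}
    (hφ : ∀ i, Integrable (φ i)) (x : E) :
    𝓕⁻ (fun ξ => ∑ i ∈ s, c i * φ i ξ) x = ∑ i ∈ s, c i * 𝓕⁻ (φ i) x := by
  have h1 : ∀ i, Integrable fun v => 𝐞 (inner ℝ v x) • (c i * φ i v) := fun i => by
    simpa using (Real.fourierIntegral_convergent_iff (-x)).2 ((hφ i).const_mul (c i))
  simp only [fourierInv_eq, Finset.smul_sum, ← integral_const_mul]
  rw [integral_finsetSum _ fun i _ => h1 i]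
  refine Finset.sum_congr rfl fun i _ => ?_
  congr 1; ext v
  simp only [Circle.smul_def, smul_eq_mul]; ring

/-- A function vanishing at infinity is controlled by the Riesz potential of order one of its
gradient. -/
theorem enorm_mul_le_rieszPotential_one [Nontrivial E] {V : E → ℂ} {D : E → E → ℂ} {H : E → ℝ≥0∞}
    (hH : Measurable H) (hD : ∀ w, Continuous (D w))
    (hV : ∀ x w : E, ∀ ρ : ℝ, HasDerivAt (fun ρ : ℝ => V (x + ρ • w)) (D w (x + ρ • w)) ρ)
    (h0 : ∀ x w : E, ‖w‖ = 1 → Tendsto (fun ρ : ℝ => V (x + ρ • w)) atTop (𝓝 0))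
    (hDH : ∀ w z : E, ‖w‖ = 1 → ‖D w z‖ₑ ≤ H z) (x : E) :
    ‖V x‖ₑ * (volume : Measure E).toSphere univ ≤ rieszPotential 1 H x := by
  -- On each ray `V x` is minus the integral of the derivative, because `V` vanishes at infinity.
  -- Integrating over directions produces the kernel `‖z‖^(1-d)`, which cancels the Jacobian
  -- `ρ^(d-1)`.
  have hray : ∀ w : sphere (0 : E) 1, ‖V x‖ₑ ≤ ∫⁻ ρ in Ioi (0 : ℝ), H (x + ρ • (w : E)) := by
    intro w
    have hw : ‖(w : E)‖ = 1 := by simp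
    by_cases hfin : ∫⁻ ρ in Ioi (0 : ℝ), H (x + ρ • (w : E)) = ⊤
    · rw [hfin]; exact le_top
    have hle : ∫⁻ ρ in Ioi (0 : ℝ), ‖D w (x + ρ • (w : E))‖ₑ ≤
        ∫⁻ ρ in Ioi (0 : ℝ), H (x + ρ • (w : E)) := lintegral_mono fun ρ => hDH _ _ hw
    have hi : IntegrableOn (fun ρ : ℝ => D w (x + ρ • (w : E))) (Ioi 0) :=
      ⟨((hD w).comp (by fun_prop)).aestronglyMeasurable,
        (hle.trans_lt (lt_top_iff_ne_top.2 hfin))⟩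
    have h1 := integral_Ioi_of_hasDerivAt_of_tendsto' (fun ρ _ => hV x w ρ) hi (h0 x w hw)
    rw [zero_smul, add_zero, zero_sub] at h1
    have h2 := enorm_integral_le_lintegral_enorm (μ := volume.restrict (Ioi (0 : ℝ)))
      fun ρ : ℝ => D w (x + ρ • (w : E))
    rw [h1, enorm_neg] at h2
    exact h2.trans hle
  have h1 : rieszPotential 1 H x =
      ∫⁻ z : E, ENNReal.ofReal (‖z‖ ^ ((1 : ℝ) - finrank ℝ E)) * H (x + z) := by
    unfold rieszPotential
    rw [← lintegral_add_left_eq_self _ x]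
    refine lintegral_congr fun z => ?_
    rw [sub_add_cancel_left, norm_neg]
  rw [h1, lintegral_polar (by fun_prop), ← lintegral_const]
  refine lintegral_mono fun w => (hray w).trans (le_of_eq ?_)
  refine setLIntegral_congr_fun measurableSet_Ioi fun ρ (hρ : 0 < ρ) => ?_
  have h2 : ‖ρ • (w : E)‖ = ρ := by rw [norm_smul]; simp [abs_of_pos hρ]
  rw [h2, ← mul_assoc, ← ENNReal.ofReal_mul (by positivity), ← Real.rpow_natCast, ← Real.rpow_add hρ]
  have hn : 1 ≤ finrank ℝ E := finrank_pos
  push_cast [hn]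
  simp

theorem rieszPotential_sum {ι : Type*} (s : Finset ι) (α : ℝ) {f : ι → E → ℝ≥0∞}
    (hf : ∀ i, Measurable (f i)) (x : E) :
    rieszPotential α (fun y => ∑ i ∈ s, f i y) x = ∑ i ∈ s, rieszPotential α (f i) x := by
  unfold rieszPotential
  simp only [Finset.mul_sum]
  exact lintegral_finsetSum _ fun i _ => by have := hf i; fun_prop

/-- The left side is a convolution with `besselDeriv a e`, whose pointwise bound is a Riesz kernel
of order `2 a - 1`. -/
theorem fourierInv_besselDeriv_mul_le (hn : 1 ≤ finrank ℝ E) {a : ℝ} (ha : 1 / 2 < a)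
    (ha' : a < finrank ℝ E / 2 + 1) (e : E) {φ : E → ℂ} (hφ : Integrable φ) (x : E) :
    ‖𝓕⁻ (fun ξ => 𝓕 (besselDeriv a e) ξ * φ ξ) x‖ₑ ≤
      ENNReal.ofReal (2 * π ^ 2 * ‖e‖ * heatConst E (a - 1)) *
        rieszPotential (2 * a - 1) (fun y => ‖𝓕⁻ φ y‖ₑ) x := by
  rw [fourierInv_fourier_mul (integrable_besselDeriv ha e) hφ]
  refine (enorm_integral_le_lintegral_enorm _).trans ?_
  unfold rieszPotential
  rw [← lintegral_const_mul' _ _ ofReal_ne_top]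
  refine lintegral_mono_ae ?_
  have hK : 0 ≤ 2 * π ^ 2 * ‖e‖ * heatConst E (a - 1) := by
    have := heatConst_pos (E := E) (b := a - 1) (by linarith); positivity
  filter_upwards [ae_sub_ne_zero hn x] with y hy
  rw [enorm_mul, ← mul_assoc, ← ENNReal.ofReal_mul hK]
  gcongr
  rw [← ofReal_norm]
  exact ENNReal.ofReal_le_ofReal (norm_besselDeriv_le ha' e hy)

/-- A function is controlled by Riesz potentials of order `1` and `s` of its fractional
derivatives of order `s`. -/
theorem exists_enorm_le_rieszPotential_add (hn : 2 ≤ finrank ℝ E) {s p : ℝ} (hs0 : 0 < s)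
    (hs1 : s < 1) (hp : 1 < p) {ι : Type*} [Fintype ι] (b : OrthonormalBasis ι ℝ E) :
    ∃ C : ℝ≥0∞, C ≠ ⊤ ∧ ∀ φ : E → ℂ, Integrable φ → Integrable (fun ξ => ‖ξ‖ * ‖φ ξ‖) →
      ∀ ψ : ι → E → ℂ, (∀ i, Integrable (ψ i)) →
      (∀ i ξ, ψ i ξ = (((1 + ‖ξ‖ ^ 2) ^ (-((1 - s) / 2)) : ℝ) : ℂ) *
        (2 * π * Complex.I * inner ℝ (b i) ξ * φ ξ)) →
      ∃ h : ι → E → ℂ, (∀ i, Continuous (h i)) ∧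
        (∀ i, eLpNorm (h i) (ENNReal.ofReal p) ≤ C * eLpNorm (𝓕⁻ (ψ i)) (ENNReal.ofReal p)) ∧
        ∀ x, ‖𝓕⁻ φ x‖ₑ ≤ C * rieszPotential 1 (fun y => ∑ i, ‖h i y‖ₑ) x +
          C * rieszPotential s (fun y => ∑ i, ‖𝓕⁻ (ψ i) y‖ₑ) x := by
  have hn1 : 1 ≤ finrank ℝ E := by lia
  have hn2 : (2 : ℝ) ≤ finrank ℝ E := by exact_mod_cast hn
  have : Nontrivial E := Module.nontrivial_of_finrank_pos (R := ℝ) hn1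
  -- Two requirements agree: `γ + (1 - s)/2 = 1`, so a Bessel potential of order `2 γ` completes the
  -- weight in `ψ` to `(1 + |ξ|²)⁻¹`, and `2 γ - 1 = s`, the order of the resulting Riesz potential.
  set γ := (1 + s) / 2 with hγ
  have hγ1 : 1 / 2 < γ := by linarith
  have hΓ : (Gamma γ : ℂ) ≠ 0 := by
    exact_mod_cast (Gamma_pos_of_pos (by linarith)).ne'
  have hpi : (π : ℂ) ≠ 0 := by exact_mod_cast pi_ne_zero
  let k : E → ℂ := fun x => (Gamma γ : ℂ)⁻¹ * bessel γ x
  have hk : Integrable k := (integrable_bessel (by linarith)).const_mul _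
  have hk' : ∀ ξ, 𝓕 k ξ = (((1 + ‖ξ‖ ^ 2) ^ (-γ) : ℝ) : ℂ) := fun ξ => by
    rw [fourier_const_mul, fourier_bessel (by linarith), Complex.ofReal_mul,
      inv_mul_cancel_left₀ hΓ]
  set M := (volume : Measure E).toSphere univ with hM
  have hM0 : M ≠ 0 := by
    rw [hM, Ne, Measure.measure_univ_eq_zero]; exact Measure.toSphere_ne_zero _
  have hMt : M ≠ ⊤ := measure_ne_top _ _
  set c : ℂ := -(1 / (4 * π ^ 2 * Gamma γ)) with hc
  set K : ℝ := 2 * π ^ 2 * heatConst E (γ - 1) with hK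
  set C : ℝ≥0∞ := (∫⁻ x, ‖k x‖ₑ) + M⁻¹ + ‖c‖ₑ * ENNReal.ofReal K with hC
  have hkfin : ∫⁻ x, ‖k x‖ₑ ≠ ⊤ := hk.2.ne
  refine ⟨C, ?_, fun φ hφ hφ' ψ hψi hψ => ?_⟩
  · have : M⁻¹ ≠ ⊤ := ENNReal.inv_ne_top.2 hM0
    rw [hC]; finiteness
  have hGψ : ∀ i, Integrable fun ξ => 𝓕 k ξ * ψ i ξ := fun i => Integrable.fourier_mul hk (hψi i)
  have hG1 : Integrable fun ξ => (((1 + ‖ξ‖ ^ 2) ^ (-1 : ℝ) : ℝ) : ℂ) * φ ξ :=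
    integrable_rpow_mul zero_le_one hφ
  have hG1' : Integrable fun ξ => ‖ξ‖ * ‖(((1 + ‖ξ‖ ^ 2) ^ (-1 : ℝ) : ℝ) : ℂ) * φ ξ‖ := by
    have h1 : ∀ ξ : E, (1 + ‖ξ‖ ^ 2) ^ (-1 : ℝ) ≤ 1 := fun ξ =>
      rpow_le_one_of_one_le_of_nonpos (by simp) (by norm_num)
    refine hφ'.mono' (continuous_norm.aestronglyMeasurable.mul hG1.1.norm)
      (Eventually.of_forall fun ξ => ?_)
    rw [norm_mul, norm_norm, norm_norm, norm_mul, Complex.norm_real,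
      norm_of_nonneg (by positivity)]
    gcongr
    exact mul_le_of_le_one_left (norm_nonneg _) (h1 ξ)
  refine ⟨fun i => 𝓕⁻ fun ξ => 𝓕 k ξ * ψ i ξ, fun i => continuous_fourierInv_of_integrable (hGψ i),
    fun i => ?_, fun x => ?_⟩
  · refine (eLpNorm_fourierInv_fourier_mul_le hp hk (hψi i)).trans ?_
    gcongr
    rw [hC, add_assoc]
    exact le_self_add
  -- The part of `φ` whose gradient is a Bessel potential of `ψ`, hence controlled in `L^p`. The
  -- remainder `φ - G1` has the extra factor `|ξ|² = Σ ξ_i²` relative to `G1`, with one `ξ_i` placed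
  -- on the Bessel kernel and the other already in `ψ i`; the constant `c` removes `(2 π i)²` and
  -- the Gamma factor.
  set G1 : E → ℂ := fun ξ => (((1 + ‖ξ‖ ^ 2) ^ (-1 : ℝ) : ℝ) : ℂ) * φ ξ with hG1d
  have hexp : ∀ ξ : E, (((1 + ‖ξ‖ ^ 2) ^ (-γ) : ℝ) : ℂ) *
      (((1 + ‖ξ‖ ^ 2) ^ (-((1 - s) / 2)) : ℝ) : ℂ) = (((1 + ‖ξ‖ ^ 2) ^ (-1 : ℝ) : ℝ) : ℂ) := by
    intro ξ
    rw [← Complex.ofReal_mul, ← rpow_add (by positivity), hγ]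
    congr 2; ring
  have hsum : ∀ w ξ : E, (inner ℝ w ξ : ℂ) = ∑ i, (inner ℝ w (b i) : ℂ) * (inner ℝ (b i) ξ : ℂ) := by
    intro w ξ
    exact_mod_cast (b.sum_inner_mul_inner w ξ).symm
  let D : E → E → ℂ := fun w => 𝓕⁻ fun ξ => 2 * π * Complex.I * inner ℝ w ξ * G1 ξ
  have hDeq : ∀ w z, D w z = ∑ i, (inner ℝ w (b i) : ℂ) * 𝓕⁻ (fun ξ => 𝓕 k ξ * ψ i ξ) z := by
    intro w z
    rw [← fourierInv_sum_const_mul _ _ hGψ]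
    refine congrArg (fun F : E → ℂ => 𝓕⁻ F z) (funext fun ξ => ?_)
    rw [hsum, Finset.mul_sum, Finset.sum_mul]
    refine Finset.sum_congr rfl fun i _ => ?_
    simp only [hG1d]
    rw [hk', hψ, ← hexp ξ]
    ring
  have hDc : ∀ w, Continuous (D w) := fun w => by
    have : D w = fun z => ∑ i, (inner ℝ w (b i) : ℂ) * 𝓕⁻ (fun ξ => 𝓕 k ξ * ψ i ξ) z :=
      funext (hDeq w)
    rw [this]
    exact continuous_finsetSum _ fun i _ =>
      continuous_const.mul (continuous_fourierInv_of_integrable (hGψ i))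
  have hV := enorm_mul_le_rieszPotential_one (V := 𝓕⁻ G1) (D := D)
    (H := fun y => ∑ i, ‖𝓕⁻ (fun ξ => 𝓕 k ξ * ψ i ξ) y‖ₑ)
    (Finset.measurable_sum _ fun i _ =>
      (continuous_fourierInv_of_integrable (hGψ i)).measurable.enorm) hDc
    (fun x w ρ => hasDerivAt_fourierInv_line hG1 hG1' x w ρ)
    (fun x w hw => tendsto_fourierInv_line G1 x hw)
    (fun w z hw => by
      rw [hDeq]
      refine (enorm_sum_le _ _).trans (Finset.sum_le_sum fun i _ => ?_)
      rw [enorm_mul]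
      refine mul_le_of_le_one_left' ?_
      rw [← ofReal_norm, Complex.norm_real, ENNReal.ofReal_le_one]
      refine (abs_real_inner_le_norm w (b i)).trans ?_
      rw [hw, b.norm_eq_one, mul_one]) x
  have hdiff : ∀ ξ, φ ξ - G1 ξ = ∑ i, c * (𝓕 (besselDeriv γ (b i)) ξ * ψ i ξ) := by
    intro ξ
    have h1 : ∀ i, c * (𝓕 (besselDeriv γ (b i)) ξ * ψ i ξ) =
        ((inner ℝ (b i) ξ ^ 2 : ℝ) : ℂ) * G1 ξ := fun i => by
      rw [fourier_besselDeriv hn hγ1, fourier_bessel (by linarith), hψ]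
      simp only [hG1d]
      rw [← hexp ξ, hc]
      push_cast
      field_simp
      rw [Complex.I_sq]; ring
    rw [Finset.sum_congr rfl fun i _ => h1 i, ← Finset.sum_mul, ← Complex.ofReal_sum]
    have h5 : ∑ i, inner ℝ (b i) ξ ^ 2 = ‖ξ‖ ^ 2 := by
      simpa [sq_abs] using b.sum_sq_norm_inner_right ξ
    have h6 : (1 + ‖ξ‖ ^ 2 : ℂ) ≠ 0 := by
      have : (1 + ‖ξ‖ ^ 2 : ℝ) ≠ 0 := by positivity
      exact_mod_cast this
    rw [h5, hG1d]
    simp only [Real.rpow_neg_one]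
    push_cast
    field_simp
    ring
  have hW : ‖𝓕⁻ (fun ξ => φ ξ - G1 ξ) x‖ₑ ≤
      ‖c‖ₑ * ENNReal.ofReal K * rieszPotential s (fun y => ∑ i, ‖𝓕⁻ (ψ i) y‖ₑ) x := by
    simp only [hdiff]
    rw [fourierInv_sum_const_mul _ (fun _ => c)
      fun i => Integrable.fourier_mul (integrable_besselDeriv hγ1 _) (hψi i)]
    rw [rieszPotential_sum _ _ fun i =>
      (continuous_fourierInv_of_integrable (hψi i)).measurable.enorm, Finset.mul_sum]
    refine (enorm_sum_le _ _).trans (Finset.sum_le_sum fun i _ => ?_)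
    rw [enorm_mul, mul_assoc]
    gcongr
    have := fourierInv_besselDeriv_mul_le hn1 hγ1 (by linarith) (b i) (hψi i) x
    rw [b.norm_eq_one, mul_one, show 2 * γ - 1 = s by rw [hγ]; ring] at this
    exact this
  have hsplit : 𝓕⁻ φ x = 𝓕⁻ G1 x + 𝓕⁻ (fun ξ => φ ξ - G1 ξ) x := by
    have := congrFun (fourierInv_add' (ψ := fun ξ => φ ξ - G1 ξ) hG1 (hφ.sub hG1)) x
    simpa only [add_sub_cancel, Pi.add_apply] using this
  rw [hsplit]
  refine (enorm_add_le _ _).trans (add_le_add ?_ (hW.trans ?_))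
  · calc ‖𝓕⁻ G1 x‖ₑ = M⁻¹ * (‖𝓕⁻ G1 x‖ₑ * M) := by
          rw [mul_comm, mul_assoc, ENNReal.mul_inv_cancel hM0 hMt, mul_one]
      _ ≤ _ := by
          refine mul_le_mul' ?_ hV
          rw [hC]
          exact le_add_right le_add_self
  · gcongr
    exact le_add_self

end Representation

/-! ### From pointwise bounds to rearrangements, and degenerate cases -/

section Final

open FourierTransform Filter Module ENNReal

variable {E : Type*} [NormedAddCommGroup E] [InnerProductSpace ℝ E] [FiniteDimensional ℝ E]
  [MeasurableSpace E] [BorelSpace E]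

/-- On a level set of `U` just below its rearrangement at `t`, the function exceeds the level while
its average obeys the Riesz bound at the measure `T ≥ t` of that set. Monotonicity of the bound
brings `T` back to `t`; finite support keeps `T` finite. -/
theorem rearr_le_rieszBound (hd : 0 < finrank ℝ E) {α₁ α₂ : ℝ} (h₁ : α₁ < finrank ℝ E)
    (h₂ : α₂ < finrank ℝ E) {f₁ f₂ U : E → ℝ≥0∞} (hf₁ : Measurable f₁) (hf₂ : Measurable f₂)
    (hU : Measurable U) (hfin : volume (Function.support U) ≠ ⊤) {C : ℝ≥0∞}
    (h : ∀ x, U x ≤ C * rieszPotential α₁ f₁ x + C * rieszPotential α₂ f₂ x) {t : ℝ} (ht : 0 < t) :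
    rearr volume U t ≤ C * rieszBound α₁ f₁ t + C * rieszBound α₂ f₂ t := by
  refine le_of_forall_lt fun l hl => ?_
  obtain ⟨l', hll', hl'⟩ := exists_between hl
  refine hll'.trans_le ?_
  set A := {x | l' < U x} with hA
  have hAm : MeasurableSet A := measurableSet_lt measurable_const hU
  have hAt : ENNReal.ofReal t ≤ volume A := le_measure_of_lt_rearr hl'
  have hAfin : volume A ≠ ⊤ := ne_top_of_le_ne_top hfin
    (measure_mono fun x (hx : l' < U x) => (bot_le.trans_lt hx).ne')
  set T := (volume A).toReal with hT
  have hAT : volume A = ENNReal.ofReal T := (ENNReal.ofReal_toReal hAfin).symm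
  have htT : t ≤ T := (ENNReal.ofReal_le_iff_le_toReal hAfin).1 hAt
  have hT0 : 0 < T := ht.trans_le htT
  have hoT : ENNReal.ofReal T ≠ 0 := by simpa using hT0
  have key : l' * ENNReal.ofReal T ≤
      (C * rieszBound α₁ f₁ T + C * rieszBound α₂ f₂ T) * ENNReal.ofReal T := by
    calc l' * ENNReal.ofReal T = ∫⁻ _ in A, l' := by rw [setLIntegral_const, hAT]
      _ ≤ ∫⁻ x in A, (C * rieszPotential α₁ f₁ x + C * rieszPotential α₂ f₂ x) := by
          refine setLIntegral_mono' hAm fun x hx => le_trans (le_of_lt hx) (h x)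
      _ = C * (∫⁻ x in A, rieszPotential α₁ f₁ x) + C * ∫⁻ x in A, rieszPotential α₂ f₂ x := by
          rw [lintegral_add_left ((measurable_rieszPotential hf₁).const_mul C),
            lintegral_const_mul _ (measurable_rieszPotential hf₁),
            lintegral_const_mul _ (measurable_rieszPotential hf₂)]
      _ ≤ C * (ENNReal.ofReal T * rieszBound α₁ f₁ T) +
          C * (ENNReal.ofReal T * rieszBound α₂ f₂ T) := by
          gcongr
          · exact setLIntegral_rieszPotential_le hd h₁ hf₁ hT0 hAT.le
          · exact setLIntegral_rieszPotential_le hd h₂ hf₂ hT0 hAT.le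
      _ = _ := by ring
  rw [ENNReal.mul_le_mul_iff_left hoT ofReal_ne_top] at key
  refine key.trans ?_
  gcongr
  · exact rieszBound_antitoneOn α₁ f₁ ht hT0 htT
  · exact rieszBound_antitoneOn α₂ f₂ ht hT0 htT

theorem lintegral_sum_enorm_rpow_le {p : ℝ} (hp : 1 ≤ p) {ι : Type*} [Fintype ι] {h : ι → E → ℂ}
    (hc : ∀ i, Continuous (h i)) {B : ℝ≥0∞} (hB : ∀ i, eLpNorm (h i) (ENNReal.ofReal p) ≤ B) :
    ∫⁻ x, (∑ i, ‖h i x‖ₑ) ^ p ≤ (Fintype.card ι * B) ^ p := by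
  have hp0 : 0 < p := by linarith
  have h1 : eLpNorm (∑ i, fun x => ‖h i x‖) (ENNReal.ofReal p) ≤ Fintype.card ι * B := by
    refine (eLpNorm_sum_le (fun i _ => (hc i).norm.aestronglyMeasurable) (by simpa using hp)).trans ?_
    refine (Finset.sum_le_card_nsmul _ _ B fun i _ => ?_).trans_eq ?_
    · rw [eLpNorm_norm]; exact hB i
    · simp
  rw [eLpNorm_eq_lintegral_rpow_enorm_toReal (by simpa using hp0) ofReal_ne_top,
    ENNReal.toReal_ofReal hp0.le, one_div] at h1
  have h2 := (ENNReal.rpow_inv_le_iff hp0).1 h1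
  refine le_trans (le_of_eq ?_) h2
  refine lintegral_congr fun x => ?_
  congr 1
  rw [Finset.sum_apply, ← ofReal_norm, Real.norm_of_nonneg (by positivity),
    ENNReal.ofReal_sum_of_nonneg fun i _ => norm_nonneg _]
  simp

theorem rieszPotential_eq_zero {α p : ℝ} (hp : 0 < p) {f : E → ℝ≥0∞} (hf : Measurable f)
    (h : ∫⁻ x, f x ^ p = 0) (x : E) : rieszPotential α f x = 0 := by
  rw [lintegral_eq_zero_iff (hf.pow_const p)] at h
  unfold rieszPotential
  rw [lintegral_eq_zero_iff (by fun_prop)]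
  filter_upwards [h] with y hy
  have : f y = 0 := by simpa [hp, hp.le, hp.not_gt] using hy
  simp [this]

theorem lorentzNorm_zero {d : ℕ} {m q : ℝ} (hq : 1 < q) :
    lorentzNorm m q (fun _ : EuclideanSpace ℝ (Fin d) => 0) = 0 := by
  have h0 : ∀ t : ℝ, 0 < t →
      decreasingRearrangement (fun _ : EuclideanSpace ℝ (Fin d) => (0 : ℝ)) t = 0 := fun t ht =>
    le_antisymm (sInf_le (by simpa [mem_ofPred_eq] using ht)) bot_le
  have h1 : ∀ t : ℝ, 0 < t →
      maximalRearrangement (fun _ : EuclideanSpace ℝ (Fin d) => (0 : ℝ)) t = 0 := fun t ht => by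
    unfold maximalRearrangement
    rw [setLIntegral_congr_fun measurableSet_Ioo fun s hs => h0 s hs.1]
    simp
  unfold lorentzNorm
  rw [setLIntegral_congr_fun (g := fun _ => 0) measurableSet_Ioi fun t ht => by
    simp [h1 t ht, zero_lt_one.trans hq]]
  simp [zero_lt_one.trans hq]

/-- Qualitative finiteness, needed because the Wiener lemma works by absorption; it also puts the
fractional gradient in `L^p`. -/
theorem eLpNorm_fourierInv_fourier_mul_fourier_ne_top {p : ℝ} (hp : 1 < p) {k u : E → ℂ}
    (hk : Integrable k) (hu : ContDiff ℝ ∞ u) (hc : HasCompactSupport u) :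
    eLpNorm (𝓕⁻ fun ξ => 𝓕 k ξ * 𝓕 u ξ) (ENNReal.ofReal p) ≠ ⊤ := by
  refine ne_top_of_le_ne_top ?_
    (eLpNorm_fourierInv_fourier_mul_le hp hk (integrable_fourier_of_contDiff hu hc))
  rw [fourierInv_fourier_of_contDiff hu hc]
  exact mul_ne_top hk.2.ne (hu.continuous.memLp_of_hasCompactSupport hc).2.ne

end Final

/-! ### The estimate of a test function by its fractional gradient -/

section Estimate

open Module ENNReal FourierTransform Real

variable {E : Type*} [NormedAddCommGroup E]

theorem HasCompactSupport.ofReal_comp {u : E → ℝ} (hc : HasCompactSupport u) :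
    HasCompactSupport fun x => (u x : ℂ) :=
  hc.comp_left (g := fun t : ℝ => (t : ℂ)) Complex.ofReal_zero

variable [InnerProductSpace ℝ E]

theorem contDiff_ofReal_comp {u : E → ℝ} (hu : ContDiff ℝ ∞ u) :
    ContDiff ℝ ∞ fun x => (u x : ℂ) :=
  Complex.ofRealCLM.contDiff.comp hu

theorem fderiv_ofReal_comp_apply {u : E → ℝ} (hu : ContDiff ℝ ∞ u) (x e : E) :
    fderiv ℝ (fun x => (u x : ℂ)) x e = (fderiv ℝ u x e : ℂ) := by
  have h := (Complex.ofRealCLM.hasFDerivAt (x := u x)).comp x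
    (hu.differentiable (by simp) x).hasFDerivAt
  have h' : HasFDerivAt (fun x => (u x : ℂ)) (Complex.ofRealCLM.comp (fderiv ℝ u x)) x := h
  rw [h'.fderiv]
  rfl

variable [FiniteDimensional ℝ E] [MeasurableSpace E] [BorelSpace E]

theorem integrable_norm_mul_norm_fourier {u : E → ℂ} (hu : ContDiff ℝ ∞ u)
    (hc : HasCompactSupport u) : Integrable fun ξ => ‖ξ‖ * ‖𝓕 u ξ‖ := by
  have h := (𝓕 (hc.toSchwartzMap hu) : SchwartzMap E ℂ).integrable_pow_mul volume 1
  simp only [pow_one] at h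
  exact h

theorem eLpNorm_inner_neg_integral_gradient_le {p : ℝ≥0∞} {g u : E → ℝ} {e : E} (he : ‖e‖ = 1) :
    eLpNorm (fun x => ((inner ℝ (-∫ y, (u x - u y) • gradient g (x - y)) e : ℝ) : ℂ)) p ≤
      eLpNorm (fun x => -∫ y, (u x - u y) • gradient g (x - y)) p := by
  refine eLpNorm_mono fun x => ?_
  rw [Complex.norm_real]
  simpa [he] using norm_inner_le_norm (𝕜 := ℝ) (-∫ y, (u x - u y) • gradient g (x - y)) e

namespace IsRieszLikeKernel

variable {m a r α C : ℝ} {g : E → ℝ} (hg : IsRieszLikeKernel m a r α C g)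
include hg

/-- The convolution formula read on the Fourier side, where the symbol of the kernel can be divided
out. -/
theorem inner_neg_integral_gradient_eq_fourierInv (hn : 2 ≤ finrank ℝ E) (hm : m < finrank ℝ E)
    (hα : finrank ℝ E < α) {u : E → ℝ} (hu : ContDiff ℝ ∞ u) (hc : HasCompactSupport u) (x e : E) :
    ((inner ℝ (-∫ y, (u x - u y) • gradient g (x - y)) e : ℝ) : ℂ) =
      𝓕⁻ (fun ξ => 𝓕 (fun x => (g x : ℂ)) ξ *
        𝓕 (fun x => fderiv ℝ (fun x => (u x : ℂ)) x e) ξ) x := by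
  have hv := contDiff_fderiv_apply_of_contDiff (contDiff_ofReal_comp hu) e
  have hvc := HasCompactSupport.fderiv_apply_const hc.ofReal_comp e
  have hgi : Integrable fun x => (g x : ℂ) := (hg.integrable (by lia) hm hα).ofReal
  rw [fourierInv_fourier_mul hgi (integrable_fourier_of_contDiff hv hvc), fourierInv_fourier_of_contDiff hv hvc,
    hg.inner_neg_integral_gradient hn hm hα hu hc, ← integral_complex_ofReal]
  refine integral_congr_ae (.of_forall fun y => ?_)
  simp [fderiv_ofReal_comp_apply hu]

theorem memLp_neg_integral_gradient (hn : 2 ≤ finrank ℝ E) (hm : m < finrank ℝ E)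
    (hα : finrank ℝ E < α) {p : ℝ} (hp : 1 < p) {u : E → ℝ} (hu : ContDiff ℝ ∞ u)
    (hc : HasCompactSupport u) :
    MemLp (fun x => -∫ y, (u x - u y) • gradient g (x - y)) (ENNReal.ofReal p) := by
  have hcomp : ∀ e : E, MemLp (fun x =>
      ((inner ℝ (-∫ y, (u x - u y) • gradient g (x - y)) e : ℝ) : ℂ)) (ENNReal.ofReal p) := by
    intro e
    have hv := contDiff_fderiv_apply_of_contDiff (contDiff_ofReal_comp hu) e
    have hvc := HasCompactSupport.fderiv_apply_const hc.ofReal_comp e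
    have hgi := (hg.integrable (by lia) hm hα).ofReal (𝕜 := ℂ)
    simp_rw [hg.inner_neg_integral_gradient_eq_fourierInv hn hm hα hu hc]
    refine ⟨(continuous_fourierInv_of_integrable (Integrable.fourier_mul hgi
      (integrable_fourier_of_contDiff hv hvc))).aestronglyMeasurable, ?_⟩
    exact (eLpNorm_fourierInv_fourier_mul_fourier_ne_top hp hgi hv hvc).lt_top
  have hsum : (fun x => -∫ y, (u x - u y) • gradient g (x - y)) = fun x =>
      ∑ i, (inner ℝ (-∫ y, (u x - u y) • gradient g (x - y)) (stdOrthonormalBasis ℝ E i) : ℝ) •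
        stdOrthonormalBasis ℝ E i := by
    funext x
    conv_lhs => rw [← (stdOrthonormalBasis ℝ E).sum_repr' (-∫ y, (u x - u y) • gradient g (x - y))]
    exact Finset.sum_congr rfl fun i _ => by rw [real_inner_comm]
  rw [hsum]
  refine memLp_finsetSum _ fun i _ => ?_
  have h := (hcomp (stdOrthonormalBasis ℝ E i)).re
  simp only [RCLike.re_eq_complex_re, Complex.ofReal_re] at h
  exact (ContinuousLinearMap.toSpanSingleton ℝ (stdOrthonormalBasis ℝ E i)).comp_memLp' h

/-- A test function is dominated by Riesz potentials of orders `1` and `s` of functions whose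
`L^p` norms are controlled by that of the fractional gradient. -/
theorem exists_enorm_le_rieszPotential_add (hn : 2 ≤ finrank ℝ E) {s p : ℝ} (hs0 : 0 < s)
    (hs1 : s < 1) (hp : 1 < p) (hm : m = finrank ℝ E - 1 + s) (hα : finrank ℝ E < α)
    (h0 : ∀ ξ, 𝓕 (fun x => (g x : ℂ)) ξ ≠ 0) :
    ∃ C : ℝ≥0∞, C ≠ ⊤ ∧ ∀ u : E → ℝ, ContDiff ℝ ∞ u → HasCompactSupport u →
      ∃ f₁ f₂ : E → ℝ≥0∞, Measurable f₁ ∧ Measurable f₂ ∧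
        ∫⁻ x, f₁ x ^ p ≤ C * eLpNorm (fun x => -∫ y, (u x - u y) • gradient g (x - y))
          (ENNReal.ofReal p) ^ p ∧
        ∫⁻ x, f₂ x ^ p ≤ C * eLpNorm (fun x => -∫ y, (u x - u y) • gradient g (x - y))
          (ENNReal.ofReal p) ^ p ∧
        ∀ x, ‖u x‖ₑ ≤ C * rieszPotential 1 f₁ x + C * rieszPotential s f₂ x := by
  have hp0 : 0 < p := by linarith
  -- The value for which `m = d - 1 + s` equals `d - 2 β`.
  set β : ℝ := (1 - s) / 2 with hβ
  have hβ0 : 0 < β := by rw [hβ]; linarith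
  have hβ1 : β < 1 / 2 := by rw [hβ]; linarith
  have hm' : m < finrank ℝ E := by rw [hm]; linarith
  obtain ⟨σ, c, hσ, hc0, hsymb⟩ := hg.exists_symbol hn hβ0 hβ1 (by rw [hm, hβ]; ring) hα
  obtain ⟨C₃, hC₃, H₃⟩ := exists_eLpNorm_fourierInv_le_of_ne_zero hp hσ hc0
    fun ξ h => h0 ξ (by rw [hsymb, h, mul_zero])
  set b := stdOrthonormalBasis ℝ E with hb
  obtain ⟨C₄, hC₄, H₄⟩ := _root_.exists_enorm_le_rieszPotential_add hn hs0 hs1 hp b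
  set n : ℝ≥0∞ := (Fintype.card (Fin (finrank ℝ E)) : ℝ≥0∞) with hn'
  have hnt : n ≠ ⊤ := natCast_ne_top _
  have hA : (n * (C₄ * C₃)) ^ p ≠ ⊤ :=
    rpow_ne_top_of_nonneg hp0.le (mul_ne_top hnt (mul_ne_top hC₄ hC₃))
  have hB : (n * C₃) ^ p ≠ ⊤ := rpow_ne_top_of_nonneg hp0.le (mul_ne_top hnt hC₃)
  refine ⟨(n * (C₄ * C₃)) ^ p + (n * C₃) ^ p + C₄, by simp [hA, hB, hC₄], fun u hu hc => ?_⟩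
  set N := eLpNorm (fun x => -∫ y, (u x - u y) • gradient g (x - y)) (ENNReal.ofReal p) with hN
  set v : E → ℂ := fun x => (u x : ℂ) with hv
  have hvd : ContDiff ℝ ∞ v := contDiff_ofReal_comp hu
  have hvc : HasCompactSupport v := hc.ofReal_comp
  have hed := fun i => contDiff_fderiv_apply_of_contDiff hvd (b i)
  have hec := fun i => HasCompactSupport.fderiv_apply_const hvc (b i)
  set ψ : Fin (finrank ℝ E) → E → ℂ := fun i ξ =>
    (((1 + ‖ξ‖ ^ 2) ^ (-β) : ℝ) : ℂ) * 𝓕 (fun x => fderiv ℝ v x (b i)) ξ with hψ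
  have hψi : ∀ i, Integrable (ψ i) := fun i =>
    integrable_rpow_mul hβ0.le (integrable_fourier_of_contDiff (hed i) (hec i))
  have hψt : ∀ i, eLpNorm (𝓕⁻ (ψ i)) (ENNReal.ofReal p) ≠ ⊤ := by
    intro i
    have hk : Integrable fun x => ((Gamma β : ℂ)⁻¹) * (bessel β : E → ℂ) x :=
      (integrable_bessel hβ0).const_mul _
    have hψ' : ψ i = fun ξ => 𝓕 (fun x => ((Gamma β : ℂ)⁻¹) * (bessel β : E → ℂ) x) ξ *
        𝓕 (fun x => fderiv ℝ v x (b i)) ξ := by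
      funext ξ
      rw [fourier_const_mul, fourier_bessel hβ0, Complex.ofReal_mul, ← mul_assoc, inv_mul_cancel₀
        (by exact_mod_cast (Gamma_pos_of_pos hβ0).ne'), one_mul]
    rw [hψ']
    exact eLpNorm_fourierInv_fourier_mul_fourier_ne_top hp hk (hed i) (hec i)
  -- Multiplying `ψ i` by `c + 𝓕 σ` restores the transform of `g` times that of `∂_i u`, which is
  -- the `i`-th component of the fractional gradient.
  have hψN : ∀ i, eLpNorm (𝓕⁻ (ψ i)) (ENNReal.ofReal p) ≤ C₃ * N := by
    intro i
    refine (H₃ _ (hψi i) (hψt i)).trans ?_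
    gcongr
    refine le_trans (le_of_eq ?_)
      (eLpNorm_inner_neg_integral_gradient_le (b.norm_eq_one i))
    congr 1
    funext x
    rw [hg.inner_neg_integral_gradient_eq_fourierInv hn hm' hα hu hc]
    refine congrArg (fun F : E → ℂ => 𝓕⁻ F x) (funext fun ξ => ?_)
    rw [hsymb]
    ring
  obtain ⟨h, hh, hhN, hu'⟩ := H₄ (𝓕 v) (integrable_fourier_of_contDiff hvd hvc)
    (integrable_norm_mul_norm_fourier hvd hvc) ψ hψi
    fun i ξ => by rw [hψ]; simp only; rw [fourier_fderiv_apply hn hvd hvc]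
  have hfc : ∀ i, Continuous (𝓕⁻ (ψ i)) := fun i => continuous_fourierInv_of_integrable (hψi i)
  refine ⟨fun y => ∑ i, ‖h i y‖ₑ, fun y => ∑ i, ‖𝓕⁻ (ψ i) y‖ₑ,
    (continuous_finsetSum _ fun i _ => (hh i).enorm).measurable,
    (continuous_finsetSum _ fun i _ => (hfc i).enorm).measurable, ?_, ?_, fun x => ?_⟩
  · refine (lintegral_sum_enorm_rpow_le hp.le hh (B := C₄ * C₃ * N) fun i => ?_).trans ?_
    · rw [mul_assoc]
      exact (hhN i).trans (by gcongr; exact hψN i)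
    · rw [← mul_assoc, mul_rpow_of_nonneg _ _ hp0.le, ← hn']
      gcongr
      rw [add_assoc]
      exact le_self_add
  · refine (lintegral_sum_enorm_rpow_le hp.le hfc hψN).trans ?_
    rw [← mul_assoc, mul_rpow_of_nonneg _ _ hp0.le, ← hn']
    gcongr
    rw [add_right_comm]
    exact le_add_self
  · have := hu' x
    rw [fourierInv_fourier_of_contDiff hvd hvc, ← ofReal_norm, hv, Complex.norm_real,
      ofReal_norm] at this
    refine this.trans ?_
    gcongr <;> exact le_add_self

end IsRieszLikeKernel

end Estimate

/-! ### The theorem -/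

open ENNReal in
theorem mainTheorem5 (d : ℕ) (hd : 3 ≤ d) (s p : ℝ) (hs0 : 0 < s) (hs1 : s < 1)
    (hp1 : 1 < p) (hpd : p < d)
    (g : EuclideanSpace ℝ (Fin d) → ℝ)
    (hg : IsLocalizedKernel d s g ∨ IsIntegrableTailKernel d s g)
    (hpos : PositivityAssumption d g) :
    ∃ C : ℝ, 0 < C ∧
      ∀ u : EuclideanSpace ℝ (Fin d) → ℝ, ContDiff ℝ ∞ u → HasCompactSupport u →
        (∀ x, Integrable (fracGradientIntegrand g u x)) ∧
        MemLp (fracGradient g u) (ENNReal.ofReal p) ∧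
        ∃ k : ℝ, 0 ≤ k ∧
          ENNReal.ofReal k = eLpNorm (fracGradient g u) (ENNReal.ofReal p) volume ∧
          lorentzNorm (p * d / (d - s * p)) p (fun x => truncG k (u x)) +
              lorentzNorm (p * d / (d - p)) p (fun x => truncT k (u x)) ≤
            ENNReal.ofReal C * eLpNorm (fracGradient g u) (ENNReal.ofReal p) volume := by
  have hfin : Module.finrank ℝ (EuclideanSpace ℝ (Fin d)) = d := by simp
  have hd' : (3 : ℝ) ≤ d := by exact_mod_cast hd
  have hp0 : 0 < p := by linarith
  have hg1 : ContDiffOn ℝ 1 g {0}ᶜ := hpos.smooth.of_le (by simp)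
  obtain ⟨m, a, r, α, K, hm, hα, hK⟩ : ∃ m a r α K : ℝ, m = d - 1 + s ∧ d < α ∧
      IsRieszLikeKernel m a r α K g := by
    rcases hg with ⟨r, R, hr, -, h0, h1⟩ | ⟨α, a, b, r, R, hα, ha, -, hr, -, h0, h1⟩
    -- A localized kernel is treated as having a tail with coefficient zero; the exponent `d + 1` is
    -- an arbitrary choice above `d`.
    · obtain ⟨K, hK⟩ := exists_isRieszLikeKernel (m := d - 1 + s) (b := 0) (α := d + 1)
        (by linarith) one_pos hr (by linarith) hg1 h0 fun x hx => by rw [h1 x hx, zero_div]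
      exact ⟨_, _, _, _, K, rfl, by linarith, hK⟩
    · obtain ⟨K, hK⟩ := exists_isRieszLikeKernel (m := d - 1 + s) (by linarith) ha hr
        (by linarith) hg1 h0 h1
      exact ⟨_, _, _, _, K, rfl, hα, hK⟩
  rw [← hfin] at hm hα
  have hn2 : 2 ≤ Module.finrank ℝ (EuclideanSpace ℝ (Fin d)) := by rw [hfin]; lia
  have hn0 := (one_pos.trans_le (one_le_two.trans hn2))
  have hm' : m < Module.finrank ℝ (EuclideanSpace ℝ (Fin d)) := by rw [hm]; linarith
  have hne := hK.fourier_ne_zero hn0 hs0 hs1 hm hα hpos.radial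
    (by rw [hfin]; exact hpos.antitone) (by rw [hfin]; exact hpos.convex)
  obtain ⟨C, hC, HC⟩ := hK.exists_enorm_le_rieszPotential_add hn2 hs0 hs1 hp1 hm hα hne
  -- The exponents `1/p - 1/d` and `1/p - s/d` are the reciprocals of the two Lorentz indices; `p <
  -- d` makes the smaller one positive.
  have ha₂ : 0 < 1 / p - 1 / (d : ℝ) := by
    rw [sub_pos]
    exact one_div_lt_one_div_of_lt hp0 hpd
  have h21 : 1 / p - 1 / (d : ℝ) < 1 / p - s / d := by
    gcongr
  have ha₁ : 1 / p - s / (d : ℝ) < 1 := by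
    have : 1 / p < 1 := by rw [div_lt_one hp0]; exact hp1
    have : 0 < s / (d : ℝ) := by positivity
    linarith
  obtain ⟨D₁, hD₁, HD₁⟩ := exists_lintegral_rieszBound_le
    (E := EuclideanSpace ℝ (Fin d)) hn0 one_pos hp1 (by rw [hfin]; exact ha₂)
  obtain ⟨D₂, hD₂, HD₂⟩ := exists_lintegral_rieszBound_le
    (E := EuclideanSpace ℝ (Fin d)) hn0 hs0 hp1 (by rw [hfin]; exact ha₂.trans h21)
  rw [hfin] at HD₁ HD₂
  have hCp : C ^ p ≠ ⊤ := rpow_ne_top_of_nonneg hp0.le hC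
  obtain ⟨M, hM, HM⟩ := exists_lorentzNorm_trunc_le hp1 ha₂ h21 ha₁
    (A := C ^ p * (D₂ * C) + C ^ p * (D₁ * C)) (by finiteness)
  refine ⟨M.toReal + 1, by positivity, fun u hu hc => ?_⟩
  have hmem : MemLp (fracGradient g u) (ENNReal.ofReal p) :=
    hK.memLp_neg_integral_gradient hn2 hm' hα hp1 hu hc
  refine ⟨hK.integrable_sub_smul_gradient hn0 hm' hα hu hc, hmem,
    (eLpNorm (fracGradient g u) (ENNReal.ofReal p) volume).toReal, by positivity,
    ofReal_toReal hmem.2.ne, ?_⟩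
  obtain ⟨f₁, f₂, hf₁, hf₂, hN₁, hN₂, hle⟩ := HC u hu hc
  change ∫⁻ x, f₁ x ^ p ≤ C * eLpNorm (fracGradient g u) _ _ ^ p at hN₁
  change ∫⁻ x, f₂ x ^ p ≤ C * eLpNorm (fracGradient g u) _ _ ^ p at hN₂
  set N := eLpNorm (fracGradient g u) (ENNReal.ofReal p) volume with hN
  have hNt : N ≠ ⊤ := hmem.2.ne
  have he₁ : p * d / (d - s * p) = 1 / (1 / p - s / (d : ℝ)) := by
    field_simp
  have he₂ : p * d / (d - p) = 1 / (1 / p - 1 / (d : ℝ)) := by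
    field_simp
  rw [he₁, he₂]
  -- The truncation lemma needs a positive level. If the fractional gradient has norm zero, both
  -- Riesz potentials vanish and so does `u`.
  rcases eq_or_ne N 0 with h0 | h0
  · have hu0 : u = fun _ => 0 := by
      funext x
      have := hle x
      rw [rieszPotential_eq_zero hp0 hf₁ (by simpa [h0, hp0] using hN₁),
        rieszPotential_eq_zero hp0 hf₂ (by simpa [h0, hp0] using hN₂)] at this
      simpa using this
    simp [h0, hu0, truncG, truncT, lorentzNorm_zero hp1]
  · have hk0 : 0 < N.toReal := toReal_pos h0 hNt
    have hkN : ENNReal.ofReal N.toReal = N := ofReal_toReal hNt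
    have hbd : ∀ (e β : ℝ) (D : ℝ≥0∞) (f : EuclideanSpace ℝ (Fin d) → ℝ≥0∞),
        ∫⁻ x, f x ^ p ≤ C * N ^ p →
        ∫⁻ t, (ENNReal.ofReal t ^ e * rieszBound β f t) ^ p ∂haarPos ≤ D * ∫⁻ x, f x ^ p →
        ∫⁻ t, (ENNReal.ofReal t ^ e * (C * rieszBound β f t)) ^ p ∂haarPos ≤
          C ^ p * (D * C) * N ^ p := by
      intro e β D f h1 h2
      simp_rw [mul_left_comm _ C, mul_rpow_of_nonneg C _ hp0.le]
      rw [lintegral_const_mul' _ _ hCp, mul_assoc, mul_assoc]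
      gcongr
      exact h2.trans (by gcongr)
    -- The potential of order `s` goes with the larger exponent `a₁`, hence takes the place of `Ψ₁`;
    -- the one of order `1` takes that of `Ψ₂`.
    refine (HM d u N.toReal hk0 (fun t => C * rieszBound s f₂ t) (fun t => C * rieszBound 1 f₁ t)
      (fun x hx y hy hxy => ?_) (fun x hx y hy hxy => ?_) (fun t ht => ?_) ?_ ?_).trans ?_
    · exact mul_le_mul_right (rieszBound_antitoneOn _ _ hx hy hxy) C
    · exact mul_le_mul_right (rieszBound_antitoneOn _ _ hx hy hxy) C
    · rw [add_comm]
      refine rearr_le_rieszBound hn0 (by rw [hfin]; linarith) (by rw [hfin]; linarith) hf₁ hf₂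
        hu.continuous.enorm.measurable ?_ hle ht
      refine ne_top_of_le_ne_top hc.isCompact.measure_lt_top.ne (measure_mono fun x hx => ?_)
      refine subset_tsupport _ ?_
      simpa using hx
    · rw [hkN]
      refine (hbd _ _ D₂ f₂ hN₂ (HD₂ f₂ hf₂)).trans ?_
      gcongr
      exact le_self_add
    · rw [hkN]
      refine (hbd _ _ D₁ f₁ hN₁ (HD₁ f₁ hf₁)).trans ?_
      gcongr
      exact le_add_self
    · rw [hkN]
      gcongr
      rw [← ofReal_toReal hM]
      exact ofReal_le_ofReal (by simp)
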